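/- A function $q_0\in C^1(0,\infty)$ is called \emph{repulsive} if $q_0(x)>0$ and $q_0'(x)<0$ for all $x>0$ and $q_0(x)\to 0$ as $x\to\infty$. It satisfies the \emph{growth condition at zero} if there is $\kappa\in(0,2)$ such that $|q_0(x)|\lesssim x^{-\kappa}$ and $|q_0'(x)|\lesssim x^{-\kappa-1}$ for all $x>0$ near $0$. For $j=1,2$ let $\lambda_j\in\{0\}\cup[3/4,\infty)$, let $q_{0,j}$ be a repulsive potential satisfying the growth condition at zero, let $q_j(x)=\lambda_j x^{-2}+q_{0,j}(x)$, and let $\mathbf A_j=-\frac{d^2}{dx^2}+q_j(x)$ be the positive self-adjoint operator on the complex space $L^2(\mathbb R^+)$, $\mathbb R^+=(0,\infty)$, with zero boundary condition. That is, $D(\mathbf A_j)$ consists of all $w\in L^2(\mathbb R^+)$ such that $w,w'$ are locally absolutely continuous on $(0,\infty)$, $-w''+q_jw\in L^2(\mathbb R^+)$, and \begin{itemize} \item if $\lambda_j=0$: $w''\in L^1(0,1)\cap L^2(1,\infty)$ and $w(0)=0$; \item if $\lambda_j\ge 3/4$: $w''\in L^p(0,1)\cap L^2(1,\infty)$ for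 all $1\le p<2$, and $w(0)=w'(0)=0$; \end{itemize} where boundary values are limits as $x\to0^+$. Let $$\dot{\mathcal H}^1_j=\Big\{w\in\dot H^1(\mathbb R^+):\ w(0)=0,\ \|w\|_{\dot{\mathcal H}^1_j}^2=\int_0^\infty\big(|w'|^2+q_j|w|^2\big)\,dx<\infty\Big\},$$ and give $\dot{\mathcal H}^1_j\times L^2(\mathbb R^+)$ the norm $\|(w_0,w_1)\|^2=\|w_0\|_{\dot{\mathcal H}^1_j}^2+\|w_1\|_{L^2}^2$. Let $\vec{\mathbf S}_j(t)$ be the wave propagation operator of $w_{tt}+\mathbf A_jw=0$ on $\dot{\mathcal H}^1_j\times L^2(\mathbb R^+)$, i.e. the continuous extension of the operator given on $D(\mathbf A_j)\times D(\mathbf A_j)$ by the functional calculus $$\vec{\mathbf S}_j(t)=\begin{pmatrix}\cos(t\mathbf A_j^{1/2})&\mathbf A_j^{-1/2}\sin(t\mathbf A_j^{1/2})\\-\mathbf A_j^{1/2}\sin(t\mathbf A_j^{1/2})&\cos(t\mathbf A_j^{1/2})\end{pmatrix}.$$ \textbf{Proposition.} Suppose there is $R>0$ such that $q_1(x)=q_2(x)$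 for all $x>R$. Then $\dot{\mathcal H}^1_1$ and $\dot{\mathcal H}^1_2$ consist of the same functions and have equivalent norms, so that $\vec{\mathbf S}_2(-t)\vec{\mathbf S}_1(t)$ is well defined, and the strong limit $$\mathbf T=\mathop{\mathrm{s\text{-}lim}}_{t\to+\infty}\vec{\mathbf S}_2(-t)\vec{\mathbf S}_1(t)$$ exists in $\dot{\mathcal H}^1_2\times L^2(\mathbb R^+)$ and is a linear isometric isomorphism from $\dot{\mathcal H}^1_1\times L^2(\mathbb R^+)$ onto $\dot{\mathcal H}^1_2\times L^2(\mathbb R^+)$. -/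

import Mathlib

open MeasureTheory Set Filter Topology Asymptotics

namespace HalfLineWave

/-- Lebesgue measure on the half line `(0, ∞)`. -/
noncomputable abbrev halfLine : Measure ℝ := volume.restrict (Ioi (0 : ℝ))

/-- The complex Hilbert space `L²(0, ∞)`. -/
abbrev HL2 : Type := Lp ℂ 2 halfLine

/-! ### Potentials -/

/-- A potential on the half line is repulsive if it is `C¹`, positive, has negative derivative and
tends to zero at infinity. -/
structure IsRepulsive (q : ℝ → ℝ) : Prop where
  contDiffOn : ContDiffOn ℝ 1 q (Ioi 0)
  pos : ∀ x, 0 < x → 0 < q x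
  deriv_neg : ∀ x, 0 < x → deriv q x < 0
  tendsto_zero : Tendsto q atTop (𝓝 0)

/-- The growth condition at zero: `|q(x)| ≲ x^{-κ}` and `|q'(x)| ≲ x^{-κ-1}` near zero, for some
`0 < κ < 2`. -/
def GrowthAtZero (q : ℝ → ℝ) : Prop :=
  ∃ κ : ℝ, 0 < κ ∧ κ < 2 ∧
    (q =O[𝓝[>] 0] fun x => x ^ (-κ)) ∧ (deriv q =O[𝓝[>] 0] fun x => x ^ (-κ - 1))

/-- The total potential `λ x⁻² + q₀(x)`. -/
noncomputable def potential (lam : ℝ) (q₀ : ℝ → ℝ) (x : ℝ) : ℝ := lam / x ^ 2 + q₀ x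

/-! ### The operator `A = -d²/dx² + λ x⁻² + q₀` with zero boundary condition -/

/-- `u` is in `AC²(0, ∞)` with `u' = v` and `u'' = z`, and satisfies the integrability conditions on
`u''` and the boundary conditions at zero which define the domain of `A`: for `λ = 0`,
`u'' ∈ L¹(0,1) ∩ L²(1,∞)` and `u(0) = 0`; otherwise `u'' ∈ Lᵖ(0,1) ∩ L²(1,∞)` for all `1 ≤ p < 2`
and `u(0) = u'(0) = 0`. -/
structure DomainConditions (lam : ℝ) (u v z : ℝ → ℂ) : Prop where
  hasDerivAt : ∀ x, 0 < x → HasDerivAt u (v x) x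
  locallyIntegrable : LocallyIntegrableOn z (Ioi 0)
  sub_eq_integral : ∀ a b, 0 < a → a ≤ b → v b - v a = ∫ x in a..b, z x
  memLp_one : MemLp z 1 (volume.restrict (Ioo 0 1))
  memLp_two : MemLp z 2 (volume.restrict (Ioi 1))
  tendsto_zero : Tendsto u (𝓝[>] 0) (𝓝 0)
  memLp_of_ne : lam ≠ 0 → ∀ p : ENNReal, 1 ≤ p → p < 2 → MemLp z p (volume.restrict (Ioo 0 1))
  tendsto_deriv_of_ne : lam ≠ 0 → Tendsto v (𝓝[>] 0) (𝓝 0)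

lemma DomainConditions.intervalIntegrable {lam : ℝ} {u v z : ℝ → ℂ}
    (h : DomainConditions lam u v z) {a b : ℝ} (ha : 0 < a) (hab : a ≤ b) :
    IntervalIntegrable z volume a b := by
  rw [intervalIntegrable_iff_integrableOn_Icc_of_le hab]
  exact h.locallyIntegrable.integrableOn_compact_subset
    (fun x hx => lt_of_lt_of_le ha hx.1) isCompact_Icc

lemma DomainConditions.zero (lam : ℝ) :
    DomainConditions lam (fun _ => 0) (fun _ => 0) (fun _ => 0) where
  hasDerivAt x _ := hasDerivAt_const x 0
  locallyIntegrable := (locallyIntegrable_zero (μ := volume)).locallyIntegrableOn _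
  sub_eq_integral a b _ _ := by simp
  memLp_one := MemLp.zero'
  memLp_two := MemLp.zero'
  tendsto_zero := tendsto_const_nhds
  memLp_of_ne _ p _ _ := MemLp.zero'
  tendsto_deriv_of_ne _ := tendsto_const_nhds

lemma DomainConditions.add {lam : ℝ} {u v z u' v' z' : ℝ → ℂ}
    (h : DomainConditions lam u v z) (h' : DomainConditions lam u' v' z') :
    DomainConditions lam (u + u') (v + v') (z + z') where
  hasDerivAt x hx := (h.hasDerivAt x hx).add (h'.hasDerivAt x hx)
  locallyIntegrable := h.locallyIntegrable.add h'.locallyIntegrable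
  sub_eq_integral a b ha hab := by
    have := intervalIntegral.integral_add (h.intervalIntegrable ha hab)
      (h'.intervalIntegrable ha hab)
    simp only [Pi.add_apply]
    rw [this, ← h.sub_eq_integral a b ha hab, ← h'.sub_eq_integral a b ha hab]
    ring
  memLp_one := h.memLp_one.add h'.memLp_one
  memLp_two := h.memLp_two.add h'.memLp_two
  tendsto_zero := add_zero (0 : ℂ) ▸ h.tendsto_zero.add h'.tendsto_zero
  memLp_of_ne hl p hp hp' := (h.memLp_of_ne hl p hp hp').add (h'.memLp_of_ne hl p hp hp')
  tendsto_deriv_of_ne hl :=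
    add_zero (0 : ℂ) ▸ (h.tendsto_deriv_of_ne hl).add (h'.tendsto_deriv_of_ne hl)

lemma DomainConditions.smul {lam : ℝ} {u v z : ℝ → ℂ} (c : ℂ)
    (h : DomainConditions lam u v z) : DomainConditions lam (c • u) (c • v) (c • z) where
  hasDerivAt x hx := (h.hasDerivAt x hx).const_smul c
  locallyIntegrable := h.locallyIntegrable.smul c
  sub_eq_integral a b ha hab := by
    simp only [Pi.smul_apply, intervalIntegral.integral_smul]
    rw [← h.sub_eq_integral a b ha hab, smul_sub]
  memLp_one := h.memLp_one.const_smul c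
  memLp_two := h.memLp_two.const_smul c
  tendsto_zero := by
    have := h.tendsto_zero.const_smul c
    rwa [smul_zero] at this
  memLp_of_ne hl p hp hp' := (h.memLp_of_ne hl p hp hp').const_smul c
  tendsto_deriv_of_ne hl := by
    have := (h.tendsto_deriv_of_ne hl).const_smul c
    rwa [smul_zero] at this

/-- The graph `{(w, A w)}` in `L² × L²`: all pairs of `L²` functions `w = u` and `-u'' + q u`, with
`u` as in `DomainConditions`. -/
noncomputable def operatorGraph (lam : ℝ) (q₀ : ℝ → ℝ) : Submodule ℂ (HL2 × HL2) where
  carrier := {p | ∃ u v z : ℝ → ℂ, DomainConditions lam u v z ∧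
    (p.1 =ᵐ[halfLine] u) ∧
    (p.2 =ᵐ[halfLine] fun x => -z x + (potential lam q₀ x : ℂ) * u x)}
  zero_mem' := ⟨_, _, _, DomainConditions.zero lam, Lp.coeFn_zero _ _ _, by
    filter_upwards [Lp.coeFn_zero ℂ 2 halfLine] with x hx
    simpa using hx⟩
  add_mem' := by
    rintro p p' ⟨u, v, z, h, h1, h2⟩ ⟨u', v', z', h', h1', h2'⟩
    refine ⟨_, _, _, h.add h', ?_, ?_⟩
    · filter_upwards [h1, h1', Lp.coeFn_add p.1 p'.1] with x e1 e2 e3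
      simp only [Prod.fst_add, e3, Pi.add_apply, e1, e2]
    · filter_upwards [h2, h2', Lp.coeFn_add p.2 p'.2] with x e1 e2 e3
      simp only [Prod.snd_add, e3, Pi.add_apply, e1, e2]
      ring
  smul_mem' := by
    rintro c p ⟨u, v, z, h, h1, h2⟩
    refine ⟨_, _, _, h.smul c, ?_, ?_⟩
    · filter_upwards [h1, Lp.coeFn_smul c p.1] with x e1 e3
      simp only [Prod.smul_fst, e3, Pi.smul_apply, e1]
    · filter_upwards [h2, Lp.coeFn_smul c p.2] with x e1 e3
      simp only [Prod.smul_snd, e3, Pi.smul_apply, e1, smul_eq_mul]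
      ring

/-- The unbounded operator `A = -d²/dx² + λ x⁻² + q₀` on `L²(0, ∞)` with zero boundary condition. -/
noncomputable def halfLineOperator (lam : ℝ) (q₀ : ℝ → ℝ) : HL2 →ₗ.[ℂ] HL2 :=
  (operatorGraph lam q₀).toLinearPMap

/-! ### Functional calculus of a positive self-adjoint operator -/

open Classical in
/-- The bounded operator `(1 + A)⁻¹`. -/
noncomputable def shiftedInverse {H : Type*} [NormedAddCommGroup H] [InnerProductSpace ℂ H]
    (A : H →ₗ.[ℂ] H) : H →L[ℂ] H :=
  if h : ∃ R : H →L[ℂ] H, ∀ g, ∃ hg : R g ∈ A.domain, R g + A ⟨R g, hg⟩ = g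
  then h.choose else 0

/-- `φ(A) w` for `w` in the domain of a positive self-adjoint operator `A` and a function `φ` which
is continuous on `[0, ∞)` with `φ(s) = o(s)` at infinity. Since `φ(s) / (1 + s) = y φ(y⁻¹ - 1)` for
`y = (1 + s)⁻¹`, one has `φ(A) (1 + A)⁻¹ = f(R)` with `f(y) = y φ(y⁻¹ - 1)` and the bounded
self-adjoint operator `R = (1 + A)⁻¹`, so that `φ(A) w = f(R) (w + A w)`. The function `f` is
continuous on `[0, 1]`, which contains the spectrum of `R`, with `f(0) = 0`. -/
noncomputable def funCalc {H : Type*} [NormedAddCommGroup H] [InnerProductSpace ℂ H] [CompleteSpace H]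
    (A : H →ₗ.[ℂ] H) (φ : ℝ → ℝ) (w : A.domain) : H :=
  cfc (fun y : ℝ => y * φ (y⁻¹ - 1)) (shiftedInverse A) ((w : H) + A w)

/-- `cos(t √A) w`. -/
noncomputable def cosSqrt {H : Type*} [NormedAddCommGroup H] [InnerProductSpace ℂ H] [CompleteSpace H]
    (A : H →ₗ.[ℂ] H) (t : ℝ) (w : A.domain) : H :=
  funCalc A (fun s => Real.cos (t * √s)) w

/-- `A^{-1/2} sin(t √A) w`; note that `sin(t √s) / √s = t sinc(t √s)`, also in the limit `s = 0`. -/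
noncomputable def sinSqrtDiv {H : Type*} [NormedAddCommGroup H] [InnerProductSpace ℂ H] [CompleteSpace H]
    (A : H →ₗ.[ℂ] H) (t : ℝ) (w : A.domain) : H :=
  funCalc A (fun s => t * Real.sinc (t * √s)) w

/-- `A^{1/2} sin(t √A) w`. -/
noncomputable def sqrtMulSin {H : Type*} [NormedAddCommGroup H] [InnerProductSpace ℂ H] [CompleteSpace H]
    (A : H →ₗ.[ℂ] H) (t : ℝ) (w : A.domain) : H :=
  funCalc A (fun s => √s * Real.sin (t * √s)) w

/-! ### The energy space `Ḣ¹_A × L²` -/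

/-- The space of functions `w` in `Ḣ¹(0, ∞)` with `w(0) = 0` and `∫ (|w'|² + q |w|²) < ∞`. A function
is represented by its continuous representative, extended by zero to the negative axis. -/
noncomputable def hDotSubmodule (q : ℝ → ℝ) : Submodule ℂ (ℝ → ℂ) where
  carrier := {w | (∀ x, x ≤ 0 → w x = 0) ∧
    (∃ v : ℝ → ℂ, MemLp v 2 halfLine ∧ ∀ x, 0 ≤ x → w x = ∫ y in (0 : ℝ)..x, v y) ∧
    MemLp (fun x => (√(q x) : ℂ) * w x) 2 halfLine}
  zero_mem' := ⟨fun _ _ => rfl, ⟨fun _ => 0, MemLp.zero', by simp⟩, by simp⟩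
  add_mem' := by
    rintro w w' ⟨h0, ⟨v, hv, hw⟩, hq⟩ ⟨h0', ⟨v', hv', hw'⟩, hq'⟩
    have key : ∀ {f : ℝ → ℂ}, MemLp f 2 halfLine → ∀ x, 0 ≤ x →
        IntervalIntegrable f volume 0 x := by
      intro f hf x hx
      rw [intervalIntegrable_iff_integrableOn_Ioc_of_le hx]
      have h2 : MemLp f 2 (volume.restrict (Ioc 0 x)) :=
        hf.mono_measure (Measure.restrict_mono Ioc_subset_Ioi_self le_rfl)
      exact h2.integrable (by norm_num)
    refine ⟨fun x hx => by simp [h0 x hx, h0' x hx], ⟨v + v', hv.add hv', fun x hx => ?_⟩, ?_⟩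
    · simp only [Pi.add_apply]
      rw [intervalIntegral.integral_add (key hv x hx) (key hv' x hx), ← hw x hx, ← hw' x hx]
    · convert! hq.add hq' using 2
      simp [mul_add]
  smul_mem' := by
    rintro c w ⟨h0, ⟨v, hv, hw⟩, hq⟩
    refine ⟨fun x hx => by simp [h0 x hx], ⟨c • v, hv.const_smul c, fun x hx => ?_⟩, ?_⟩
    · simp only [Pi.smul_apply, intervalIntegral.integral_smul]
      rw [← hw x hx]
    · convert! hq.const_smul c using 2
      simp [mul_left_comm]

/-- The homogeneous Sobolev space `Ḣ¹_A` of `A = -d²/dx² + q`. It is a type of its own because it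
carries the energy norm instead of the topology of pointwise convergence. -/
def HDot (q : ℝ → ℝ) : Type := hDotSubmodule q

namespace HDot

variable {q : ℝ → ℝ}

noncomputable instance : AddCommGroup (HDot q) := inferInstanceAs (AddCommGroup (hDotSubmodule q))

noncomputable instance : Module ℂ (HDot q) := inferInstanceAs (Module ℂ (hDotSubmodule q))

/-- The underlying function. -/
def toFun (w : HDot q) : ℝ → ℂ := w.1

lemma toFun_add (w w' : HDot q) : (w + w').toFun = w.toFun + w'.toFun := rfl

lemma toFun_smul (c : ℂ) (w : HDot q) : (c • w).toFun = c • w.toFun := rfl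

lemma exists_hasDerivAt (w : HDot q) : ∃ v : ℝ → ℂ, MemLp v 2 halfLine ∧
    (∀ x, 0 ≤ x → w.toFun x = ∫ y in (0 : ℝ)..x, v y) ∧
    ∀ᵐ x ∂halfLine, HasDerivAt w.toFun (v x) x := by
  obtain ⟨-, ⟨v, hv, hw⟩, -⟩ := w.2
  refine ⟨v, hv, hw, ?_⟩
  have hloc : LocallyIntegrable ((Ioi (0 : ℝ)).indicator v) volume := by
    have h2 : MemLp ((Ioi (0 : ℝ)).indicator v) 2 volume :=
      (memLp_indicator_iff_restrict measurableSet_Ioi).2 hv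
    exact h2.locallyIntegrable (by norm_num)
  have h := LocallyIntegrable.ae_hasDerivAt_integral hloc
  filter_upwards [ae_restrict_of_ae h, ae_restrict_mem measurableSet_Ioi] with x hx hx0
  have h1 := hx 0
  rw [indicator_of_mem hx0] at h1
  refine h1.congr_of_eventuallyEq ?_
  filter_upwards [Ioi_mem_nhds hx0] with y hy
  have e := hw y (le_of_lt hy)
  rw [show w.toFun y = w.1 y from rfl, e, intervalIntegral.integral_of_le (le_of_lt hy),
    intervalIntegral.integral_of_le (le_of_lt hy)]
  refine setIntegral_congr_fun measurableSet_Ioc fun s hs => ?_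
  exact (indicator_of_mem (show s ∈ Ioi (0 : ℝ) from hs.1) v).symm

lemma ae_differentiableAt (w : HDot q) : ∀ᵐ x ∂halfLine, DifferentiableAt ℝ w.toFun x := by
  obtain ⟨v, -, -, h⟩ := w.exists_hasDerivAt
  filter_upwards [h] with x hx using hx.differentiableAt

lemma memLp_deriv (w : HDot q) : MemLp (deriv w.toFun) 2 halfLine := by
  obtain ⟨v, hv, -, h⟩ := w.exists_hasDerivAt
  refine hv.ae_eq ?_
  filter_upwards [h] with x hx using hx.deriv.symm

lemma memLp_sqrt_mul (w : HDot q) : MemLp (fun x => (√(q x) : ℂ) * w.toFun x) 2 halfLine :=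
  w.2.2.2

/-- The linear map `w ↦ (w', √q w)` into `L² × L²`. -/
noncomputable def energyMap (q : ℝ → ℝ) : HDot q →ₗ[ℂ] WithLp 2 (HL2 × HL2) where
  toFun w := WithLp.toLp 2 (w.memLp_deriv.toLp _, w.memLp_sqrt_mul.toLp _)
  map_add' w w' := by
    rw [← WithLp.toLp_add, Prod.mk_add_mk, ← MemLp.toLp_add, ← MemLp.toLp_add]
    congr 2
    · rw [MemLp.toLp_eq_toLp_iff]
      filter_upwards [w.ae_differentiableAt, w'.ae_differentiableAt] with x h h'
      rw [toFun_add, Pi.add_apply, deriv_add h h']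
    · rw [MemLp.toLp_eq_toLp_iff]
      refine Eventually.of_forall fun x => ?_
      simp [toFun_add, mul_add]
  map_smul' c w := by
    rw [RingHom.id_apply, ← WithLp.toLp_smul, Prod.smul_mk, ← MemLp.toLp_const_smul,
      ← MemLp.toLp_const_smul]
    congr 2
    · rw [MemLp.toLp_eq_toLp_iff]
      filter_upwards [w.ae_differentiableAt] with x h
      rw [toFun_smul, Pi.smul_apply, deriv_const_smul c h]
    · rw [MemLp.toLp_eq_toLp_iff]
      refine Eventually.of_forall fun x => ?_
      simp [toFun_smul, mul_left_comm]

lemma energyMap_injective (q : ℝ → ℝ) : Function.Injective (energyMap q) := by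
  refine (injective_iff_map_eq_zero _).2 fun w hw => ?_
  obtain ⟨v, hv, hint, hd⟩ := w.exists_hasDerivAt
  have h1 : w.memLp_deriv.toLp _ = 0 := congrArg (fun p : WithLp 2 (HL2 × HL2) => p.fst) hw
  have h2 : deriv w.toFun =ᵐ[halfLine] 0 := (MemLp.coeFn_toLp _).symm.trans (Lp.eq_zero_iff_ae_eq_zero.1 h1)
  have h3 : ∀ᵐ x ∂halfLine, v x = 0 := by
    filter_upwards [h2, hd] with x e e'
    rw [← e'.deriv, e, Pi.zero_apply]
  refine Subtype.ext (funext fun x => ?_)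
  rcases le_total x 0 with hx | hx
  · exact w.2.1 x hx
  · change w.toFun x = 0
    rw [hint x hx, intervalIntegral.integral_of_le hx]
    refine integral_eq_zero_of_ae ?_
    exact ae_mono (Measure.restrict_mono Ioc_subset_Ioi_self le_rfl) h3

/-- The norm `(∫ (|w'|² + q |w|²))^{1/2}`. -/
noncomputable instance : NormedAddCommGroup (HDot q) :=
  NormedAddCommGroup.induced _ _ (energyMap q) (energyMap_injective q)

noncomputable instance : NormedSpace ℂ (HDot q) :=
  NormedSpace.induced ℂ _ _ (energyMap q)

end HDot

/-- The energy space `Ḣ¹_A × L²` of `A = -d²/dx² + q`, with norm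
`‖(w₀, w₁)‖² = ∫ (|w₀'|² + q |w₀|² + |w₁|²)`. -/
abbrev EnergySpace (q : ℝ → ℝ) : Type := WithLp 2 (HDot q × HL2)

/-! ### The wave propagation operator -/

/-- `U` is the bounded operator on the energy space of `A = -d²/dx² + λ x⁻² + q₀` that acts on data
`(w₀, w₁)` in the dense subspace `D(A) × D(A)` by the matrix
`((cos(t√A), A^{-1/2} sin(t√A)), (-A^{1/2} sin(t√A), cos(t√A)))`. -/
def IsPropagatorAt (lam : ℝ) (q₀ : ℝ → ℝ) (t : ℝ)
    (U : EnergySpace (potential lam q₀) →L[ℂ] EnergySpace (potential lam q₀)) : Prop :=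
  ∀ (f : EnergySpace (potential lam q₀)) (w₀ w₁ : (halfLineOperator lam q₀).domain),
    (f.fst.toFun =ᵐ[halfLine] (w₀ : HL2)) → f.snd = w₁ →
    ((U f).fst.toFun =ᵐ[halfLine]
      (cosSqrt (halfLineOperator lam q₀) t w₀ + sinSqrtDiv (halfLineOperator lam q₀) t w₁ : HL2)) ∧
    (U f).snd =
      -sqrtMulSin (halfLineOperator lam q₀) t w₀ + cosSqrt (halfLineOperator lam q₀) t w₁

open Classical in
/-- The wave propagation operator `S(t)` of `w_tt + A w = 0` on the energy space of
`A = -d²/dx² + λ x⁻² + q₀`: the functional calculus matrix, extended from `D(A) × D(A)` by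
continuity. -/
noncomputable def wavePropagator (lam : ℝ) (q₀ : ℝ → ℝ) (t : ℝ) :
    EnergySpace (potential lam q₀) →L[ℂ] EnergySpace (potential lam q₀) :=
  if h : ∃ U, IsPropagatorAt lam q₀ t U then h.choose else 0

end HalfLineWave

open HalfLineWave

/-! The two operators differ only on a bounded region, and repulsivity makes every wave leave each
bounded region. Quantitatively, put φ = 1 - (1 + x)⁻¹ and let B be the Morawetz multiplier B w = φ
w' + (φ'/2 - η (1 + x)⁻⁴) w. Along a solution u of the wave equation, the time derivative of -Re⟨B
u, u_t⟩ is at least c ‖L (u, u_t)‖², where L collects weighted local energies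
(`re_inner_multiplier_ge`, `re_inner_multiplier_self_le`). The sign q' ≤ 0 enters here, and a
weighted Hardy argument absorbs the bad term φ'''. Since |⟨B u, u_t⟩| is bounded by the conserved
energy, ∫₀^∞ ‖L (u, u_t)‖² dt is bounded by the energy (`integral_norm_sq_le`), and for regular data
‖L (u, u_t)‖ tends to zero.

The limit then exists by the method of Cook and Kato. Let J be the identification of the energy
spaces and P its cut off version, equal in the weak sense to J for large x. First, ‖J f - P f‖ ≤ C
‖L₁ f‖, which is negligible in the limit. Second, for solutions u₁, u₂ of the two equations the
derivative of ⟨P u₁, u₂⟩ contains only terms with the derivative of the cutoff, hence is at most C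
‖L₁ u₁‖ ‖L₂ u₂‖. Young's inequality in time, with the space-time bound used for u₂, gives a Cauchy
estimate by duality (`cauchySeq_energySol`). Third, |‖J f‖² - ‖f‖²| ≤ C ‖L₁ f‖², so the limit is
isometric. Exchanging the operators gives a limit in the other direction, and the two limits are
inverse to each other.

The operator is handled through its resolvent. If ι is the embedding of the form domain into L²,
then ι ι* is positive, bounded by one and gives the weak solution of -w'' + q w + w = g. That it is
(1 + A)⁻¹ for the operator A of the statement needs regularity at zero: the du Bois-Reymond lemma
gives the differential equation, and Kato's inequality with a comparison argument gives u = O(x^a)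
(`exists_norm_le_rpow`). For λ ≥ 3/4 every a < 3/2 is allowed, because a (a - 1) < 3/4 there.
Conversely, functions with the stated boundary conditions are weak solutions
(`eq_lift_of_domainConditions`). From then on the wave group is expressed through the continuous
functional calculus of the resolvent on [0, 1]. -/

namespace HalfLineWave

/-! ### Functions which are locally absolutely continuous on the open half line -/

/-- `f` is locally absolutely continuous on `(0, ∞)` with derivative `f'`. -/
structure IsPrimitive {E : Type*} [NormedAddCommGroup E] [NormedSpace ℝ E] (f f' : ℝ → E) : Prop where
  intervalIntegrable : ∀ a b, 0 < a → a ≤ b → IntervalIntegrable f' volume a b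
  sub_eq : ∀ a b, 0 < a → a ≤ b → f b - f a = ∫ x in a..b, f' x

namespace IsPrimitive

section General

variable {E F : Type*} [NormedAddCommGroup E] [NormedSpace ℝ E] [NormedAddCommGroup F]
  [NormedSpace ℝ F] {f f' g g' : ℝ → E}

lemma clm [CompleteSpace E] [CompleteSpace F] (h : IsPrimitive f f') (L : E →L[ℝ] F) :
    IsPrimitive (fun x => L (f x)) (fun x => L (f' x)) where
  intervalIntegrable a b ha hab :=
    ⟨L.integrable_comp (h.intervalIntegrable a b ha hab).1,
      L.integrable_comp (h.intervalIntegrable a b ha hab).2⟩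
  sub_eq a b ha hab := by
    rw [L.intervalIntegral_comp_comm (h.intervalIntegrable a b ha hab), ← h.sub_eq a b ha hab,
      map_sub]

lemma add (hf : IsPrimitive f f') (hg : IsPrimitive g g') :
    IsPrimitive (fun x => f x + g x) (fun x => f' x + g' x) where
  intervalIntegrable a b ha hab :=
    (hf.intervalIntegrable a b ha hab).add (hg.intervalIntegrable a b ha hab)
  sub_eq a b ha hab := by
    rw [intervalIntegral.integral_add (hf.intervalIntegrable a b ha hab)
      (hg.intervalIntegrable a b ha hab), ← hf.sub_eq a b ha hab, ← hg.sub_eq a b ha hab]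
    abel

lemma neg (hf : IsPrimitive f f') : IsPrimitive (fun x => -f x) (fun x => -f' x) where
  intervalIntegrable a b ha hab := (hf.intervalIntegrable a b ha hab).neg
  sub_eq a b ha hab := by
    rw [intervalIntegral.integral_neg, ← hf.sub_eq a b ha hab]
    abel

lemma sub (hf : IsPrimitive f f') (hg : IsPrimitive g g') :
    IsPrimitive (fun x => f x - g x) (fun x => f' x - g' x) := by
  simpa only [sub_eq_add_neg] using hf.add hg.neg

lemma congr (hf : IsPrimitive f f') (h : ∀ x, 0 < x → g x = f x)
    (h' : ∀ᵐ x ∂halfLine, g' x = f' x) : IsPrimitive g g' := by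
  have key : ∀ a b, 0 < a → a ≤ b → f' =ᵐ[volume.restrict (Ioc a b)] g' := by
    intro a b ha hab
    have hs : Ioc a b ⊆ Ioi 0 := fun x hx => ha.trans hx.1
    filter_upwards [ae_mono (Measure.restrict_mono hs le_rfl) h'] with x hx using hx.symm
  refine ⟨fun a b ha hab => ?_, fun a b ha hab => ?_⟩
  · have := hf.intervalIntegrable a b ha hab
    rw [intervalIntegrable_iff_integrableOn_Ioc_of_le hab] at this ⊢
    exact this.congr_fun_ae (key a b ha hab)
  · rw [h b (ha.trans_le hab), h a ha, hf.sub_eq a b ha hab,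
      intervalIntegral.integral_of_le hab, intervalIntegral.integral_of_le hab]
    exact integral_congr_ae (key a b ha hab)

lemma of_hasDerivAt [CompleteSpace E] (h : ∀ x, 0 < x → HasDerivAt f (f' x) x)
    (h' : ContinuousOn f' (Ioi 0)) : IsPrimitive f f' := by
  have hi : ∀ a b, 0 < a → a ≤ b → IntervalIntegrable f' volume a b := fun a b ha hab =>
    (h'.mono (by
      rw [uIcc_of_le hab]
      exact fun x hx => lt_of_lt_of_le ha hx.1)).intervalIntegrable
  refine ⟨hi, fun a b ha hab => ?_⟩
  rw [intervalIntegral.integral_eq_sub_of_hasDerivAt (fun x hx => ?_) (hi a b ha hab)]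
  rw [uIcc_of_le hab] at hx
  exact h x (lt_of_lt_of_le ha hx.1)

lemma intervalIntegrable' (h : IsPrimitive f f') {a b : ℝ} (ha : 0 < a) (hb : 0 < b) :
    IntervalIntegrable f' volume a b := by
  rcases le_total a b with hab | hab
  · exact h.intervalIntegrable a b ha hab
  · exact (h.intervalIntegrable b a hb hab).symm

lemma sub_eq' (h : IsPrimitive f f') {a b : ℝ} (ha : 0 < a) (hb : 0 < b) :
    f b - f a = ∫ x in a..b, f' x := by
  rcases le_total a b with hab | hab
  · exact h.sub_eq a b ha hab
  · rw [intervalIntegral.integral_symm, ← h.sub_eq b a hb hab, neg_sub]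

lemma eq_add (h : IsPrimitive f f') {a b : ℝ} (ha : 0 < a) (hb : 0 < b) :
    f b = f a + ∫ x in a..b, f' x := by
  rw [← h.sub_eq' ha hb]; abel

lemma continuousOn (h : IsPrimitive f f') : ContinuousOn f (Ioi 0) := by
  intro x hx
  have hx0 : 0 < x := hx
  have h1 : ContinuousOn (fun y => f (x / 2) + ∫ t in (x / 2)..y, f' t) (Icc (x / 2) (2 * x)) := by
    have := h.intervalIntegrable (x / 2) (2 * x) (by positivity) (by linarith)
    have := intervalIntegral.continuousOn_primitive_interval' this left_mem_uIcc
    rw [uIcc_of_le (by linarith)] at this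
    exact this.const_add _
  have hn : Icc (x / 2) (2 * x) ∈ 𝓝 x := Icc_mem_nhds (by linarith) (by linarith)
  refine ContinuousAt.continuousWithinAt ?_
  refine (h1.continuousAt hn).congr ?_
  filter_upwards [hn] with y hy
  exact (h.eq_add (by positivity) (lt_of_lt_of_le (by positivity) hy.1)).symm

lemma ae_hasDerivAt [CompleteSpace E] (h : IsPrimitive f f') {a b : ℝ} (ha : 0 < a) (hab : a < b) :
    ∀ᵐ x, x ∈ Ioo a b → HasDerivAt f (f' x) x := by
  filter_upwards [(h.intervalIntegrable a b ha hab.le).ae_hasDerivAt_integral] with x hx hxm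
  have := hx (by rw [uIcc_of_le hab.le]; exact Ioo_subset_Icc_self hxm) a left_mem_uIcc
  refine (this.const_add (f a)).congr_of_eventuallyEq ?_
  filter_upwards [Ioo_mem_nhds hxm.1 hxm.2] with y hy
  exact h.eq_add ha (ha.trans hy.1)

end General

section Product

/-- On [a, b] each factor is replaced by its primitive based at a, which agrees with it for x ≥ a
and is absolutely continuous on the closed interval; then integration by parts for absolutely
continuous functions applies. -/
lemma real_mul {f f' g g' : ℝ → ℝ} (hf : IsPrimitive f f') (hg : IsPrimitive g g') :
    IsPrimitive (fun x => f x * g x) (fun x => f' x * g x + f x * g' x) where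
  intervalIntegrable a b ha hab := by
    have hs : uIcc a b ⊆ Ioi 0 := by
      rw [uIcc_of_le hab]
      exact fun x hx => ha.trans_le hx.1
    exact ((hf.intervalIntegrable a b ha hab).mul_continuousOn (hg.continuousOn.mono hs)).add
      ((hg.intervalIntegrable a b ha hab).continuousOn_mul (hf.continuousOn.mono hs))
  sub_eq a b ha hab := by
    have key : ∀ {h h' : ℝ → ℝ}, IsPrimitive h h' →
        AbsolutelyContinuousOnInterval (fun x => h a + ∫ t in a..x, h' t) a b := fun {h h'} hh =>
      AbsolutelyContinuousOnInterval.add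
        (LipschitzWith.const (h a)).lipschitzOnWith.absolutelyContinuousOnInterval
        ((hh.intervalIntegrable a b ha hab).absolutelyContinuousOnInterval_intervalIntegral
          (c := a) left_mem_uIcc)
    have hval : ∀ {h h' : ℝ → ℝ}, IsPrimitive h h' → ∀ x, a ≤ x →
        h a + ∫ t in a..x, h' t = h x := fun hh x hx => (hh.eq_add ha (ha.trans_le hx)).symm
    have hder : ∀ {h h' : ℝ → ℝ}, IsPrimitive h h' → ∀ᵐ x, x ∈ uIoc a b →
        deriv (fun x => h a + ∫ t in a..x, h' t) x = h' x := by
      intro h h' hh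
      filter_upwards [(hh.intervalIntegrable a b ha hab).ae_hasDerivAt_integral] with x hx hxm
      exact ((hx (uIoc_subset_uIcc hxm) a left_mem_uIcc).const_add (h a)).deriv
    have := (key hf).integral_deriv_mul_eq_sub (key hg)
    rw [hval hf b hab, hval hg b hab, hval hf a le_rfl, hval hg a le_rfl] at this
    rw [← this]
    refine intervalIntegral.integral_congr_ae ?_
    filter_upwards [hder hf, hder hg] with x h1 h2 hx
    have hax : a ≤ x := by
      rw [uIoc_of_le hab] at hx
      exact hx.1.le
    rw [h1 hx, h2 hx, hval hf x hax, hval hg x hax]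

variable {f f' g g' : ℝ → ℂ}

lemma re (hf : IsPrimitive f f') : IsPrimitive (fun x => (f x).re) (fun x => (f' x).re) :=
  hf.clm Complex.reCLM

lemma im (hf : IsPrimitive f f') : IsPrimitive (fun x => (f x).im) (fun x => (f' x).im) :=
  hf.clm Complex.imCLM

lemma conj (hf : IsPrimitive f f') :
    IsPrimitive (fun x => starRingEnd ℂ (f x)) (fun x => starRingEnd ℂ (f' x)) :=
  hf.clm (Complex.conjCLE : ℂ →L[ℝ] ℂ)

lemma ofReal {f f' : ℝ → ℝ} (hf : IsPrimitive f f') :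
    IsPrimitive (fun x => (f x : ℂ)) (fun x => (f' x : ℂ)) :=
  hf.clm Complex.ofRealCLM

lemma of_re_im (hre : IsPrimitive (fun x => (f x).re) (fun x => (f' x).re))
    (him : IsPrimitive (fun x => (f x).im) (fun x => (f' x).im)) : IsPrimitive f f' := by
  have := hre.ofReal.add
    (him.clm (ContinuousLinearMap.toSpanSingleton ℝ Complex.I))
  simpa [Complex.re_add_im] using this

lemma mul (hf : IsPrimitive f f') (hg : IsPrimitive g g') :
    IsPrimitive (fun x => f x * g x) (fun x => f' x * g x + f x * g' x) := by
  refine of_re_im ?_ ?_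
  · refine ((hf.re.real_mul hg.re).sub (hf.im.real_mul hg.im)).congr
      (fun x _ => Complex.mul_re _ _) (Eventually.of_forall fun x => ?_)
    simp only [Complex.add_re, Complex.mul_re]
    ring
  · refine ((hf.re.real_mul hg.im).add (hf.im.real_mul hg.re)).congr
      (fun x _ => Complex.mul_im _ _) (Eventually.of_forall fun x => ?_)
    simp only [Complex.add_im, Complex.mul_im]
    ring

/-- The product rule for the real inner product `Re (f̄ g)`. -/
lemma re_conj_mul (hf : IsPrimitive f f') (hg : IsPrimitive g g') :
    IsPrimitive (fun x => (starRingEnd ℂ (f x) * g x).re)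
      (fun x => (starRingEnd ℂ (f' x) * g x).re + (starRingEnd ℂ (f x) * g' x).re) := by
  simpa only [Complex.add_re] using (hf.conj.mul hg).re

end Product

section Limits

/-- Boundary terms at infinity are only known to be integrable, not to decay. Integrability still
makes them small along some sequence, which is all that is needed. -/
lemma _root_.HalfLineWave.frequently_norm_lt_of_integrableOn {E : Type*} [NormedAddCommGroup E]
    {f : ℝ → E} (hf : IntegrableOn f (Ioi 1)) {δ : ℝ} (hδ : 0 < δ) :
    ∃ᶠ x in atTop, ‖f x‖ < δ := by
  intro h
  obtain ⟨N, hN⟩ := eventually_atTop.1 h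
  have h1 : IntegrableOn (fun _ : ℝ => δ) (Ioi (max N 1)) := by
    refine Integrable.mono' (hf.mono_set (Ioi_subset_Ioi (le_max_right N 1))).norm
      aestronglyMeasurable_const ?_
    filter_upwards [ae_restrict_mem measurableSet_Ioi] with x hx
    rw [Real.norm_of_nonneg hδ.le]
    exact not_lt.1 (hN x ((le_max_left N 1).trans (le_of_lt hx)))
  rw [integrableOn_const_iff] at h1
  simp [hδ.ne'] at h1

/-- Integrating f' ≤ g from a to b and letting a tend to 0 gives f b ≤ ∫₀ᵇ g; now let b run to
infinity along points where f b is small. Only the majorant g has to be integrable, not f'. This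
turns pointwise identities into integral inequalities without boundary terms. -/
lemma integral_nonneg_of_le {f f' g : ℝ → ℝ} (hf : IsPrimitive f f')
    (h0 : Tendsto f (𝓝[>] 0) (𝓝 0)) (hinf : IntegrableOn f (Ioi 1))
    (hg : IntegrableOn g (Ioi 0)) (hle : ∀ᵐ x ∂halfLine, f' x ≤ g x) :
    0 ≤ ∫ x in Ioi 0, g x := by
  have hgi : ∀ a b, 0 ≤ a → a ≤ b → IntervalIntegrable g volume a b := fun a b ha hab => by
    rw [intervalIntegrable_iff_integrableOn_Ioc_of_le hab]
    exact hg.mono_set fun x hx => ha.trans_lt hx.1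
  have hG0 : Tendsto (fun a => ∫ x in (0 : ℝ)..a, g x) (𝓝[>] 0) (𝓝 0) := by
    have h1 := intervalIntegral.continuousOn_primitive_interval'
      (hgi 0 1 le_rfl zero_le_one) left_mem_uIcc
    have h2 := h1 0 left_mem_uIcc
    rw [ContinuousWithinAt, intervalIntegral.integral_same] at h2
    refine h2.mono_left ?_
    rw [uIcc_of_le zero_le_one, nhdsWithin_Icc_eq_nhdsGE zero_lt_one]
    exact nhdsWithin_mono _ Ioi_subset_Ici_self
  have hG1 := intervalIntegral_tendsto_integral_Ioi 0 hg tendsto_id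
  have hstep : ∀ b, 0 < b → f b ≤ ∫ x in (0 : ℝ)..b, g x := by
    intro b hb
    have h1 : Tendsto (fun a => f b - f a) (𝓝[>] 0) (𝓝 (f b - 0)) := h0.const_sub _
    have h2 := hG0.const_sub (∫ x in (0 : ℝ)..b, g x)
    rw [sub_zero] at h1 h2
    refine le_of_tendsto_of_tendsto h1 h2 ?_
    filter_upwards [Ioo_mem_nhdsGT hb] with a ha
    rw [hf.sub_eq a b ha.1 ha.2.le, ← intervalIntegral.integral_add_adjacent_intervals (hgi 0 a le_rfl ha.1.le)
        (hgi a b ha.1.le ha.2.le), add_sub_cancel_left, intervalIntegral.integral_of_le ha.2.le,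
      intervalIntegral.integral_of_le ha.2.le]
    have hs : Ioc a b ⊆ Ioi 0 := fun x hx => ha.1.trans hx.1
    have hi := hf.intervalIntegrable a b ha.1 ha.2.le
    rw [intervalIntegrable_iff_integrableOn_Ioc_of_le ha.2.le] at hi
    exact integral_mono_ae hi (hg.mono_set hs) (ae_mono (Measure.restrict_mono hs le_rfl) hle)
  refine le_of_forall_pos_lt_add fun δ hδ => ?_
  have h1 := (hG1.eventually (gt_mem_nhds (lt_add_of_pos_right _ (half_pos hδ)))).and
    (eventually_gt_atTop 0)
  obtain ⟨b, hb, hb1, hb2⟩ :=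
    ((frequently_norm_lt_of_integrableOn hinf (half_pos hδ)).and_eventually h1).exists
  have := hstep b hb2
  have h3 := neg_abs_le (f b)
  rw [Real.norm_eq_abs] at hb
  simp only [id] at hb1
  linarith

lemma integral_eq_zero {f f' : ℝ → ℂ} (hf : IsPrimitive f f')
    (h0 : Tendsto f (𝓝[>] 0) (𝓝 0)) (hinf : IntegrableOn f (Ioi 1))
    (hg : IntegrableOn f' (Ioi 0)) : ∫ x in Ioi 0, f' x = 0 := by
  have key : ∀ {f f' : ℝ → ℝ}, IsPrimitive f f' → Tendsto f (𝓝[>] 0) (𝓝 0) →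
      IntegrableOn f (Ioi 1) → IntegrableOn f' (Ioi 0) → ∫ x in Ioi 0, f' x = 0 := by
    intro f f' hf h0 hinf hg
    refine le_antisymm ?_ (hf.integral_nonneg_of_le h0 hinf hg (Eventually.of_forall fun _ => le_rfl))
    have := hf.neg.integral_nonneg_of_le (by simpa using h0.neg) hinf.neg hg.neg
      (Eventually.of_forall fun _ => le_rfl)
    simp only [Pi.neg_apply, integral_neg] at this
    linarith
  have h1 := key hf.re ((Complex.continuous_re.tendsto 0).comp h0) hinf.re hg.re
  have h2 := key hf.im ((Complex.continuous_im.tendsto 0).comp h0) hinf.im hg.im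
  refine Complex.ext ?_ ?_
  · exact (Complex.reCLM.integral_comp_comm hg).symm.trans h1
  · exact (Complex.imCLM.integral_comp_comm hg).symm.trans h2

end Limits

end IsPrimitive

/-! ### Auxiliary facts about square integrable functions -/

lemma norm_sq_toLp {f : ℝ → ℂ} (hf : MemLp f 2 halfLine) :
    ‖hf.toLp f‖ ^ 2 = ∫ x in Ioi 0, ‖f x‖ ^ 2 := by
  rw [@norm_sq_eq_re_inner ℂ, L2.inner_def, ← integral_re (L2.integrable_inner _ _)]
  refine integral_congr_ae ?_
  filter_upwards [hf.coeFn_toLp] with x hx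
  rw [hx, ← norm_sq_eq_re_inner]

lemma norm_sq_HL2 (f : HL2) : ‖f‖ ^ 2 = ∫ x in Ioi 0, ‖f x‖ ^ 2 := by
  have := norm_sq_toLp (Lp.memLp f)
  rwa [Lp.toLp_coeFn] at this

lemma integrableOn_norm_sq {f : ℝ → ℂ} (hf : MemLp f 2 halfLine) :
    IntegrableOn (fun x => ‖f x‖ ^ 2) (Ioi 0) :=
  (memLp_two_iff_integrable_sq_norm hf.1).1 hf

lemma _root_.MeasureTheory.MemLp.intervalIntegrable_halfLine {f : ℝ → ℂ} (hf : MemLp f 2 halfLine) {a b : ℝ}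
    (ha : 0 ≤ a) (hab : a ≤ b) : IntervalIntegrable f volume a b := by
  rw [intervalIntegrable_iff_integrableOn_Ioc_of_le hab]
  have h2 : MemLp f 2 (volume.restrict (Ioc a b)) :=
    hf.mono_measure (Measure.restrict_mono (fun x hx => ha.trans_lt hx.1) le_rfl)
  exact h2.integrable (by norm_num)

lemma sq_integral_norm_le {f : ℝ → ℂ} {a b : ℝ} (hab : a ≤ b)
    (hf : MemLp f 2 (volume.restrict (Ioc a b))) :
    (∫ x in a..b, ‖f x‖) ^ 2 ≤ (b - a) * ∫ x in a..b, ‖f x‖ ^ 2 := by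
  rcases hab.eq_or_lt with rfl | hab'
  · simp
  have h1 : IntervalIntegrable (fun x => ‖f x‖) volume a b := by
    rw [intervalIntegrable_iff_integrableOn_Ioc_of_le hab]
    exact (hf.integrable (by norm_num)).norm
  have h2 : IntervalIntegrable (fun x => ‖f x‖ ^ 2) volume a b := by
    rw [intervalIntegrable_iff_integrableOn_Ioc_of_le hab]
    exact (memLp_two_iff_integrable_sq_norm hf.1).1 hf
  set I := ∫ x in a..b, ‖f x‖ with hI
  have hL : 0 < b - a := sub_pos.2 hab'
  -- Cauchy–Schwarz from the nonnegative variance of ‖f‖: integrate the squared deviation from its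
  -- mean.
  have h3 : 0 ≤ ∫ x in a..b, (‖f x‖ ^ 2 - (2 * (I / (b - a))) * ‖f x‖ + (I / (b - a)) ^ 2) :=
    intervalIntegral.integral_nonneg hab fun x _ => by
      nlinarith [sq_nonneg (‖f x‖ - I / (b - a))]
  rw [intervalIntegral.integral_add (h2.sub (h1.const_mul _)) intervalIntegrable_const,
    intervalIntegral.integral_sub h2 (h1.const_mul _), intervalIntegral.integral_const_mul, ← hI,
    intervalIntegral.integral_const, smul_eq_mul] at h3
  have h4 : (b - a) * (∫ x in a..b, ‖f x‖ ^ 2) - I ^ 2 =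
      (b - a) * ((∫ x in a..b, ‖f x‖ ^ 2) - 2 * (I / (b - a)) * I + (b - a) * (I / (b - a)) ^ 2) := by
    field_simp
    ring
  have := mul_nonneg hL.le h3
  linarith

lemma sq_integral_norm_le_mul_norm_sq {f : ℝ → ℂ} (hf : MemLp f 2 halfLine) {a b : ℝ} (ha : 0 ≤ a)
    (hab : a ≤ b) : (∫ x in a..b, ‖f x‖) ^ 2 ≤ (b - a) * ‖hf.toLp f‖ ^ 2 := by
  have hs : Ioc a b ⊆ Ioi 0 := fun x hx => ha.trans_lt hx.1
  refine (sq_integral_norm_le hab (hf.mono_measure (Measure.restrict_mono hs le_rfl))).trans ?_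
  refine mul_le_mul_of_nonneg_left ?_ (sub_nonneg.2 hab)
  rw [norm_sq_toLp hf, intervalIntegral.integral_of_le hab]
  exact setIntegral_mono_set (integrableOn_norm_sq hf)
    (Eventually.of_forall fun x => by positivity) (Eventually.of_forall hs)

lemma aecover_halfLine : AECover halfLine atTop
    fun n : ℕ => Ioc ((1 : ℝ) / (n + 1)) ((n : ℝ) + 1) where
  measurableSet _ := measurableSet_Ioc
  ae_eventually_mem := by
    filter_upwards [ae_restrict_mem measurableSet_Ioi] with x hx
    have h1 := (tendsto_one_div_add_atTop_nhds_zero_nat (𝕜 := ℝ)).eventually (gt_mem_nhds hx)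
    have h2 := tendsto_natCast_atTop_atTop.eventually (eventually_ge_atTop x)
    filter_upwards [h1, h2] with n hn hn'
    exact ⟨hn, by linarith⟩

/-! ### The energy space: bounds at zero and Hardy's inequality -/

namespace HDot

variable {q : ℝ → ℝ}

noncomputable instance : InnerProductSpace ℂ (HDot q) := InnerProductSpace.induced (energyMap q)

/-- `w ↦ w'` -/
noncomputable def derivL (q : ℝ → ℝ) : HDot q →L[ℂ] HL2 :=
  LinearMap.mkContinuous
    ((WithLp.fstL 2 ℂ HL2 HL2).toLinearMap ∘ₗ energyMap q) 1 fun w => by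
      rw [one_mul]
      exact WithLp.norm_fst_le HL2 (energyMap q w)

/-- `w ↦ √q w` -/
noncomputable def potL (q : ℝ → ℝ) : HDot q →L[ℂ] HL2 :=
  LinearMap.mkContinuous
    ((WithLp.sndL 2 ℂ HL2 HL2).toLinearMap ∘ₗ energyMap q) 1 fun w => by
      rw [one_mul]
      exact WithLp.norm_snd_le HL2 (energyMap q w)

lemma derivL_apply (w : HDot q) : derivL q w = w.memLp_deriv.toLp (deriv w.toFun) := rfl

lemma potL_apply (w : HDot q) : potL q w =
    w.memLp_sqrt_mul.toLp (fun x => (√(q x) : ℂ) * w.toFun x) := rfl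

lemma coeFn_derivL (w : HDot q) : derivL q w =ᵐ[halfLine] deriv w.toFun :=
  MemLp.coeFn_toLp w.memLp_deriv

lemma coeFn_potL (w : HDot q) : potL q w =ᵐ[halfLine] fun x => (√(q x) : ℂ) * w.toFun x :=
  MemLp.coeFn_toLp w.memLp_sqrt_mul

lemma norm_sq_eq (w : HDot q) : ‖w‖ ^ 2 = ‖derivL q w‖ ^ 2 + ‖potL q w‖ ^ 2 :=
  WithLp.prod_norm_sq_eq_of_L2 (energyMap q w)

lemma inner_eq (w w' : HDot q) : inner ℂ w w' =
    inner ℂ (derivL q w) (derivL q w') + inner ℂ (potL q w) (potL q w') :=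
  WithLp.prod_inner_apply (energyMap q w) (energyMap q w')

lemma norm_derivL_le (w : HDot q) : ‖derivL q w‖ ≤ ‖w‖ := WithLp.norm_fst_le HL2 (energyMap q w)

lemma norm_potL_le (w : HDot q) : ‖potL q w‖ ≤ ‖w‖ := WithLp.norm_snd_le HL2 (energyMap q w)

lemma toFun_of_nonpos (w : HDot q) {x : ℝ} (hx : x ≤ 0) : w.toFun x = 0 := w.2.1 x hx

lemma ext_toFun {w w' : HDot q} (h : ∀ x, 0 < x → w.toFun x = w'.toFun x) : w = w' := by
  refine Subtype.ext (funext fun x => ?_)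
  rcases le_or_gt x 0 with hx | hx
  · exact (w.2.1 x hx).trans (w'.2.1 x hx).symm
  · exact h x hx

lemma toFun_eq_integral (w : HDot q) {x : ℝ} (hx : 0 ≤ x) :
    w.toFun x = ∫ y in (0 : ℝ)..x, deriv w.toFun y := by
  obtain ⟨v, hv, hw, hd⟩ := w.exists_hasDerivAt
  rw [hw x hx, intervalIntegral.integral_of_le hx, intervalIntegral.integral_of_le hx]
  refine integral_congr_ae ?_
  filter_upwards [ae_mono (Measure.restrict_mono Ioc_subset_Ioi_self le_rfl) hd] with y hy
    using hy.deriv.symm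

lemma isPrimitive (w : HDot q) : IsPrimitive w.toFun (deriv w.toFun) where
  intervalIntegrable _ _ ha hab := w.memLp_deriv.intervalIntegrable_halfLine ha.le hab
  sub_eq a b ha hab := by
    rw [w.toFun_eq_integral ha.le, w.toFun_eq_integral (ha.le.trans hab), sub_eq_iff_eq_add',
      intervalIntegral.integral_add_adjacent_intervals
        (w.memLp_deriv.intervalIntegrable_halfLine le_rfl ha.le)
        (w.memLp_deriv.intervalIntegrable_halfLine ha.le hab)]

lemma continuousOn (w : HDot q) : ContinuousOn w.toFun (Ioi 0) := w.isPrimitive.continuousOn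

/-- Cauchy–Schwarz applied to w x = ∫₀ˣ w'. It controls the boundary terms at zero here and in
Hardy's inequality. -/
lemma norm_sq_toFun_le (w : HDot q) {x : ℝ} (hx : 0 ≤ x) :
    ‖w.toFun x‖ ^ 2 ≤ x * ‖derivL q w‖ ^ 2 := by
  have h := sq_integral_norm_le_mul_norm_sq w.memLp_deriv le_rfl hx
  rw [sub_zero] at h
  refine le_trans ?_ h
  rw [w.toFun_eq_integral hx]
  gcongr
  exact intervalIntegral.norm_integral_le_integral_norm hx

lemma tendsto_toFun_zero (w : HDot q) : Tendsto w.toFun (𝓝[>] 0) (𝓝 0) := by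
  rw [tendsto_zero_iff_norm_tendsto_zero]
  have h1 : Tendsto (fun x : ℝ => √(x * ‖derivL q w‖ ^ 2)) (𝓝[>] 0) (𝓝 0) := by
    have : Continuous fun x : ℝ => √(x * ‖derivL q w‖ ^ 2) := by fun_prop
    have := (this.tendsto 0).mono_left (nhdsWithin_le_nhds (s := Ioi 0))
    simpa using this
  refine squeeze_zero' (Eventually.of_forall fun _ => norm_nonneg _) ?_ h1
  filter_upwards [self_mem_nhdsWithin] with x hx
  exact Real.le_sqrt_of_sq_le (w.norm_sq_toFun_le (le_of_lt hx))

/-- Hardy's inequality. -/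
lemma hardy (w : HDot q) : MemLp (fun x => ((x⁻¹ : ℝ) : ℂ) * w.toFun x) 2 halfLine ∧
    ∫ x in Ioi 0, ‖((x⁻¹ : ℝ) : ℂ) * w.toFun x‖ ^ 2 ≤ 6 * ‖derivL q w‖ ^ 2 := by
  have hcont : ContinuousOn (fun x => ((x⁻¹ : ℝ) : ℂ) * w.toFun x) (Ioi 0) :=
    (Complex.continuous_ofReal.comp_continuousOn
      (continuousOn_inv₀.mono fun x hx => (ne_of_gt hx : x ≠ 0))).mul w.continuousOn
  have hmeas : AEStronglyMeasurable (fun x => ((x⁻¹ : ℝ) : ℂ) * w.toFun x) halfLine :=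
    hcont.aestronglyMeasurable measurableSet_Ioi
  have hinv : IsPrimitive (fun x : ℝ => x⁻¹) (fun x => -(x ^ 2)⁻¹) :=
    IsPrimitive.of_hasDerivAt (fun x hx => hasDerivAt_inv hx.ne')
      ((continuousOn_inv₀.comp (by fun_prop) fun x hx => pow_ne_zero 2 (ne_of_gt hx)).neg)
  -- The derivative of -|w|²/x is |w|²/x² - 2 Re(w̄ w')/x ≥ |w|²/(2x²) - 2|w'|². On [a, b] the
  -- boundary term at b has a favourable sign and the one at a is at most ‖w'‖², so half of the
  -- Hardy integral is at most 3 ‖w'‖².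
  have hF := (hinv.real_mul (w.isPrimitive.re_conj_mul w.isPrimitive)).neg
  have hnorm : ∀ x, 0 < x → ‖((x⁻¹ : ℝ) : ℂ) * w.toFun x‖ ^ 2 = (x ^ 2)⁻¹ * ‖w.toFun x‖ ^ 2 := by
    intro x hx
    rw [norm_mul, mul_pow, Complex.norm_real, Real.norm_eq_abs, sq_abs, inv_pow]
  have hsq : ∀ z : ℂ, (starRingEnd ℂ z * z).re = ‖z‖ ^ 2 := fun z => by
    rw [mul_comm, Complex.mul_conj, Complex.ofReal_re, Complex.normSq_eq_norm_sq]
  have hbound : ∀ a b, 0 < a → a ≤ b →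
      ∫ x in a..b, ‖((x⁻¹ : ℝ) : ℂ) * w.toFun x‖ ^ 2 ≤ 6 * ‖derivL q w‖ ^ 2 := by
    intro a b ha hab
    have hs : Icc a b ⊆ Ioi 0 := fun x hx => ha.trans_le hx.1
    have hi1 : IntervalIntegrable (fun x => ‖((x⁻¹ : ℝ) : ℂ) * w.toFun x‖ ^ 2) volume a b :=
      (((hcont.mono hs).norm.pow 2).intervalIntegrable_of_Icc hab)
    have hi2 : IntervalIntegrable (fun x => ‖deriv w.toFun x‖ ^ 2) volume a b := by
      rw [intervalIntegrable_iff_integrableOn_Ioc_of_le hab]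
      exact (integrableOn_norm_sq w.memLp_deriv).mono_set (Ioc_subset_Icc_self.trans hs)
    have h1 : ∫ x in a..b, ((1 / 2) * ‖((x⁻¹ : ℝ) : ℂ) * w.toFun x‖ ^ 2
        - 2 * ‖deriv w.toFun x‖ ^ 2) ≤ a⁻¹ * ‖w.toFun a‖ ^ 2 := by
      have h2 := hF.sub_eq a b ha hab
      have h3 : ∫ x in a..b, ((1 / 2) * ‖((x⁻¹ : ℝ) : ℂ) * w.toFun x‖ ^ 2
          - 2 * ‖deriv w.toFun x‖ ^ 2) ≤ -(b⁻¹ * (starRingEnd ℂ (w.toFun b) * w.toFun b).re) -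
            -(a⁻¹ * (starRingEnd ℂ (w.toFun a) * w.toFun a).re) := by
        rw [h2]
        refine intervalIntegral.integral_mono_on hab
          ((hi1.const_mul _).sub (hi2.const_mul _)) (hF.intervalIntegrable a b ha hab) ?_
        intro x hx
        have hx0 : 0 < x := hs hx
        rw [hnorm x hx0, hsq]
        have e1 : (starRingEnd ℂ (deriv w.toFun x) * w.toFun x).re ≤
            ‖deriv w.toFun x‖ * ‖w.toFun x‖ := by
          refine (Complex.re_le_norm _).trans ?_
          rw [norm_mul, RCLike.norm_conj]
        have e2 : (starRingEnd ℂ (w.toFun x) * deriv w.toFun x).re ≤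
            ‖deriv w.toFun x‖ * ‖w.toFun x‖ := by
          refine (Complex.re_le_norm _).trans ?_
          rw [norm_mul, RCLike.norm_conj, mul_comm]
        have e3 : x⁻¹ * ((starRingEnd ℂ (deriv w.toFun x) * w.toFun x).re +
            (starRingEnd ℂ (w.toFun x) * deriv w.toFun x).re) ≤
            x⁻¹ * (2 * (‖deriv w.toFun x‖ * ‖w.toFun x‖)) :=
          mul_le_mul_of_nonneg_left (by linarith) (by positivity)
        have e4 := sq_nonneg (x⁻¹ * ‖w.toFun x‖ - 2 * ‖deriv w.toFun x‖)
        rw [← inv_pow]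
        nlinarith
      have h4 : 0 ≤ b⁻¹ * (starRingEnd ℂ (w.toFun b) * w.toFun b).re := by
        rw [hsq]
        have : 0 < b := ha.trans_le hab
        positivity
      rw [hsq (w.toFun a)] at h3
      linarith
    have h5 : a⁻¹ * ‖w.toFun a‖ ^ 2 ≤ ‖derivL q w‖ ^ 2 := by
      rw [inv_mul_le_iff₀ ha]
      exact w.norm_sq_toFun_le ha.le
    have h6 : ∫ x in a..b, ‖deriv w.toFun x‖ ^ 2 ≤ ‖derivL q w‖ ^ 2 := by
      rw [derivL_apply, norm_sq_toLp, intervalIntegral.integral_of_le hab]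
      exact setIntegral_mono_set (integrableOn_norm_sq w.memLp_deriv)
        (Eventually.of_forall fun x => by positivity)
        (Eventually.of_forall (Ioc_subset_Icc_self.trans hs))
    rw [intervalIntegral.integral_sub (hi1.const_mul _) (hi2.const_mul _),
      intervalIntegral.integral_const_mul, intervalIntegral.integral_const_mul] at h1
    linarith
  have hn : ∀ n : ℕ, (1 : ℝ) / (n + 1) ≤ n + 1 := fun n => by
    rw [div_le_iff₀ (by positivity)]
    nlinarith [(Nat.cast_nonneg n : (0 : ℝ) ≤ n)]
  have hsub : ∀ n : ℕ, Ioc ((1 : ℝ) / (n + 1)) ((n : ℝ) + 1) ∩ Ioi 0 =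
      Ioc ((1 : ℝ) / (n + 1)) ((n : ℝ) + 1) := fun n =>
    inter_eq_left.2 fun x hx => lt_trans (by positivity : (0 : ℝ) < 1 / (n + 1)) hx.1
  have hb' : ∀ n : ℕ, ∫ x in Ioc ((1 : ℝ) / (n + 1)) ((n : ℝ) + 1),
      ‖((x⁻¹ : ℝ) : ℂ) * w.toFun x‖ ^ 2 ∂halfLine ≤ 6 * ‖derivL q w‖ ^ 2 := by
    intro n
    rw [Measure.restrict_restrict measurableSet_Ioc, hsub,
      ← intervalIntegral.integral_of_le (hn n)]
    exact hbound _ _ (by positivity) (hn n)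
  have hint : Integrable (fun x => ‖((x⁻¹ : ℝ) : ℂ) * w.toFun x‖ ^ 2) halfLine := by
    refine aecover_halfLine.integrable_of_integral_bounded_of_nonneg_ae (6 * ‖derivL q w‖ ^ 2)
      (fun n => ?_) (Eventually.of_forall fun x => by positivity) (Eventually.of_forall hb')
    rw [IntegrableOn, Measure.restrict_restrict measurableSet_Ioc, hsub]
    rw [← IntegrableOn, ← integrableOn_Icc_iff_integrableOn_Ioc]
    refine ContinuousOn.integrableOn_Icc ((hcont.norm.pow 2).mono fun x hx => ?_)
    exact lt_of_lt_of_le (by positivity : (0 : ℝ) < 1 / (n + 1)) hx.1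
  refine ⟨(memLp_two_iff_integrable_sq_norm hmeas).2 hint, ?_⟩
  exact le_of_tendsto (aecover_halfLine.integral_tendsto_of_countably_generated hint)
    (Eventually.of_forall hb')

end HDot

lemma IsPrimitive.ae_hasDerivAt_halfLine {E : Type*} [NormedAddCommGroup E] [NormedSpace ℝ E]
    [CompleteSpace E] {f f' : ℝ → E} (h : IsPrimitive f f') :
    ∀ᵐ x ∂halfLine, HasDerivAt f (f' x) x := by
  rw [ae_restrict_iff' measurableSet_Ioi]
  have h1 : ∀ᵐ x, ∀ n : ℕ, x ∈ Ioo ((1 : ℝ) / (n + 2)) ((n : ℝ) + 2) → HasDerivAt f (f' x) x := by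
    refine ae_all_iff.2 fun n => h.ae_hasDerivAt (by positivity) ?_
    rw [div_lt_iff₀ (by positivity)]
    nlinarith [(Nat.cast_nonneg n : (0 : ℝ) ≤ n)]
  filter_upwards [h1] with x hx hx0
  obtain ⟨n, hn⟩ := exists_nat_gt (max x x⁻¹)
  refine hx n ⟨?_, ?_⟩
  · have : x⁻¹ < n + 2 := by linarith [le_max_right x x⁻¹]
    rw [one_div]
    exact inv_lt_of_inv_lt₀ hx0 this
  · linarith [le_max_left x x⁻¹]

lemma IsPrimitive.eq_integral {f v : ℝ → ℂ} (h : IsPrimitive f v) (h0 : Tendsto f (𝓝[>] 0) (𝓝 0))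
    (hv : IntervalIntegrable v volume 0 1) {x : ℝ} (hx : 0 < x) :
    f x = ∫ y in (0 : ℝ)..x, v y := by
  have hvx : IntervalIntegrable v volume 0 x := hv.trans (h.intervalIntegrable' one_pos hx)
  have h1 := intervalIntegral.continuousOn_primitive_interval' hvx left_mem_uIcc 0 left_mem_uIcc
  rw [ContinuousWithinAt, intervalIntegral.integral_same, uIcc_of_le hx.le,
    nhdsWithin_Icc_eq_nhdsGE hx] at h1
  have h2 : Tendsto (fun a => f a + ((∫ y in (0 : ℝ)..x, v y) - ∫ y in (0 : ℝ)..a, v y)) (𝓝[>] 0)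
      (𝓝 (0 + ((∫ y in (0 : ℝ)..x, v y) - 0))) :=
    h0.add ((h1.mono_left (nhdsWithin_mono _ Ioi_subset_Ici_self)).const_sub _)
  rw [zero_add, sub_zero] at h2
  refine tendsto_nhds_unique (tendsto_const_nhds.congr' ?_) h2
  filter_upwards [Ioo_mem_nhdsGT hx] with a ha
  rw [h.eq_add ha.1 hx, intervalIntegral.integral_interval_sub_left hvx
    (hvx.mono_set (uIcc_subset_uIcc left_mem_uIcc (by
      rw [uIcc_of_le hx.le]; exact ⟨ha.1.le, ha.2.le⟩)))]

lemma isPrimitive_integral {v : ℝ → ℂ} (hv : MemLp v 2 halfLine) :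
    IsPrimitive (fun x => ∫ y in (0 : ℝ)..x, v y) v where
  intervalIntegrable _ _ ha hab := hv.intervalIntegrable_halfLine ha.le hab
  sub_eq a b ha hab := by
    rw [sub_eq_iff_eq_add', intervalIntegral.integral_add_adjacent_intervals
        (hv.intervalIntegrable_halfLine le_rfl ha.le) (hv.intervalIntegrable_halfLine ha.le hab)]

lemma norm_sq_integral_le {v : ℝ → ℂ} (hv : MemLp v 2 halfLine) {x : ℝ} (hx : 0 ≤ x) :
    ‖∫ y in (0 : ℝ)..x, v y‖ ^ 2 ≤ x * ‖hv.toLp v‖ ^ 2 := by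
  have h := sq_integral_norm_le_mul_norm_sq hv le_rfl hx
  rw [sub_zero] at h
  refine le_trans ?_ h
  gcongr
  exact intervalIntegral.norm_integral_le_integral_norm hx

namespace HDot

variable {q : ℝ → ℝ}

/-- The element of `HDot q` given by an absolutely continuous function on `(0, ∞)`. -/
noncomputable def ofPrimitive (f f' : ℝ → ℂ) (h : IsPrimitive f f')
    (h0 : Tendsto f (𝓝[>] 0) (𝓝 0)) (hf' : MemLp f' 2 halfLine)
    (hq : MemLp (fun x => (√(q x) : ℂ) * f x) 2 halfLine) : HDot q :=
  ⟨(Ioi 0).indicator f, fun x hx => indicator_of_notMem (not_lt.2 hx) f,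
    ⟨f', hf', fun x hx => by
      rcases hx.eq_or_lt with rfl | hx
      · simp
      · rw [indicator_of_mem (show x ∈ Ioi (0 : ℝ) from hx)]
        exact h.eq_integral h0 (hf'.intervalIntegrable_halfLine le_rfl zero_le_one) hx⟩,
    hq.ae_eq (by
      filter_upwards [ae_restrict_mem measurableSet_Ioi] with x hx
      rw [indicator_of_mem hx])⟩

section

variable {f f' : ℝ → ℂ} (h : IsPrimitive f f') (h0 : Tendsto f (𝓝[>] 0) (𝓝 0))
    (hf' : MemLp f' 2 halfLine) (hq : MemLp (fun x => (√(q x) : ℂ) * f x) 2 halfLine)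

lemma toFun_ofPrimitive {x : ℝ} (hx : 0 < x) : (ofPrimitive f f' h h0 hf' hq).toFun x = f x :=
  indicator_of_mem (show x ∈ Ioi (0 : ℝ) from hx) f

lemma deriv_eq_of_isPrimitive (w : HDot q) {f f' : ℝ → ℂ} (h : IsPrimitive f f')
    (hw : ∀ x, 0 < x → w.toFun x = f x) : deriv w.toFun =ᵐ[halfLine] f' := by
  filter_upwards [h.ae_hasDerivAt_halfLine, ae_restrict_mem measurableSet_Ioi] with x hx hx0
  refine (hx.congr_of_eventuallyEq ?_).deriv
  filter_upwards [Ioi_mem_nhds hx0] with y hy using hw y hy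

lemma derivL_ofPrimitive : derivL q (ofPrimitive f f' h h0 hf' hq) = hf'.toLp f' := by
  rw [derivL_apply, MemLp.toLp_eq_toLp_iff]
  exact deriv_eq_of_isPrimitive _ h fun x hx => toFun_ofPrimitive h h0 hf' hq hx

lemma potL_ofPrimitive : potL q (ofPrimitive f f' h h0 hf' hq) = hq.toLp _ := by
  rw [potL_apply, MemLp.toLp_eq_toLp_iff]
  filter_upwards [ae_restrict_mem measurableSet_Ioi] with x hx
  rw [toFun_ofPrimitive h h0 hf' hq hx]

end

lemma norm_toFun_sub_integral_le (w : HDot q) {v : ℝ → ℂ} (hv : MemLp v 2 halfLine) {x : ℝ}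
    (hx : 0 ≤ x) : ‖w.toFun x - ∫ y in (0 : ℝ)..x, v y‖ ^ 2 ≤
      x * ‖derivL q w - hv.toLp v‖ ^ 2 := by
  rw [w.toFun_eq_integral hx, ← intervalIntegral.integral_sub
    (w.memLp_deriv.intervalIntegrable_halfLine le_rfl hx) (hv.intervalIntegrable_halfLine le_rfl hx),
    derivL_apply, ← MemLp.toLp_sub]
  exact norm_sq_integral_le (w.memLp_deriv.sub hv) hx

/-- Pointwise convergence of functions whose derivatives converge in `L²`. -/
lemma tendsto_toFun_integral {u : ℕ → HDot q} {v : HL2}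
    (h : Tendsto (fun n => derivL q (u n)) atTop (𝓝 v)) {x : ℝ} (hx : 0 ≤ x) :
    Tendsto (fun n => (u n).toFun x) atTop (𝓝 (∫ y in (0 : ℝ)..x, v y)) := by
  rw [tendsto_iff_norm_sub_tendsto_zero]
  have h1 : Tendsto (fun n => √(x * ‖derivL q (u n) - v‖ ^ 2)) atTop (𝓝 0) := by
    have h2 := ((tendsto_iff_norm_sub_tendsto_zero.1 h).pow 2).const_mul x
    have := (Real.continuous_sqrt.tendsto _).comp h2
    simpa [Function.comp_def] using this
  refine squeeze_zero (fun _ => norm_nonneg _) (fun n => Real.le_sqrt_of_sq_le ?_) h1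
  have := (u n).norm_toFun_sub_integral_le (Lp.memLp v) hx
  rwa [Lp.toLp_coeFn] at this

/-- A subsequence of an L² convergent sequence converges almost everywhere, so the L² limit agrees
with the pointwise limit. -/
lemma ae_eq_of_tendsto {f : ℕ → HL2} {g : HL2} (h : Tendsto f atTop (𝓝 g)) {F : ℕ → ℝ → ℂ}
    {G : ℝ → ℂ} (hF : ∀ n, f n =ᵐ[halfLine] F n)
    (hG : ∀ᵐ x ∂halfLine, Tendsto (fun n => F n x) atTop (𝓝 (G x))) : g =ᵐ[halfLine] G := by
  obtain ⟨ns, hns, hlim⟩ := (tendstoInMeasure_of_tendsto_Lp h).exists_seq_tendsto_ae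
  filter_upwards [hlim, hG, ae_all_iff.2 hF] with x h1 h2 h3
  refine tendsto_nhds_unique h1 ?_
  simp only [h3]
  exact h2.comp hns.tendsto_atTop

/-- If the derivatives converge in L², the functions converge pointwise to the primitive of the
limit. This identifies the L² limit of √q w without any regularity of q. -/
instance : CompleteSpace (HDot q) := by
  refine Metric.complete_of_cauchySeq_tendsto fun u hu => ?_
  obtain ⟨v, hv⟩ := cauchySeq_tendsto_of_complete ((derivL q).uniformContinuous.comp_cauchySeq hu)
  obtain ⟨k, hk⟩ := cauchySeq_tendsto_of_complete ((potL q).uniformContinuous.comp_cauchySeq hu)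
  have hkw : k =ᵐ[halfLine] fun x => (√(q x) : ℂ) * ∫ y in (0 : ℝ)..x, v y := by
    refine ae_eq_of_tendsto hk (fun n => coeFn_potL (u n)) ?_
    filter_upwards [ae_restrict_mem measurableSet_Ioi] with x hx
    exact (tendsto_toFun_integral hv (le_of_lt hx)).const_mul _
  have hvm := Lp.memLp v
  have hq : MemLp (fun x => (√(q x) : ℂ) * ∫ y in (0 : ℝ)..x, v y) 2 halfLine :=
    (Lp.memLp k).ae_eq hkw
  have h0 : Tendsto (fun x => ∫ y in (0 : ℝ)..x, v y) (𝓝[>] 0) (𝓝 0) := by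
    have h1 := intervalIntegral.continuousOn_primitive_interval'
      (hvm.intervalIntegrable_halfLine le_rfl zero_le_one) left_mem_uIcc 0 left_mem_uIcc
    rw [ContinuousWithinAt, intervalIntegral.integral_same, uIcc_of_le zero_le_one,
      nhdsWithin_Icc_eq_nhdsGE zero_lt_one] at h1
    exact h1.mono_left (nhdsWithin_mono _ Ioi_subset_Ici_self)
  refine ⟨ofPrimitive _ _ (isPrimitive_integral hvm) h0 hvm hq, ?_⟩
  rw [tendsto_iff_norm_sub_tendsto_zero]
  have h1 := tendsto_iff_norm_sub_tendsto_zero.1 hv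
  have h2 := tendsto_iff_norm_sub_tendsto_zero.1 hk
  have h3 := (Real.continuous_sqrt.tendsto _).comp ((h1.pow 2).add (h2.pow 2))
  refine Tendsto.congr (fun n => ?_) (by simpa [Function.comp_def] using h3)
  rw [eq_comm, ← Real.sqrt_sq (norm_nonneg _), norm_sq_eq, map_sub, map_sub, derivL_ofPrimitive,
    potL_ofPrimitive, Lp.toLp_coeFn]
  rw [show hq.toLp _ = k from (Lp.ext (hkw.trans (MemLp.coeFn_toLp hq).symm)).symm]

end HDot

/-! ### Multiplication operators -/

section Multiplication

variable {m : ℝ → ℝ}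

lemma memLp_ofReal_mul (hm : AEStronglyMeasurable m halfLine) {C : ℝ} (hC : ∀ x, 0 < x → |m x| ≤ C)
    {f : ℝ → ℂ} (hf : MemLp f 2 halfLine) : MemLp (fun x => (m x : ℂ) * f x) 2 halfLine := by
  refine hf.of_le_mul (c := C)
    ((Complex.continuous_ofReal.comp_aestronglyMeasurable hm).mul hf.1) ?_
  filter_upwards [ae_restrict_mem measurableSet_Ioi] with x hx
  rw [norm_mul, Complex.norm_real, Real.norm_eq_abs]
  exact mul_le_mul_of_nonneg_right (hC x hx) (norm_nonneg _)

/-- Multiplication by a bounded measurable function on `L²(0, ∞)`. -/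
noncomputable def mulL (m : ℝ → ℝ) (hm : AEStronglyMeasurable m halfLine) (C : ℝ)
    (hC : ∀ x, 0 < x → |m x| ≤ C) : HL2 →L[ℂ] HL2 :=
  LinearMap.mkContinuous
    { toFun := fun f => (memLp_ofReal_mul hm hC (Lp.memLp f)).toLp (fun x => (m x : ℂ) * f x)
      map_add' := fun f g => by
        rw [← MemLp.toLp_add, MemLp.toLp_eq_toLp_iff]
        filter_upwards [Lp.coeFn_add f g] with x hx
        rw [hx, Pi.add_apply, Pi.add_apply, mul_add]
      map_smul' := fun c f => by
        rw [RingHom.id_apply, ← MemLp.toLp_const_smul, MemLp.toLp_eq_toLp_iff]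
        filter_upwards [Lp.coeFn_smul c f] with x hx
        rw [hx, Pi.smul_apply, Pi.smul_apply, smul_eq_mul, smul_eq_mul, mul_left_comm] } C
    fun f => by
      refine Lp.norm_le_mul_norm_of_ae_le_mul ?_
      filter_upwards [(memLp_ofReal_mul hm hC (Lp.memLp f)).coeFn_toLp,
        ae_restrict_mem measurableSet_Ioi] with x h1 hx
      change ‖((memLp_ofReal_mul hm hC (Lp.memLp f)).toLp (fun x => (m x : ℂ) * f x)) x‖ ≤ _
      rw [h1, norm_mul, Complex.norm_real, Real.norm_eq_abs]
      exact mul_le_mul_of_nonneg_right (hC x hx) (norm_nonneg _)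

lemma coeFn_mulL (hm : AEStronglyMeasurable m halfLine) (C : ℝ) (hC : ∀ x, 0 < x → |m x| ≤ C)
    (f : HL2) : mulL m hm C hC f =ᵐ[halfLine] fun x => (m x : ℂ) * f x :=
  (memLp_ofReal_mul hm hC (Lp.memLp f)).coeFn_toLp

end Multiplication

/-! ### Multiplication and inclusion operators on the energy space -/

namespace HDot

variable {q m : ℝ → ℝ}

/-- By Hardy's inequality x⁻² is dominated by the energy density whatever q is, so a weight acts
boundedly on the energy space once its square is at most a multiple of q + x⁻². -/
lemma norm_sq_ofReal_mul_le {C : ℝ} (hC0 : 0 ≤ C)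
    (hC : ∀ x, 0 < x → m x ^ 2 ≤ C * (q x + (x ^ 2)⁻¹)) (w : HDot q) {x : ℝ} (hx : 0 < x) :
    ‖(m x : ℂ) * w.toFun x‖ ^ 2 ≤ C * (‖(√(q x) : ℂ) * w.toFun x‖ ^ 2 +
      ‖((x⁻¹ : ℝ) : ℂ) * w.toFun x‖ ^ 2) := by
  simp only [norm_mul, Complex.norm_real, Real.norm_eq_abs, mul_pow, sq_abs, ← add_mul,
    ← mul_assoc]
  refine mul_le_mul_of_nonneg_right ((hC x hx).trans ?_) (by positivity)
  rw [inv_pow]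
  gcongr
  -- No sign of q is assumed: where q is negative its square root is 0, which only helps.
  rcases le_total 0 (q x) with h | h
  · rw [Real.sq_sqrt h]
  · exact h.trans (sq_nonneg _)

lemma memLp_ofReal_mul (hm : AEStronglyMeasurable m halfLine) {C : ℝ} (hC0 : 0 ≤ C)
    (hC : ∀ x, 0 < x → m x ^ 2 ≤ C * (q x + (x ^ 2)⁻¹)) (w : HDot q) :
    MemLp (fun x => (m x : ℂ) * w.toFun x) 2 halfLine := by
  have hmeas : AEStronglyMeasurable (fun x => (m x : ℂ) * w.toFun x) halfLine :=
    (Complex.continuous_ofReal.comp_aestronglyMeasurable hm).mul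
      (w.continuousOn.aestronglyMeasurable measurableSet_Ioi)
  rw [memLp_two_iff_integrable_sq_norm hmeas]
  refine Integrable.mono' (((integrableOn_norm_sq w.memLp_sqrt_mul).add
    (integrableOn_norm_sq w.hardy.1)).const_mul C) (hmeas.norm.pow 2) ?_
  filter_upwards [ae_restrict_mem measurableSet_Ioi] with x hx
  rw [Real.norm_of_nonneg (by positivity)]
  exact w.norm_sq_ofReal_mul_le hC0 hC hx

lemma norm_sq_toLp_le (hm : AEStronglyMeasurable m halfLine) {C : ℝ} (hC0 : 0 ≤ C)
    (hC : ∀ x, 0 < x → m x ^ 2 ≤ C * (q x + (x ^ 2)⁻¹)) (w : HDot q) :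
    ‖(w.memLp_ofReal_mul hm hC0 hC).toLp _‖ ^ 2 ≤ 6 * C * ‖w‖ ^ 2 := by
  rw [norm_sq_toLp]
  have h1 : ∫ x in Ioi 0, ‖(m x : ℂ) * w.toFun x‖ ^ 2 ≤
      ∫ x in Ioi 0, C * (‖(√(q x) : ℂ) * w.toFun x‖ ^ 2 + ‖((x⁻¹ : ℝ) : ℂ) * w.toFun x‖ ^ 2) :=
    setIntegral_mono_on (integrableOn_norm_sq (w.memLp_ofReal_mul hm hC0 hC))
      (((integrableOn_norm_sq w.memLp_sqrt_mul).add (integrableOn_norm_sq w.hardy.1)).const_mul C)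
      measurableSet_Ioi fun x hx => w.norm_sq_ofReal_mul_le hC0 hC hx
  rw [integral_const_mul, integral_add (integrableOn_norm_sq w.memLp_sqrt_mul)
    (integrableOn_norm_sq w.hardy.1), ← norm_sq_toLp w.memLp_sqrt_mul, ← potL_apply] at h1
  refine h1.trans ?_
  rw [norm_sq_eq]
  have := w.hardy.2
  nlinarith [mul_le_mul_of_nonneg_left this hC0, mul_nonneg hC0 (sq_nonneg ‖potL q w‖)]

/-- Multiplication `w ↦ m w` from `HDot q` to `L²(0, ∞)`, for `m² ≲ q + x⁻²`. -/
noncomputable def mulL (m : ℝ → ℝ) (hm : AEStronglyMeasurable m halfLine) (C : ℝ) (hC0 : 0 ≤ C)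
    (hC : ∀ x, 0 < x → m x ^ 2 ≤ C * (q x + (x ^ 2)⁻¹)) : HDot q →L[ℂ] HL2 :=
  LinearMap.mkContinuous
    { toFun := fun w => (w.memLp_ofReal_mul hm hC0 hC).toLp (fun x => (m x : ℂ) * w.toFun x)
      map_add' := fun f g => by
        rw [← MemLp.toLp_add, MemLp.toLp_eq_toLp_iff]
        refine Eventually.of_forall fun x => ?_
        simp only [toFun_add, Pi.add_apply, mul_add]
      map_smul' := fun c f => by
        rw [RingHom.id_apply, ← MemLp.toLp_const_smul, MemLp.toLp_eq_toLp_iff]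
        refine Eventually.of_forall fun x => ?_
        simp only [toFun_smul, Pi.smul_apply, smul_eq_mul, mul_left_comm] } (√(6 * C))
    fun w => by
      rw [← Real.sqrt_sq (norm_nonneg w), ← Real.sqrt_mul (by positivity)]
      exact Real.le_sqrt_of_sq_le (w.norm_sq_toLp_le hm hC0 hC)

lemma coeFn_mulL (hm : AEStronglyMeasurable m halfLine) (C : ℝ) (hC0 : 0 ≤ C)
    (hC : ∀ x, 0 < x → m x ^ 2 ≤ C * (q x + (x ^ 2)⁻¹)) (w : HDot q) :
    mulL m hm C hC0 hC w =ᵐ[halfLine] fun x => (m x : ℂ) * w.toFun x :=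
  (w.memLp_ofReal_mul hm hC0 hC).coeFn_toLp

/-- The inclusion of energy spaces, for `q' ≲ q + x⁻²`, as a map. -/
noncomputable def inclFun (q q' : ℝ → ℝ) (hq' : AEStronglyMeasurable q' halfLine) (C : ℝ)
    (hC0 : 0 ≤ C) (hC : ∀ x, 0 < x → √(q' x) ^ 2 ≤ C * (q x + (x ^ 2)⁻¹)) (w : HDot q) : HDot q' :=
  ofPrimitive w.toFun (deriv w.toFun) w.isPrimitive w.tendsto_toFun_zero w.memLp_deriv
    (w.memLp_ofReal_mul (Real.continuous_sqrt.comp_aestronglyMeasurable hq') hC0 hC)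

section

variable (q q' : ℝ → ℝ) (hq' : AEStronglyMeasurable q' halfLine) (C : ℝ) (hC0 : 0 ≤ C)
  (hC : ∀ x, 0 < x → √(q' x) ^ 2 ≤ C * (q x + (x ^ 2)⁻¹)) (w : HDot q)

lemma toFun_inclFun : (inclFun q q' hq' C hC0 hC w).toFun = w.toFun := by
  funext x
  rcases le_or_gt x 0 with hx | hx
  · rw [toFun_of_nonpos _ hx, toFun_of_nonpos _ hx]
  · rw [inclFun, toFun_ofPrimitive _ _ _ _ hx]

/-- The inclusion of energy spaces, for `q' ≲ q + x⁻²`, as a linear map. -/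
noncomputable def inclₗ : HDot q →ₗ[ℂ] HDot q' where
  toFun := inclFun q q' hq' C hC0 hC
  map_add' w w' := ext_toFun fun x _ => by
    rw [toFun_add, toFun_inclFun, toFun_inclFun, toFun_inclFun, toFun_add]
  map_smul' c w := ext_toFun fun x _ => by
    rw [RingHom.id_apply, toFun_smul, toFun_inclFun, toFun_inclFun, toFun_smul]

lemma toFun_inclₗ : (inclₗ q q' hq' C hC0 hC w).toFun = w.toFun :=
  toFun_inclFun q q' hq' C hC0 hC w

lemma derivL_congr {w : HDot q} {w' : HDot q'} (h : w'.toFun = w.toFun) :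
    derivL q' w' = derivL q w := by
  rw [derivL_apply, derivL_apply, MemLp.toLp_eq_toLp_iff, h]

lemma norm_inclₗ_le : ‖inclₗ q q' hq' C hC0 hC w‖ ≤ √(1 + 6 * C) * ‖w‖ := by
  rw [← Real.sqrt_sq (norm_nonneg w), ← Real.sqrt_mul (by positivity)]
  refine Real.le_sqrt_of_sq_le ?_
  rw [norm_sq_eq, add_mul, one_mul, derivL_congr q q' (toFun_inclₗ q q' hq' C hC0 hC w)]
  refine add_le_add (pow_le_pow_left₀ (norm_nonneg _) w.norm_derivL_le 2) ?_
  refine le_trans (le_of_eq ?_)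
    (w.norm_sq_toLp_le (Real.continuous_sqrt.comp_aestronglyMeasurable hq') hC0 hC)
  congr 2
  rw [potL_apply, MemLp.toLp_eq_toLp_iff, toFun_inclₗ]

/-- The inclusion of energy spaces, for `q' ≲ q + x⁻²`. -/
noncomputable def incl : HDot q →L[ℂ] HDot q' :=
  (inclₗ q q' hq' C hC0 hC).mkContinuous (√(1 + 6 * C)) (norm_inclₗ_le q q' hq' C hC0 hC)

lemma toFun_incl : (incl q q' hq' C hC0 hC w).toFun = w.toFun :=
  toFun_inclₗ q q' hq' C hC0 hC w

end

/-- Multiplication by a cutoff function `χ` with `|χ| ≤ 1` and `|χ'| ≤ K / x`. -/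
noncomputable def cutoff {q q' : ℝ → ℝ} (χ χ' : ℝ → ℝ) (hχ : ∀ x, HasDerivAt χ (χ' x) x)
    (hχ' : Continuous χ') (h1 : ∀ x, |χ x| ≤ 1) (K : ℝ) (hK : ∀ x, 0 < x → |χ' x| ≤ K * x⁻¹)
    (hqq : ∀ x, 0 < x → χ x ≠ 0 → q' x = q x) (w : HDot q) : HDot q' :=
  have hχc : Continuous χ := continuous_iff_continuousAt.2 fun x => (hχ x).continuousAt
  have hp : IsPrimitive (fun x => (χ x : ℂ)) (fun x => (χ' x : ℂ)) :=
    (IsPrimitive.of_hasDerivAt (fun x _ => hχ x) hχ'.continuousOn).ofReal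
  ofPrimitive (fun x => (χ x : ℂ) * w.toFun x)
    (fun x => (χ' x : ℂ) * w.toFun x + (χ x : ℂ) * deriv w.toFun x) (hp.mul w.isPrimitive)
    (by
      have := (((Complex.continuous_ofReal.comp hχc).tendsto 0).mono_left
        (nhdsWithin_le_nhds (s := Ioi 0))).mul w.tendsto_toFun_zero
      rw [mul_zero] at this
      exact this)
    (by
      refine MemLp.add ?_ (HalfLineWave.memLp_ofReal_mul hχc.aestronglyMeasurable
        (fun x _ => h1 x) w.memLp_deriv)
      -- The term χ' w is square integrable by Hardy's inequality, since |χ'| ≤ K / x.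
      refine w.hardy.1.of_le_mul (c := K) ((Complex.continuous_ofReal.comp hχ').aestronglyMeasurable.mul
        (w.continuousOn.aestronglyMeasurable measurableSet_Ioi)) ?_
      filter_upwards [ae_restrict_mem measurableSet_Ioi] with x hx
      have hx : 0 < x := hx
      rw [norm_mul, norm_mul, Complex.norm_real, Complex.norm_real, Real.norm_eq_abs,
        Real.norm_eq_abs, abs_of_pos (inv_pos.2 hx), ← mul_assoc]
      exact mul_le_mul_of_nonneg_right (hK x hx) (norm_nonneg _))
    (by
      refine (HalfLineWave.memLp_ofReal_mul hχc.aestronglyMeasurable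
        (fun x _ => h1 x) w.memLp_sqrt_mul).ae_eq ?_
      filter_upwards [ae_restrict_mem measurableSet_Ioi] with x hx
      by_cases h : χ x = 0
      · simp [h]
      · rw [hqq x hx h, mul_left_comm])

section

variable {q q' : ℝ → ℝ} {χ χ' : ℝ → ℝ} (hχ : ∀ x, HasDerivAt χ (χ' x) x)
    (hχ' : Continuous χ') (h1 : ∀ x, |χ x| ≤ 1) (K : ℝ) (hK : ∀ x, 0 < x → |χ' x| ≤ K * x⁻¹)
    (hqq : ∀ x, 0 < x → χ x ≠ 0 → q' x = q x) (w : HDot q)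

lemma toFun_cutoff {x : ℝ} (hx : 0 < x) :
    (cutoff χ χ' hχ hχ' h1 K hK hqq w).toFun x = (χ x : ℂ) * w.toFun x := by
  unfold cutoff
  rw [toFun_ofPrimitive _ _ _ _ hx]

lemma coeFn_derivL_cutoff : derivL q' (cutoff χ χ' hχ hχ' h1 K hK hqq w) =ᵐ[halfLine]
    fun x => (χ' x : ℂ) * w.toFun x + (χ x : ℂ) * deriv w.toFun x := by
  rw [cutoff, derivL_ofPrimitive]
  exact MemLp.coeFn_toLp _

lemma coeFn_potL_cutoff : potL q' (cutoff χ χ' hχ hχ' h1 K hK hqq w) =ᵐ[halfLine]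
    fun x => (√(q' x) : ℂ) * ((χ x : ℂ) * w.toFun x) := by
  rw [cutoff, potL_ofPrimitive]
  exact MemLp.coeFn_toLp _

end

end HDot

/-! ### Cutoff functions -/

/-- The function takes its global minimum 0 for x ≤ 0 and its global maximum 1 for x ≥ 1, endpoints
included. -/
lemma deriv_smoothTransition_eq_zero {x : ℝ} (hx : x ≤ 0 ∨ 1 ≤ x) :
    deriv Real.smoothTransition x = 0 := by
  have hd : ∀ x, DifferentiableAt ℝ Real.smoothTransition x := fun x =>
    (Real.smoothTransition.contDiff (n := 1)).differentiable (by norm_num) x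
  rcases hx with hx | hx
  · refine IsLocalMin.deriv_eq_zero (Eventually.of_forall fun y => ?_)
    rw [Real.smoothTransition.zero_of_nonpos hx]
    exact Real.smoothTransition.nonneg y
  · refine IsLocalMax.deriv_eq_zero (Eventually.of_forall fun y => ?_)
    rw [Real.smoothTransition.one_of_one_le hx]
    exact Real.smoothTransition.le_one y

lemma continuous_deriv_smoothTransition : Continuous (deriv Real.smoothTransition) :=
  (Real.smoothTransition.contDiff (n := 1)).continuous_deriv (by norm_num)

lemma exists_bound_deriv_smoothTransition : ∃ K, 0 ≤ K ∧ ∀ x, |deriv Real.smoothTransition x| ≤ K := by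
  obtain ⟨K, hK⟩ := isCompact_Icc.exists_bound_of_continuousOn
    (continuous_deriv_smoothTransition.continuousOn (s := Icc 0 1))
  refine ⟨max K 0, le_max_right _ _, fun x => ?_⟩
  by_cases hx : x ∈ Icc (0 : ℝ) 1
  · exact (hK x hx).trans (le_max_left _ _)
  · rw [deriv_smoothTransition_eq_zero, abs_zero]
    · exact le_max_right _ _
    · rw [mem_Icc, not_and_or, not_le, not_le] at hx
      exact hx.imp le_of_lt le_of_lt

/-- A smooth function which vanishes for `x ≤ r` and equals `1` for `x ≥ 2 r`. -/
noncomputable def step (r x : ℝ) : ℝ := Real.smoothTransition (x / r - 1)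

/-- The derivative of `step r`. -/
noncomputable def stepDeriv (r x : ℝ) : ℝ := deriv Real.smoothTransition (x / r - 1) * (1 / r)

lemma hasDerivAt_step (r x : ℝ) : HasDerivAt (step r) (stepDeriv r x) x := by
  have h : HasDerivAt Real.smoothTransition (deriv Real.smoothTransition (x / r - 1)) (x / r - 1) :=
    ((Real.smoothTransition.contDiff (n := 1)).differentiable (by norm_num) _).hasDerivAt
  exact h.comp x (((hasDerivAt_id x).div_const r).sub_const 1)

lemma continuous_step (r : ℝ) : Continuous (step r) :=
  Real.smoothTransition.continuous.comp (by fun_prop)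

lemma continuous_stepDeriv (r : ℝ) : Continuous (stepDeriv r) :=
  (continuous_deriv_smoothTransition.comp (by fun_prop)).mul continuous_const

lemma step_nonneg (r x : ℝ) : 0 ≤ step r x := Real.smoothTransition.nonneg _

lemma step_le_one (r x : ℝ) : step r x ≤ 1 := Real.smoothTransition.le_one _

lemma step_eq_zero {r x : ℝ} (hr : 0 < r) (hx : x ≤ r) : step r x = 0 :=
  Real.smoothTransition.zero_of_nonpos (by rw [sub_nonpos, div_le_one hr]; exact hx)

lemma step_eq_one {r x : ℝ} (hr : 0 < r) (hx : 2 * r ≤ x) : step r x = 1 :=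
  Real.smoothTransition.one_of_one_le (by rw [le_sub_iff_add_le, le_div_iff₀ hr]; linarith)

lemma stepDeriv_eq_zero {r x : ℝ} (hr : 0 < r) (hx : x ≤ r ∨ 2 * r ≤ x) : stepDeriv r x = 0 := by
  rw [stepDeriv, deriv_smoothTransition_eq_zero, zero_mul]
  refine hx.imp (fun h => ?_) fun h => ?_
  · rw [sub_nonpos, div_le_one hr]; exact h
  · rw [le_sub_iff_add_le, le_div_iff₀ hr]; linarith

/-- The derivative lives on r ≤ x ≤ 2 r, where 1 / r ≤ 2 / x. The constant does not depend on r, so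
Hardy's inequality bounds χ' w uniformly in the cutoff radius. -/
lemma exists_bound_stepDeriv :
    ∃ K, 0 ≤ K ∧ ∀ r x, 0 < r → 0 < x → |stepDeriv r x| ≤ K * x⁻¹ := by
  obtain ⟨K, hK0, hK⟩ := exists_bound_deriv_smoothTransition
  refine ⟨2 * K, by positivity, fun r x hr hx => ?_⟩
  by_cases h : 2 * r ≤ x
  · rw [stepDeriv_eq_zero hr (Or.inr h), abs_zero]
    positivity
  · rw [stepDeriv, abs_mul, abs_of_pos (by positivity : 0 < 1 / r)]
    have h1 : 1 / r ≤ 2 * x⁻¹ := by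
      rw [← div_eq_mul_inv, div_le_div_iff₀ hr hx]
      linarith
    calc _ ≤ K * (2 * x⁻¹) := mul_le_mul (hK _) h1 (by positivity) hK0
      _ = _ := by ring

/-! ### Admissible potentials -/

/-- The properties of the total potential which do not depend on its behaviour at zero. -/
structure IsAdmissible (q : ℝ → ℝ) : Prop where
  hasDerivAt : ∀ x, 0 < x → HasDerivAt q (deriv q x) x
  continuousOn_deriv : ContinuousOn (deriv q) (Ioi 0)
  deriv_nonpos : ∀ x, 0 < x → deriv q x ≤ 0
  pos : ∀ x, 0 < x → 0 < q x
  bound : ∃ C, 0 ≤ C ∧ ∀ x, 0 < x → q x ≤ C * (1 + (x ^ 2)⁻¹)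

lemma IsRepulsive.hasDerivAt {q : ℝ → ℝ} (h : IsRepulsive q) {x : ℝ} (hx : 0 < x) :
    HasDerivAt q (deriv q x) x :=
  ((h.contDiffOn.differentiableOn (by norm_num)).differentiableAt (Ioi_mem_nhds hx)).hasDerivAt

lemma IsRepulsive.antitoneOn {q : ℝ → ℝ} (h : IsRepulsive q) : AntitoneOn q (Ioi 0) := by
  refine antitoneOn_of_deriv_nonpos (convex_Ioi 0) h.contDiffOn.continuousOn
    (h.contDiffOn.differentiableOn (by norm_num) |>.mono interior_subset) fun x hx => ?_
  rw [interior_Ioi] at hx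
  exact (h.deriv_neg x hx).le

/-- The growth condition holds only near zero; monotonicity of q bounds it on the rest of (0, 1],
where x ^ (-κ) ≥ 1. -/
lemma GrowthAtZero.exists_bound {q : ℝ → ℝ} (h : IsRepulsive q) (hg : GrowthAtZero q) :
    ∃ κ C : ℝ, 0 < κ ∧ κ < 2 ∧ 0 ≤ C ∧ ∀ x, 0 < x → x ≤ 1 → q x ≤ C * x ^ (-κ) := by
  obtain ⟨κ, hκ, hκ2, hO, -⟩ := hg
  obtain ⟨C, hC⟩ := hO.bound
  obtain ⟨δ, hδ, hδC⟩ := mem_nhdsGT_iff_exists_Ioo_subset.1 hC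
  have hδ : 0 < δ := hδ
  have hq : 0 < q (δ / 2) := h.pos _ (by positivity)
  refine ⟨κ, |C| + q (δ / 2), hκ, hκ2, by positivity, fun x hx hx1 => ?_⟩
  have hpow : 1 ≤ x ^ (-κ) := Real.one_le_rpow_of_pos_of_le_one_of_nonpos hx hx1 (by linarith)
  rcases lt_or_ge x δ with hxδ | hxδ
  · have h1 : ‖q x‖ ≤ C * ‖x ^ (-κ)‖ := hδC ⟨hx, hxδ⟩
    rw [Real.norm_of_nonneg (by positivity : 0 ≤ x ^ (-κ))] at h1
    have h2 := (le_abs_self (q x)).trans h1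
    nlinarith [le_abs_self C]
  · have h1 : q x ≤ q (δ / 2) := h.antitoneOn (show 0 < δ / 2 by positivity) hx (by linarith)
    nlinarith [abs_nonneg C]

lemma isAdmissible_potential {lam : ℝ} {q₀ : ℝ → ℝ} (hlam : lam = 0 ∨ 3 / 4 ≤ lam)
    (hq : IsRepulsive q₀) (hg : GrowthAtZero q₀) : IsAdmissible (potential lam q₀) := by
  have hlam0 : 0 ≤ lam := by rcases hlam with rfl | h <;> linarith
  have hd : ∀ x, 0 < x → HasDerivAt (potential lam q₀) (lam * (-(2 * x) / (x ^ 2) ^ 2) + deriv q₀ x) x := by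
    intro x hx
    have h1 := (((hasDerivAt_id x).pow 2).inv (by simpa using hx.ne')).const_mul lam
    have h2 := h1.add (hq.hasDerivAt hx)
    refine (h2.congr_deriv (by simp)).congr_of_eventuallyEq (Eventually.of_forall fun y => ?_)
    simp [potential, div_eq_mul_inv]
  refine ⟨fun x hx => (hd x hx).differentiableAt.hasDerivAt, ?_, fun x hx => ?_, fun x hx => ?_, ?_⟩
  · refine ContinuousOn.congr (f := fun x => lam * (-(2 * x) / (x ^ 2) ^ 2) + deriv q₀ x) ?_
      fun x hx => (hd x hx).deriv
    refine ContinuousOn.add (continuousOn_const.mul (ContinuousOn.div (by fun_prop) (by fun_prop)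
      fun x hx => ?_)) (hq.contDiffOn.continuousOn_deriv_of_isOpen isOpen_Ioi (by norm_num))
    have : 0 < x := hx
    positivity
  · rw [(hd x hx).deriv]
    have : 0 ≤ lam * (2 * x / (x ^ 2) ^ 2) := by positivity
    have h2 := hq.deriv_neg x hx
    rw [neg_div, mul_neg]
    linarith
  · have := hq.pos x hx
    unfold potential
    positivity
  · obtain ⟨κ, C, hκ, hκ2, hC, hb⟩ := GrowthAtZero.exists_bound hq hg
    have h1 := hq.pos 1 one_pos
    refine ⟨lam + C + q₀ 1, by positivity, fun x hx => ?_⟩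
    have hx2 : 0 < (x ^ 2)⁻¹ := by positivity
    have h2 : q₀ x ≤ (C + q₀ 1) * (1 + (x ^ 2)⁻¹) := by
      rcases le_total x 1 with hx1 | hx1
      · have h3 : x ^ (-κ) ≤ (x ^ 2)⁻¹ := by
          rw [← Real.rpow_natCast, ← Real.rpow_neg hx.le]
          exact Real.rpow_le_rpow_of_exponent_ge hx hx1 (by push_cast; linarith)
        have := hb x hx hx1
        nlinarith
      · have := hq.antitoneOn (show (0 : ℝ) < 1 from one_pos) hx hx1
        nlinarith
    rw [potential, div_eq_mul_inv]
    nlinarith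

/-! ### The form domain and the resolvent -/

/-- The potential of the form domain `{w : ∫ |w'|² + q |w|² + |w|² < ∞}`. -/
def formPotential (q : ℝ → ℝ) (x : ℝ) : ℝ := q x + 1

namespace IsAdmissible

variable {q : ℝ → ℝ} (hq : IsAdmissible q)

include hq

lemma continuousOn : ContinuousOn q (Ioi 0) := fun x hx =>
  (hq.hasDerivAt x hx).continuousAt.continuousWithinAt

lemma aestronglyMeasurable : AEStronglyMeasurable q halfLine :=
  hq.continuousOn.aestronglyMeasurable measurableSet_Ioi

lemma sq_sqrt {x : ℝ} (hx : 0 < x) : √(q x) ^ 2 = q x := Real.sq_sqrt (hq.pos x hx).le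

lemma antitoneOn : AntitoneOn q (Ioi 0) := by
  refine antitoneOn_of_deriv_nonpos (convex_Ioi 0) hq.continuousOn
    (fun x hx => ?_) fun x hx => ?_
  · exact (hq.hasDerivAt x (interior_subset hx)).differentiableAt.differentiableWithinAt
  · exact hq.deriv_nonpos x (interior_subset hx)

/-- The embedding of the form domain into `L²`. -/
noncomputable def embL : HDot (formPotential q) →L[ℂ] HL2 :=
  HDot.mulL (fun _ => 1) aestronglyMeasurable_const 1 zero_le_one fun x hx => by
    have := hq.pos x hx
    have : 0 < (x ^ 2)⁻¹ := by positivity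
    rw [formPotential]
    linarith

/-- The inclusion of the form domain into the energy space. -/
noncomputable def toEnergy : HDot (formPotential q) →L[ℂ] HDot q :=
  HDot.incl _ _ hq.aestronglyMeasurable 1 zero_le_one fun x hx => by
    have : 0 < (x ^ 2)⁻¹ := by positivity
    rw [hq.sq_sqrt hx, formPotential]
    linarith

lemma coeFn_embL (w : HDot (formPotential q)) : hq.embL w =ᵐ[halfLine] w.toFun := by
  refine (HDot.coeFn_mulL _ _ _ _ w).trans (Eventually.of_forall fun x => ?_)
  simp

lemma memLp_toFun (w : HDot (formPotential q)) : MemLp w.toFun 2 halfLine :=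
  (Lp.memLp (hq.embL w)).ae_eq (hq.coeFn_embL w)

lemma toFun_toEnergy (w : HDot (formPotential q)) : (hq.toEnergy w).toFun = w.toFun :=
  HDot.toFun_incl _ _ _ _ _ _ w

lemma derivL_toEnergy (w : HDot (formPotential q)) :
    HDot.derivL q (hq.toEnergy w) = HDot.derivL _ w :=
  HDot.derivL_congr _ _ (hq.toFun_toEnergy w)

lemma inner_toEnergy (w w' : HDot (formPotential q)) :
    inner ℂ (hq.toEnergy w) (hq.toEnergy w') =
      inner ℂ w w' - inner ℂ (hq.embL w) (hq.embL w') := by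
  rw [eq_sub_iff_add_eq, HDot.inner_eq, HDot.inner_eq, hq.derivL_toEnergy, hq.derivL_toEnergy,
    add_assoc]
  congr 1
  rw [L2.inner_def, L2.inner_def, L2.inner_def,
    ← integral_add (L2.integrable_inner _ _) (L2.integrable_inner _ _)]
  refine integral_congr_ae ?_
  filter_upwards [HDot.coeFn_potL (hq.toEnergy w), HDot.coeFn_potL (hq.toEnergy w'),
    hq.coeFn_embL w, hq.coeFn_embL w', HDot.coeFn_potL w, HDot.coeFn_potL w',
    ae_restrict_mem measurableSet_Ioi] with x h1 h2 h3 h4 h5 h6 hx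
  have hpos := hq.pos x hx
  rw [h1, h2, h3, h4, h5, h6, hq.toFun_toEnergy, hq.toFun_toEnergy]
  simp only [RCLike.inner_apply, map_mul, Complex.conj_ofReal]
  have e1 : ((√(q x) : ℝ) : ℂ) * ((√(q x) : ℝ) : ℂ) = (q x : ℂ) := by
    rw [← Complex.ofReal_mul, Real.mul_self_sqrt hpos.le]
  have e2 : ((√(formPotential q x) : ℝ) : ℂ) * ((√(formPotential q x) : ℝ) : ℂ) =
      (q x : ℂ) + 1 := by
    rw [← Complex.ofReal_mul, Real.mul_self_sqrt (by rw [formPotential]; positivity), formPotential]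
    push_cast
    rfl
  linear_combination (w'.toFun x * (starRingEnd ℂ) (w.toFun x)) * e1 -
    (w'.toFun x * (starRingEnd ℂ) (w.toFun x)) * e2

/-- An element of the energy space which is square integrable belongs to the form domain. -/
lemma exists_toEnergy_eq {w : HDot q} (hw : MemLp w.toFun 2 halfLine) :
    ∃ k, hq.toEnergy k = w := by
  have hmem : MemLp (fun x => (√(formPotential q x) : ℂ) * w.toFun x) 2 halfLine := by
    have hmeas : AEStronglyMeasurable (fun x => (√(formPotential q x) : ℂ) * w.toFun x) halfLine :=
      (Complex.continuous_ofReal.comp_aestronglyMeasurable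
        (Real.continuous_sqrt.comp_aestronglyMeasurable
          (hq.aestronglyMeasurable.add aestronglyMeasurable_const))).mul hw.1
    rw [memLp_two_iff_integrable_sq_norm hmeas]
    refine ((integrableOn_norm_sq w.memLp_sqrt_mul).add (integrableOn_norm_sq hw)).congr ?_
    filter_upwards [ae_restrict_mem measurableSet_Ioi] with x hx
    have hpos := hq.pos x hx
    simp only [Pi.add_apply, norm_mul, Complex.norm_real, Real.norm_eq_abs, mul_pow, sq_abs]
    rw [hq.sq_sqrt hx, Real.sq_sqrt (by rw [formPotential]; positivity), formPotential]
    ring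
  refine ⟨HDot.ofPrimitive _ _ w.isPrimitive w.tendsto_toFun_zero w.memLp_deriv hmem,
    HDot.ext_toFun fun x hx => ?_⟩
  rw [hq.toFun_toEnergy, HDot.toFun_ofPrimitive _ _ _ _ hx]

/-- Cut off at infinity: the function (1 - step (n + 1)) w lives on x ≤ 2 (n + 1), where |w| ≤ 2 (n
+ 1) |w| / x is square integrable by Hardy's inequality. The truncations converge in energy by
dominated convergence, with the derivative of the cutoff again controlled by Hardy. -/
lemma denseRange_toEnergy : DenseRange hq.toEnergy := by
  obtain ⟨K, hK0, hK⟩ := exists_bound_stepDeriv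
  intro w
  have hd : ∀ n : ℕ, ∀ x, HasDerivAt (fun x => 1 - step (n + 1) x) (-stepDeriv (n + 1) x) x :=
    fun n x => (hasDerivAt_step _ x).const_sub 1
  have hs1 : ∀ n : ℕ, ∀ x, |1 - step (n + 1) x| ≤ 1 := fun n x => by
    rw [abs_le]
    constructor <;> linarith [step_nonneg (n + 1) x, step_le_one (n + 1) x]
  have hKn : ∀ n : ℕ, ∀ x, 0 < x → |-stepDeriv (n + 1) x| ≤ K * x⁻¹ := fun n x hx => by
    rw [abs_neg]
    exact hK _ _ (by positivity) hx
  set u : ℕ → HDot q := fun n => HDot.cutoff (q' := q) _ _ (hd n) (continuous_stepDeriv _).neg (hs1 n) K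
    (hKn n) (fun _ _ _ => rfl) w with hu
  have hpt : ∀ x, 0 < x → ∀ᶠ n : ℕ in atTop, step (n + 1) x = 0 ∧ stepDeriv (n + 1) x = 0 := by
    intro x hx
    filter_upwards [tendsto_natCast_atTop_atTop.eventually (eventually_ge_atTop x)] with n hn
    exact ⟨step_eq_zero (by positivity) (by linarith),
      stepDeriv_eq_zero (by positivity) (Or.inl (by linarith))⟩
  have hmem : ∀ n, u n ∈ range hq.toEnergy := by
    intro n
    refine hq.exists_toEnergy_eq ?_
    refine w.hardy.1.of_le_mul (c := 2 * (n + 1))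
      ((u n).continuousOn.aestronglyMeasurable measurableSet_Ioi) ?_
    filter_upwards [ae_restrict_mem measurableSet_Ioi] with x hx
    have hx : 0 < x := hx
    rw [hu, HDot.toFun_cutoff _ _ _ _ _ _ _ hx, norm_mul, norm_mul, ← mul_assoc, Complex.norm_real,
      Complex.norm_real, Real.norm_eq_abs, Real.norm_eq_abs]
    refine mul_le_mul_of_nonneg_right ?_ (norm_nonneg _)
    rcases le_total (2 * ((n : ℝ) + 1)) x with h | h
    · rw [step_eq_one (by positivity) h, sub_self, abs_zero]
      positivity
    · refine (hs1 n x).trans ?_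
      rw [abs_of_pos (inv_pos.2 hx), ← div_eq_mul_inv, le_div_iff₀ hx]
      linarith
  refine mem_closure_of_tendsto (f := u) (b := atTop) ?_ (Eventually.of_forall hmem)
  -- Dominated convergence in the form needed twice: at each point the error vanishes for all large
  -- n.
  have hconv : ∀ (f : ℕ → ℝ → ℂ) (F : ℝ → ℝ) (g : ℕ → HL2), (∀ n, g n =ᵐ[halfLine] f n) →
      IntegrableOn F (Ioi 0) → (∀ n, ∀ᵐ x ∂halfLine, ‖f n x‖ ^ 2 ≤ F x) →
      (∀ x, 0 < x → ∀ᶠ n in atTop, f n x = 0) → Tendsto (fun n => ‖g n‖ ^ 2) atTop (𝓝 0) := by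
    intro f F g hg hF hfF hf0
    have hf : ∀ n, MemLp (f n) 2 halfLine := fun n => (Lp.memLp (g n)).ae_eq (hg n)
    have h1 : ∀ n, ‖g n‖ ^ 2 = ∫ x in Ioi 0, ‖f n x‖ ^ 2 := fun n => by
      rw [norm_sq_HL2]
      refine integral_congr_ae ?_
      filter_upwards [hg n] with x hx
      rw [hx]
    simp only [h1]
    have := tendsto_integral_of_dominated_convergence (μ := halfLine)
      (F := fun n x => ‖f n x‖ ^ 2) (f := fun _ => 0) F
      (fun n => (integrableOn_norm_sq (hf n)).1) hF
      (fun n => by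
        filter_upwards [hfF n] with x hx
        rwa [Real.norm_of_nonneg (by positivity)])
      (by
        filter_upwards [ae_restrict_mem measurableSet_Ioi] with x hx
        refine tendsto_const_nhds.congr' ?_
        filter_upwards [hf0 x hx] with n hn
        simp [hn])
    simpa using this
  rw [tendsto_iff_norm_sub_tendsto_zero]
  have h1 := hconv (fun n x => -(step (n + 1) x : ℂ) * deriv w.toFun x
      - (stepDeriv (n + 1) x : ℂ) * w.toFun x)
    (fun x => 2 * ‖deriv w.toFun x‖ ^ 2 + 2 * K ^ 2 * ‖((x⁻¹ : ℝ) : ℂ) * w.toFun x‖ ^ 2)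
    (fun n => HDot.derivL q (u n - w)) (fun n => by
      rw [map_sub]
      filter_upwards [Lp.coeFn_sub (HDot.derivL q (u n)) (HDot.derivL q w),
        HDot.coeFn_derivL w, HDot.coeFn_derivL_cutoff (q' := q) (hd n)
        (continuous_stepDeriv _).neg (hs1 n) K (hKn n) (fun _ _ _ => rfl) w] with x h1 h2 h3
      rw [h1, Pi.sub_apply, h2, hu, h3]
      push_cast
      ring)
    (show IntegrableOn ((fun x => 2 * ‖deriv w.toFun x‖ ^ 2) +
        fun x => 2 * K ^ 2 * ‖((x⁻¹ : ℝ) : ℂ) * w.toFun x‖ ^ 2) (Ioi 0) volume from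
      ((integrableOn_norm_sq w.memLp_deriv).const_mul 2).add
      ((integrableOn_norm_sq w.hardy.1).const_mul (2 * K ^ 2)))
    (fun n => by
      filter_upwards [ae_restrict_mem measurableSet_Ioi] with x hx
      have hx : 0 < x := hx
      have e1 : ‖-(step (n + 1) x : ℂ) * deriv w.toFun x
        - (stepDeriv (n + 1) x : ℂ) * w.toFun x‖ ≤ ‖deriv w.toFun x‖ + K * ‖((x⁻¹ : ℝ) : ℂ) * w.toFun x‖ := by
        refine (norm_sub_le _ _).trans ?_
        rw [norm_mul, norm_mul, norm_mul, norm_neg, ← mul_assoc, Complex.norm_real,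
          Complex.norm_real, Complex.norm_real, Real.norm_eq_abs, Real.norm_eq_abs,
          Real.norm_eq_abs, abs_of_pos (inv_pos.2 hx), abs_of_nonneg (step_nonneg _ _)]
        exact add_le_add (mul_le_of_le_one_left (norm_nonneg _) (step_le_one _ _))
          (mul_le_mul_of_nonneg_right (hK _ _ (by positivity) hx) (norm_nonneg _))
      have e2 := pow_le_pow_left₀ (norm_nonneg _) e1 2
      nlinarith [sq_nonneg (‖deriv w.toFun x‖ - K * ‖((x⁻¹ : ℝ) : ℂ) * w.toFun x‖)])
    (fun x hx => by
      filter_upwards [hpt x hx] with n hn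
      simp [hn.1, hn.2])
  have h2 := hconv (fun n x => -(step (n + 1) x : ℂ) * ((√(q x) : ℂ) * w.toFun x))
    (fun x => ‖(√(q x) : ℂ) * w.toFun x‖ ^ 2)
    (fun n => HDot.potL q (u n - w)) (fun n => by
      rw [map_sub]
      filter_upwards [Lp.coeFn_sub (HDot.potL q (u n)) (HDot.potL q w),
        HDot.coeFn_potL w, HDot.coeFn_potL_cutoff (q' := q) (hd n)
        (continuous_stepDeriv _).neg (hs1 n) K (hKn n) (fun _ _ _ => rfl) w] with x h1 h2 h3
      rw [h1, Pi.sub_apply, h2, hu, h3]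
      push_cast
      ring)
    (integrableOn_norm_sq w.memLp_sqrt_mul)
    (fun n => Eventually.of_forall fun x => by
      rw [norm_mul, mul_pow, norm_neg, Complex.norm_real, Real.norm_eq_abs,
        abs_of_nonneg (step_nonneg _ _)]
      exact mul_le_of_le_one_left (by positivity) (pow_le_one₀ (step_nonneg _ _) (step_le_one _ _)))
    (fun x hx => by
      filter_upwards [hpt x hx] with n hn
      simp [hn.1])
  have h3 := (Real.continuous_sqrt.tendsto _).comp (h1.add h2)
  refine Tendsto.congr (fun n => ?_) (by simpa [Function.comp_def] using h3)
  rw [← map_sub, ← map_sub, ← HDot.norm_sq_eq, Real.sqrt_sq (norm_nonneg _)]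

end IsAdmissible

/-! ### Weak solutions satisfy the differential equation -/

lemma ae_halfLine_of_forall_Ioc {P : ℝ → Prop}
    (h : ∀ a b, 0 < a → a < 1 → 2 < b → ∀ᵐ x ∂volume.restrict (Ioc a b), P x) :
    ∀ᵐ x ∂halfLine, P x := by
  rw [ae_restrict_iff' measurableSet_Ioi]
  have h1 : ∀ᵐ x, ∀ n : ℕ, x ∈ Ioc ((1 : ℝ) / (n + 2)) ((n : ℝ) + 3) → P x := by
    refine ae_all_iff.2 fun n => (ae_restrict_iff' measurableSet_Ioc).1
      (h _ _ (by positivity) ?_ (by linarith [(Nat.cast_nonneg n : (0 : ℝ) ≤ n)]))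
    rw [div_lt_one (by positivity)]
    linarith [(Nat.cast_nonneg n : (0 : ℝ) ≤ n)]
  filter_upwards [h1] with x hx hx0
  have hx0 : 0 < x := hx0
  obtain ⟨n, hn⟩ := exists_nat_gt (max x x⁻¹)
  refine hx n ⟨?_, ?_⟩
  · have : x⁻¹ < n + 2 := by linarith [le_max_right x x⁻¹]
    rw [one_div]
    exact inv_lt_of_inv_lt₀ hx0 this
  · linarith [le_max_left x x⁻¹]

lemma IsPrimitive.of_intervalIntegrable {z : ℝ → ℂ}
    (hz : ∀ a b, 0 < a → a ≤ b → IntervalIntegrable z volume a b) (c : ℂ) :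
    IsPrimitive (fun x => c + ∫ y in (1 : ℝ)..x, z y) z := by
  have hz' : ∀ a b, 0 < a → 0 < b → IntervalIntegrable z volume a b := fun a b ha hb => by
    rcases le_total a b with h | h
    · exact hz a b ha h
    · exact (hz b a hb h).symm
  refine ⟨hz, fun a b ha hab => ?_⟩
  have hb := ha.trans_le hab
  rw [add_sub_add_left_eq_sub, intervalIntegral.integral_interval_sub_left (hz' 1 b one_pos hb)
    (hz' 1 a one_pos ha)]

/-- The du Bois-Reymond lemma: if `f - Z` annihilates all functions of mean zero on an interval, it
is constant there. -/
lemma ae_eq_const_of_annihilates {F : ℝ → ℂ} {a b : ℝ} (hab : a < b)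
    (hF : MemLp F 2 (volume.restrict (Ioc a b)))
    (h : ∀ k : ℝ → ℂ, MemLp k 2 (volume.restrict (Ioc a b)) → ∫ x in a..b, k x = 0 →
      ∫ x in a..b, starRingEnd ℂ (F x) * k x = 0) :
    ∃ c : ℂ, ∀ᵐ x ∂volume.restrict (Ioc a b), F x = c := by
  have hFi : IntervalIntegrable F volume a b := by
    rw [intervalIntegrable_iff_integrableOn_Ioc_of_le hab.le]
    exact hF.integrable (by norm_num)
  -- The constant is the mean of F, and the test function is F - c itself; the annihilation property
  -- then says ∫ |F - c|² = 0.
  set c : ℂ := (b - a : ℝ)⁻¹ • ∫ x in a..b, F x with hc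
  have hba : 0 < b - a := sub_pos.2 hab
  have hk : MemLp (fun x => F x - c) 2 (volume.restrict (Ioc a b)) := hF.sub (memLp_const c)
  have hki : IntervalIntegrable (fun x => F x - c) volume a b := hFi.sub intervalIntegrable_const
  have hk0 : ∫ x in a..b, (F x - c) = 0 := by
    rw [intervalIntegral.integral_sub hFi intervalIntegrable_const, intervalIntegral.integral_const, hc,
      smul_smul, mul_inv_cancel₀ hba.ne', one_smul, sub_self]
  have h1 := h _ hk hk0
  have hmul : IntervalIntegrable (fun x => starRingEnd ℂ (F x) * (F x - c)) volume a b := by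
    rw [intervalIntegrable_iff_integrableOn_Ioc_of_le hab.le]
    exact (hF.star).integrable_mul hk
  have h2 : ∫ x in a..b, ((‖F x - c‖ ^ 2 : ℝ) : ℂ) = 0 := by
    have e : ∀ x, ((‖F x - c‖ ^ 2 : ℝ) : ℂ) =
        starRingEnd ℂ (F x) * (F x - c) - starRingEnd ℂ c * (F x - c) := fun x => by
      rw [← sub_mul, ← map_sub, mul_comm, Complex.mul_conj, Complex.normSq_eq_norm_sq]
    simp only [e]
    rw [intervalIntegral.integral_sub hmul (hki.const_mul _),
      intervalIntegral.integral_const_mul, h1, hk0, mul_zero, sub_zero]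
  rw [intervalIntegral.integral_ofReal, Complex.ofReal_eq_zero,
    intervalIntegral.integral_of_le hab.le, integral_eq_zero_iff_of_nonneg_ae
    (Eventually.of_forall fun x => by positivity)
    ((memLp_two_iff_integrable_sq_norm hk.1).1 hk)] at h2
  refine ⟨c, ?_⟩
  filter_upwards [h2] with x hx
  have hx : ‖F x - c‖ ^ 2 = 0 := hx
  rw [sq_eq_zero_iff, norm_eq_zero, sub_eq_zero] at hx
  exact hx

namespace IsAdmissible

variable {q : ℝ → ℝ} (hq : IsAdmissible q)

include hq

/-- The solution `w` in the form domain of `-w'' + q w + w = g`. -/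
noncomputable def lift : HL2 →L[ℂ] HDot (formPotential q) := ContinuousLinearMap.adjoint hq.embL

/-- The weak form of -w'' + q w + w = g is the defining property of the adjoint, so existence and
uniqueness of weak solutions are the Riesz representation theorem. -/
lemma inner_lift (g : HL2) (h : HDot (formPotential q)) :
    inner ℂ (hq.lift g) h = inner ℂ g (hq.embL h) := ContinuousLinearMap.adjoint_inner_left _ _ _

/-- The bounded operator `(1 + A)⁻¹`. -/
noncomputable def resolvent : HL2 →L[ℂ] HL2 := hq.embL ∘L hq.lift

lemma continuousOn_formPotential : ContinuousOn (formPotential q) (Ioi 0) :=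
  hq.continuousOn.add continuousOn_const

lemma formPotential_pos {x : ℝ} (hx : 0 < x) : 0 < formPotential q x := by
  have := hq.pos x hx
  rw [formPotential]
  positivity

/-- The primitive of a function of mean zero on (a, b] vanishes outside that interval, so it belongs
to the form domain whatever q does at zero. -/
lemma exists_test {a b : ℝ} (ha : 0 < a) (hab : a < b) {k : ℝ → ℂ}
    (hk : MemLp k 2 (volume.restrict (Ioc a b))) (hk0 : ∫ x in a..b, k x = 0) :
    ∃ h : HDot (formPotential q), IsPrimitive h.toFun ((Ioc a b).indicator k) ∧
      (∀ x, x ≤ a → h.toFun x = 0) ∧ (∀ x, b ≤ x → h.toFun x = 0) ∧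
      deriv h.toFun =ᵐ[halfLine] (Ioc a b).indicator k := by
  have hsub : Ioc a b ⊆ Ioi 0 := fun x hx => ha.trans hx.1
  set K := (Ioc a b).indicator k with hK
  have hKm : MemLp K 2 halfLine := by
    rw [hK, memLp_indicator_iff_restrict measurableSet_Ioc, Measure.restrict_restrict measurableSet_Ioc,
      inter_eq_left.2 hsub]
    exact hk
  have hKi : ∀ s t, 0 ≤ s → s ≤ t → IntervalIntegrable K volume s t := fun s t hs hst =>
    hKm.intervalIntegrable_halfLine hs hst
  have hz1 : ∀ s t, s ≤ t → t ≤ a → ∫ x in s..t, K x = 0 := by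
    intro s t hst hta
    rw [intervalIntegral.integral_of_le hst]
    refine setIntegral_eq_zero_of_forall_eq_zero fun x hx => ?_
    exact indicator_of_notMem (fun h => absurd h.1 (not_lt.2 (hx.2.trans hta))) _
  have hz2 : ∀ s t, s ≤ t → b ≤ s → ∫ x in s..t, K x = 0 := by
    intro s t hst hbs
    rw [intervalIntegral.integral_of_le hst]
    refine setIntegral_eq_zero_of_forall_eq_zero fun x hx => ?_
    exact indicator_of_notMem (fun h => absurd h.2 (not_le.2 (hbs.trans_lt hx.1))) _
  have hab0 : ∫ x in a..b, K x = 0 := by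
    rw [← hk0, intervalIntegral.integral_of_le hab.le, intervalIntegral.integral_of_le hab.le]
    exact setIntegral_congr_fun measurableSet_Ioc fun x hx => indicator_of_mem hx _
  have hfa : ∀ x, 0 ≤ x → x ≤ a → ∫ y in (0 : ℝ)..x, K y = 0 := fun x hx hxa => hz1 0 x hx hxa
  have hfb : ∀ x, b ≤ x → ∫ y in (0 : ℝ)..x, K y = 0 := by
    intro x hx
    have hb : 0 ≤ b := ha.le.trans hab.le
    rw [← intervalIntegral.integral_add_adjacent_intervals (hKi 0 b le_rfl hb) (hKi b x hb hx),
      ← intervalIntegral.integral_add_adjacent_intervals (hKi 0 a le_rfl ha.le)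
        (hKi a b ha.le hab.le), hz1 0 a ha.le le_rfl, hab0, hz2 b x hx le_rfl]
    simp
  have hp := isPrimitive_integral hKm
  have hmem : MemLp (fun x => (√(formPotential q x) : ℂ) * ∫ y in (0 : ℝ)..x, K y) 2 halfLine := by
    have hcont : ContinuousOn (fun x => (√(formPotential q x) : ℂ) * ∫ y in (0 : ℝ)..x, K y) (Ioi 0) :=
      (Complex.continuous_ofReal.comp_continuousOn
        (Real.continuous_sqrt.comp_continuousOn hq.continuousOn_formPotential)).mul hp.continuousOn
    have hIcc : Icc a b ⊆ Ioi 0 := fun x hx => ha.trans_le hx.1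
    obtain ⟨M, hM⟩ := isCompact_Icc.exists_bound_of_continuousOn (hcont.mono hIcc)
    have : MemLp ((Icc a b).indicator fun x => (√(formPotential q x) : ℂ) * ∫ y in (0 : ℝ)..x, K y) 2
        halfLine := by
      rw [memLp_indicator_iff_restrict measurableSet_Icc, Measure.restrict_restrict measurableSet_Icc,
        inter_eq_left.2 hIcc]
      refine MemLp.of_bound ((hcont.mono hIcc).aestronglyMeasurable measurableSet_Icc) M ?_
      filter_upwards [ae_restrict_mem measurableSet_Icc] with x hx using hM x hx
    refine this.ae_eq ?_
    filter_upwards [ae_restrict_mem measurableSet_Ioi] with x hx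
    have hx : 0 < x := hx
    by_cases h : x ∈ Icc a b
    · rw [indicator_of_mem h]
    · rw [indicator_of_notMem h]
      rw [mem_Icc, not_and_or, not_le, not_le] at h
      rcases h with h | h
      · rw [hfa x hx.le h.le, mul_zero]
      · rw [hfb x h.le, mul_zero]
  have h0 : Tendsto (fun x => ∫ y in (0 : ℝ)..x, K y) (𝓝[>] 0) (𝓝 0) := by
    refine tendsto_const_nhds.congr' ?_
    filter_upwards [Ioo_mem_nhdsGT ha] with x hx
    exact (hfa x hx.1.le hx.2.le).symm
  refine ⟨HDot.ofPrimitive _ _ hp h0 hKm hmem, hp.congr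
    (fun x hx => HDot.toFun_ofPrimitive _ _ _ _ hx) (Eventually.of_forall fun _ => rfl),
    fun x hx => ?_, fun x hx => ?_, HDot.deriv_eq_of_isPrimitive _ hp
    fun x hx => HDot.toFun_ofPrimitive _ _ _ _ hx⟩
  · rcases le_or_gt x 0 with h | h
    · exact HDot.toFun_of_nonpos _ h
    · rw [HDot.toFun_ofPrimitive _ _ _ _ h, hfa x h.le hx]
  · rw [HDot.toFun_ofPrimitive _ _ _ _ (ha.trans (hab.trans_le hx)), hfb x hx]

/-- The second derivative of `lift g`. -/
noncomputable def liftSecond (g : HL2) (x : ℝ) : ℂ :=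
  (formPotential q x : ℂ) * (hq.lift g).toFun x - g x

lemma intervalIntegrable_liftSecond (g : HL2) (a b : ℝ) (ha : 0 < a) (hab : a ≤ b) :
    IntervalIntegrable (hq.liftSecond g) volume a b := by
  refine IntervalIntegrable.sub ?_ ((Lp.memLp g).intervalIntegrable_halfLine ha.le hab)
  refine ContinuousOn.intervalIntegrable ?_
  rw [uIcc_of_le hab]
  exact ((Complex.continuous_ofReal.comp_continuousOn hq.continuousOn_formPotential).mul
    (hq.lift g).continuousOn).mono fun x hx => ha.trans_le hx.1

lemma inner_lift_eq_integral (g : HL2) (h : HDot (formPotential q)) :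
    ∫ x in Ioi 0, (starRingEnd ℂ (deriv (hq.lift g).toFun x) * deriv h.toFun x +
      starRingEnd ℂ (hq.liftSecond g x) * h.toFun x) = 0 := by
  have h1 := hq.inner_lift g h
  rw [HDot.inner_eq, L2.inner_def, L2.inner_def, L2.inner_def,
    ← integral_add (L2.integrable_inner _ _) (L2.integrable_inner _ _), ← sub_eq_zero,
    ← integral_sub ((L2.integrable_inner _ _).add (L2.integrable_inner _ _))
    (L2.integrable_inner _ _)] at h1
  rw [← h1]
  refine integral_congr_ae ?_
  filter_upwards [HDot.coeFn_derivL (hq.lift g), HDot.coeFn_derivL h, HDot.coeFn_potL (hq.lift g),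
    HDot.coeFn_potL h, hq.coeFn_embL h, ae_restrict_mem measurableSet_Ioi] with x e1 e2 e3 e4 e5 hx
  have e6 : ((√(formPotential q x) : ℝ) : ℂ) * ((√(formPotential q x) : ℝ) : ℂ) =
      (formPotential q x : ℂ) := by
    rw [← Complex.ofReal_mul, Real.mul_self_sqrt (hq.formPotential_pos hx).le]
  rw [e1, e2, e3, e4, e5, liftSecond]
  simp only [RCLike.inner_apply, map_mul, map_sub, Complex.conj_ofReal]
  linear_combination (-h.toFun x * starRingEnd ℂ ((hq.lift g).toFun x)) * e6

/-- On each compact interval, testing the weak equation with the primitive of k and integrating by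
parts shows that w' - Z annihilates all k of mean zero, where Z is a primitive of the expected
second derivative. By the du Bois-Reymond lemma w' - Z is constant. -/
lemma exists_ae_deriv_lift (g : HL2) : ∃ c : ℂ, deriv (hq.lift g).toFun =ᵐ[halfLine]
    fun x => c + ∫ y in (1 : ℝ)..x, hq.liftSecond g y := by
  set Z : ℝ → ℂ := fun x => 0 + ∫ y in (1 : ℝ)..x, hq.liftSecond g y with hZ
  have hZp : IsPrimitive Z (hq.liftSecond g) :=
    IsPrimitive.of_intervalIntegrable (hq.intervalIntegrable_liftSecond g) 0
  have key : ∀ a b, 0 < a → a < b → ∃ c : ℂ, ∀ᵐ x ∂volume.restrict (Ioc a b),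
      deriv (hq.lift g).toFun x - Z x = c := by
    intro a b ha hab
    have hsub : Ioc a b ⊆ Ioi 0 := fun x hx => ha.trans hx.1
    have hZm : MemLp Z 2 (volume.restrict (Ioc a b)) := by
      have hIcc : Icc a b ⊆ Ioi 0 := fun x hx => ha.trans_le hx.1
      obtain ⟨M, hM⟩ := isCompact_Icc.exists_bound_of_continuousOn (hZp.continuousOn.mono hIcc)
      refine MemLp.of_bound ((hZp.continuousOn.mono hsub).aestronglyMeasurable measurableSet_Ioc) M ?_
      filter_upwards [ae_restrict_mem measurableSet_Ioc] with x hx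
        using hM x (Ioc_subset_Icc_self hx)
    have hdm : MemLp (deriv (hq.lift g).toFun) 2 (volume.restrict (Ioc a b)) :=
      (hq.lift g).memLp_deriv.mono_measure (Measure.restrict_mono hsub le_rfl)
    refine ae_eq_const_of_annihilates hab (hdm.sub hZm) fun k hk hk0 => ?_
    obtain ⟨h, hp, hleft, hright, hderiv⟩ := hq.exists_test ha hab hk hk0
    have h1 := hq.inner_lift_eq_integral g h
    have h2 : ∫ x in a..b, (starRingEnd ℂ (deriv (hq.lift g).toFun x) * k x +
        starRingEnd ℂ (hq.liftSecond g x) * h.toFun x) = 0 := by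
      rw [← h1, intervalIntegral.integral_of_le hab.le,
        ← integral_indicator measurableSet_Ioc, ← integral_indicator measurableSet_Ioi]
      refine integral_congr_ae ?_
      filter_upwards [(ae_restrict_iff' measurableSet_Ioi).1 hderiv] with x hx
      by_cases hx0 : x ∈ Ioi (0 : ℝ)
      · rw [indicator_of_mem hx0, hx hx0]
        by_cases hxab : x ∈ Ioc a b
        · rw [indicator_of_mem hxab, indicator_of_mem hxab]
        · rw [indicator_of_notMem hxab, indicator_of_notMem hxab, mul_zero, zero_add]
          rw [mem_Ioc, not_and_or, not_lt, not_le] at hxab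
          rcases hxab with hxab | hxab
          · rw [hleft x hxab, mul_zero]
          · rw [hright x hxab.le, mul_zero]
      · rw [indicator_of_notMem hx0, indicator_of_notMem fun hh => hx0 (hsub hh)]
    -- Since h vanishes at both ends, the integral of (Z̄ h)' is zero; subtracting it from the weak
    -- equation removes the term with h and leaves only the one with k.
    have h3 := (hZp.conj.mul hp).sub_eq a b ha hab.le
    rw [hleft a le_rfl, hright b le_rfl, mul_zero, mul_zero, sub_zero] at h3
    have hi1 : IntervalIntegrable (fun x => starRingEnd ℂ (deriv (hq.lift g).toFun x) * k x +
        starRingEnd ℂ (hq.liftSecond g x) * h.toFun x) volume a b := by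
      refine IntervalIntegrable.add ?_ ?_
      · rw [intervalIntegrable_iff_integrableOn_Ioc_of_le hab.le]
        exact hdm.star.integrable_mul hk
      · refine IntervalIntegrable.mul_continuousOn ?_ (h.continuousOn.mono ?_)
        · exact (hZp.conj.intervalIntegrable a b ha hab.le)
        · rw [uIcc_of_le hab.le]
          exact fun x hx => ha.trans_le hx.1
    have hi2 := (hZp.conj.mul hp).intervalIntegrable a b ha hab.le
    have h4 := intervalIntegral.integral_sub hi1 hi2
    rw [h2, ← h3, sub_zero] at h4
    rw [← h4, intervalIntegral.integral_of_le hab.le, intervalIntegral.integral_of_le hab.le]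
    refine setIntegral_congr_fun measurableSet_Ioc fun x hx => ?_
    simp only [indicator_of_mem hx, map_sub]
    ring
  obtain ⟨c, hc⟩ := key 1 2 one_pos one_lt_two
  refine ⟨c, ae_halfLine_of_forall_Ioc fun a b ha ha1 hb => ?_⟩
  obtain ⟨d, hd⟩ := key a b ha (by linarith)
  -- The constants for different intervals agree because all of the intervals contain (1, 2].
  have hdc : d = c := by
    have h1 := ae_mono (Measure.restrict_mono
      (fun x hx => ⟨ha1.trans hx.1, hx.2.trans hb.le⟩ : Ioc (1 : ℝ) 2 ⊆ Ioc a b) le_rfl) hd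
    have hne : NeBot (ae (volume.restrict (Ioc (1 : ℝ) 2))) := by
      rw [ae_neBot, Ne, Measure.restrict_eq_zero, Real.volume_Ioc]
      norm_num
    obtain ⟨x, hx1, hx2⟩ := (Filter.Eventually.and h1 hc).exists
    rw [← hx1, hx2]
  filter_upwards [hd] with x hx
  rw [← hdc, ← hx, hZ]
  ring

end IsAdmissible

/-! ### Decay at zero of solutions of the resolvent equation -/

lemma conj_mul_self_re (z : ℂ) : (starRingEnd ℂ z * z).re = ‖z‖ ^ 2 := by
  rw [mul_comm, Complex.mul_conj, Complex.ofReal_re, Complex.normSq_eq_norm_sq]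

lemma abs_re_conj_mul_le (z w : ℂ) : |(starRingEnd ℂ z * w).re| ≤ ‖z‖ * ‖w‖ := by
  refine (Complex.abs_re_le_norm _).trans ?_
  rw [norm_mul, RCLike.norm_conj]

lemma hasDerivAt_norm_sq {u : ℝ → ℂ} {v : ℂ} {x : ℝ} (h : HasDerivAt u v x) :
    HasDerivAt (fun x => ‖u x‖ ^ 2) (2 * (starRingEnd ℂ (u x) * v).re) x := by
  refine h.norm_sq.congr_deriv ?_
  simp [Complex.inner]
  ring

/-- Otherwise 1/y ≤ ‖v y‖/δ near zero, which is impossible because v is integrable there and 1/y is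
not. -/
lemma frequently_mul_norm_lt {v : ℝ → ℂ} (hv : MemLp v 2 halfLine) {δ : ℝ} (hδ : 0 < δ) :
    ∃ᶠ y in 𝓝[>] (0 : ℝ), y * ‖v y‖ < δ := by
  intro h
  obtain ⟨y₀, hy₀, hy⟩ := mem_nhdsGT_iff_exists_Ioo_subset.1 h
  have hy₀ : 0 < y₀ := hy₀
  have h1 : IntervalIntegrable (fun y => ‖v y‖) volume 0 (y₀ / 2) :=
    (hv.intervalIntegrable_halfLine le_rfl (by positivity)).norm
  have h2 : IntervalIntegrable (fun y : ℝ => y⁻¹) volume 0 (y₀ / 2) := by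
    refine IntervalIntegrable.mono_fun (h1.const_mul δ⁻¹) (by fun_prop) ?_
    rw [uIoc_of_le (by positivity)]
    filter_upwards [ae_restrict_mem measurableSet_Ioc] with y hym
    have hy1 : ¬ (y * ‖v y‖ < δ) := hy ⟨hym.1, by linarith [hym.2]⟩
    have hypos : 0 < y := hym.1
    rw [Real.norm_of_nonneg (by positivity), Real.norm_of_nonneg (by positivity),
      inv_le_iff_one_le_mul₀ hypos, mul_assoc, ← div_eq_inv_mul, one_le_div hδ, mul_comm]
    exact not_lt.1 hy1
  rw [intervalIntegrable_inv_iff] at h2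
  rcases h2 with h2 | h2
  · linarith
  · exact h2 left_mem_uIcc

/-- Kato's inequality and a comparison argument: decay at zero of solutions of `u'' = p u - g` with
`p ≥ a (a - 1) x⁻²`. -/
lemma exists_norm_le_rpow {u v z g : ℝ → ℂ} {p : ℝ → ℝ} {a : ℝ} (ha1 : 1 ≤ a) (ha2 : a < 3 / 2)
    (hu : ∀ x, 0 < x → HasDerivAt u (v x) x) (hv : IsPrimitive v z)
    (hz : ∀ᵐ x ∂halfLine, z x = (p x : ℂ) * u x - g x)
    (hp : ∀ x, 0 < x → x ≤ 1 → a * (a - 1) * (x ^ 2)⁻¹ ≤ p x) (hg : MemLp g 2 halfLine)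
    (hu0 : Tendsto u (𝓝[>] 0) (𝓝 0)) (hv2 : MemLp v 2 halfLine) :
    ∃ C, 0 ≤ C ∧ ∀ x, 0 < x → x ≤ 1 → ‖u x‖ ≤ C * x ^ a := by
  set G := ‖hg.toLp g‖ with hG
  have hG0 : 0 ≤ G := norm_nonneg _
  have ha3 : 0 < 3 / 2 - a := by linarith
  have hC0 : 0 ≤ ‖u 1‖ + G / (3 / 2 - a) := by positivity
  refine ⟨‖u 1‖ + G / (3 / 2 - a), hC0, fun x₀ hx₀ hx₁ => ?_⟩
  refine le_of_forall_pos_le_add fun ε hε => ?_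
  -- |u| need not be differentiable where u vanishes, so it is replaced by W = √(|u|² + ε²); W - ε
  -- lies between 0 and |u|.
  set W : ℝ → ℝ := fun x => √(‖u x‖ ^ 2 + ε ^ 2) with hW
  have hWpos : ∀ x, 0 < W x := fun x => Real.sqrt_pos.2 (by positivity)
  have hWsq : ∀ x, W x ^ 2 = ‖u x‖ ^ 2 + ε ^ 2 := fun x => Real.sq_sqrt (by positivity)
  have huW : ∀ x, ‖u x‖ ≤ W x := fun x => Real.le_sqrt_of_sq_le (by nlinarith)
  have hεW : ∀ x, ε ≤ W x := fun x => Real.le_sqrt_of_sq_le (by nlinarith [norm_nonneg (u x)])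
  have hWu : ∀ x, W x - ε ≤ ‖u x‖ := fun x => by
    have : W x ≤ ‖u x‖ + ε := by
      refine Real.sqrt_le_iff.2 ⟨by positivity, ?_⟩
      nlinarith [norm_nonneg (u x)]
    linarith
  set P : ℝ → ℝ := fun x => (starRingEnd ℂ (u x) * v x).re with hP
  have hWd : ∀ x, 0 < x → HasDerivAt W (P x * (W x)⁻¹) x := by
    intro x hx
    refine (((hasDerivAt_norm_sq (hu x hx)).add_const (ε ^ 2)).sqrt (by positivity)).congr_deriv ?_
    rw [div_eq_mul_inv, mul_inv, hP, hW]
    ring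
  have hup : IsPrimitive u v := IsPrimitive.of_hasDerivAt hu hv.continuousOn
  have hPp := hup.re_conj_mul hv
  have hWc : ContinuousOn W (Ioi 0) := fun x hx => (hWd x hx).continuousAt.continuousWithinAt
  have hWinv : IsPrimitive (fun x => (W x)⁻¹) (fun x => -(P x * (W x)⁻¹) / W x ^ 2) := by
    refine IsPrimitive.of_hasDerivAt (fun x hx => (hWd x hx).inv (hWpos x).ne') ?_
    exact ((hPp.continuousOn.mul (hWc.inv₀ fun x _ => (hWpos x).ne')).neg).div (hWc.pow 2)
      fun x _ => pow_ne_zero 2 (hWpos x).ne'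
  have hW1 := hPp.real_mul hWinv
  have hpow : ∀ b : ℝ, IsPrimitive (fun x : ℝ => x ^ b) (fun x => b * x ^ (b - 1)) := fun b => by
    refine IsPrimitive.of_hasDerivAt (fun x hx => Real.hasDerivAt_rpow_const (Or.inl hx.ne')) ?_
    exact continuousOn_const.mul (continuousOn_id.rpow_const fun x hx => Or.inl (ne_of_gt hx))
  have hWp : IsPrimitive (fun x => W x - ε) (fun x => P x * (W x)⁻¹) :=
    IsPrimitive.of_hasDerivAt (fun x hx => (hWd x hx).sub_const ε)
      (hPp.continuousOn.mul (hWc.inv₀ fun x _ => (hWpos x).ne'))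
  have hZ := ((hpow a).real_mul hW1).sub (((hpow (a - 1)).real_mul hWp).clm (a • ContinuousLinearMap.id ℝ ℝ))
  -- The Wronskian of W - ε with x^a, which solves the comparison equation y'' = a (a - 1) x⁻² y.
  set Z : ℝ → ℝ := fun x => x ^ a * (P x * (W x)⁻¹) - a * (x ^ (a - 1) * (W x - ε)) with hZdef
  have hP1 : ∀ x, |P x| ≤ ‖u x‖ * ‖v x‖ := fun x => abs_re_conj_mul_le _ _
  have hP2 : ∀ x, |P x * (W x)⁻¹| ≤ ‖v x‖ := fun x => by
    rw [abs_mul, abs_inv, abs_of_pos (hWpos x), ← div_eq_mul_inv, div_le_iff₀ (hWpos x), mul_comm ‖v x‖]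
    exact (hP1 x).trans (mul_le_mul_of_nonneg_right (huW x) (norm_nonneg _))
  -- Kato's inequality: |Re(ū u')| ≤ W |u'| gives W'' ≥ a (a - 1) x⁻² (W - ε) - |g|, and therefore
  -- Z' ≥ -x^a |g|.
  have hZ'le : ∀ᵐ x ∂halfLine, x ≤ 1 → -(x ^ a * ‖g x‖) ≤
      a * x ^ (a - 1) * (P x * (W x)⁻¹) + x ^ a * (((starRingEnd ℂ (v x) * v x).re +
        (starRingEnd ℂ (u x) * z x).re) * (W x)⁻¹ + P x * (-(P x * (W x)⁻¹) / W x ^ 2)) -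
      a * ((a - 1) * x ^ (a - 1 - 1) * (W x - ε) + x ^ (a - 1) * (P x * (W x)⁻¹)) := by
    filter_upwards [hz, ae_restrict_mem measurableSet_Ioi] with x hzx hx hx1
    have hx : 0 < x := hx
    have hpx := hp x hx hx1
    set b := a * (a - 1) * (x ^ 2)⁻¹ with hb
    have hb0 : 0 ≤ b := by
      have : 0 ≤ a - 1 := by linarith
      positivity
    have hWx := hWpos x
    have e1 : (starRingEnd ℂ (u x) * z x).re = p x * ‖u x‖ ^ 2 - (starRingEnd ℂ (u x) * g x).re := by
      rw [hzx, ← conj_mul_self_re, mul_sub, Complex.sub_re, mul_left_comm, Complex.re_ofReal_mul]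
    have e2 := (abs_le.1 (abs_re_conj_mul_le (u x) (g x))).2
    have e3 : P x ^ 2 ≤ W x ^ 2 * ‖v x‖ ^ 2 := by
      rw [← sq_abs, ← mul_pow]
      exact pow_le_pow_left₀ (abs_nonneg _)
        ((hP1 x).trans (mul_le_mul_of_nonneg_right (huW x) (norm_nonneg _))) 2
    have e4 : b * (W x - ε) - ‖g x‖ ≤ ((starRingEnd ℂ (v x) * v x).re +
        (starRingEnd ℂ (u x) * z x).re) * (W x)⁻¹ + P x * (-(P x * (W x)⁻¹) / W x ^ 2) := by
      have : ((starRingEnd ℂ (v x) * v x).re +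
        (starRingEnd ℂ (u x) * z x).re) * (W x)⁻¹ + P x * (-(P x * (W x)⁻¹) / W x ^ 2) =
        (‖v x‖ ^ 2 + (p x * ‖u x‖ ^ 2 - (starRingEnd ℂ (u x) * g x).re) - P x ^ 2 / W x ^ 2) / W x := by
        rw [e1, conj_mul_self_re]
        field_simp
        ring
      rw [this, le_div_iff₀ hWx]
      have e5 : P x ^ 2 / W x ^ 2 ≤ ‖v x‖ ^ 2 := by
        rw [div_le_iff₀ (by positivity), mul_comm]
        exact e3
      have e6 : ‖u x‖ * ‖g x‖ ≤ W x * ‖g x‖ := mul_le_mul_of_nonneg_right (huW x) (norm_nonneg _)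
      have e7 : b * ‖u x‖ ^ 2 ≤ p x * ‖u x‖ ^ 2 := mul_le_mul_of_nonneg_right hpx (by positivity)
      have e8 : b * (W x ^ 2 - ε * W x) ≤ b * ‖u x‖ ^ 2 :=
        mul_le_mul_of_nonneg_left (by nlinarith [hWsq x, hεW x]) hb0
      nlinarith
    have e9 := mul_le_mul_of_nonneg_left e4 (Real.rpow_nonneg hx.le a)
    have e10 : x ^ (a - 1 - 1) = x ^ a * (x ^ 2)⁻¹ := by
      rw [sub_sub, one_add_one_eq_two, Real.rpow_sub hx, Real.rpow_two, div_eq_mul_inv]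
    rw [e10]
    rw [hb] at e9
    linear_combination e9
  -- Near zero x^a ≤ x, so the first term of Z is at most y |v y|, which is small along a sequence;
  -- the second tends to zero with u.
  have hfreq : ∀ δ : ℝ, 0 < δ → ∃ᶠ y in 𝓝[>] (0 : ℝ), -δ ≤ Z y := by
    intro δ hδ
    have h1 : ∀ᶠ y in 𝓝[>] (0 : ℝ), a * ‖u y‖ < δ / 2 := by
      have := hu0.norm.const_mul a
      rw [norm_zero, mul_zero] at this
      exact this.eventually (gt_mem_nhds (by positivity))
    refine ((frequently_mul_norm_lt hv2 (half_pos hδ)).and_eventually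
      (h1.and (Ioo_mem_nhdsGT one_pos))).mono fun y hy => ?_
    obtain ⟨hy1, hy2, hy3⟩ := hy
    have hy0 : 0 < y := hy3.1
    have e1 : y ^ a ≤ y := by
      simpa using Real.rpow_le_rpow_of_exponent_ge hy0 hy3.2.le ha1
    have e2 : y ^ (a - 1) ≤ 1 := Real.rpow_le_one hy0.le hy3.2.le (by linarith)
    have e3 : |y ^ a * (P y * (W y)⁻¹)| ≤ y * ‖v y‖ := by
      rw [abs_mul, abs_of_nonneg (Real.rpow_nonneg hy0.le a)]
      exact mul_le_mul e1 (hP2 y) (abs_nonneg _) hy0.le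
    have e4 : y ^ (a - 1) * (W y - ε) ≤ 1 * ‖u y‖ :=
      mul_le_mul e2 (hWu y) (by linarith [hεW y]) zero_le_one
    have e5 := (abs_le.1 e3).1
    have e6 := mul_le_mul_of_nonneg_left e4 (by linarith : 0 ≤ a)
    simp only [hZdef]
    linarith
  -- Integrate Z' from a point y of that sequence up to x, and bound ∫ |g| by x^(1/2) G with
  -- Cauchy–Schwarz.
  have hZlow : ∀ x, 0 < x → x ≤ 1 → -(x ^ a * (x ^ (1 / 2 : ℝ) * G)) ≤ Z x := by
    intro x hx hx1
    refine le_of_forall_pos_le_add fun δ hδ => ?_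
    obtain ⟨y, hy1, hy2⟩ := ((hfreq δ hδ).and_eventually (Ioo_mem_nhdsGT hx)).exists
    have hy0 : 0 < y := hy2.1
    have hyx : y ≤ x := hy2.2.le
    have e1 := hZ.sub_eq y x hy0 hyx
    have hgi : IntervalIntegrable (fun s => ‖g s‖) volume y x :=
      (hg.intervalIntegrable_halfLine hy0.le hyx).norm
    have e2 : ∫ s in y..x, -(x ^ a * ‖g s‖) ≤ Z x - Z y := by
      refine le_trans ?_ (le_of_eq e1.symm)
      rw [intervalIntegral.integral_of_le hyx, intervalIntegral.integral_of_le hyx]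
      have hs : Ioc y x ⊆ Ioi 0 := fun s hs => hy0.trans hs.1
      have hi := hZ.intervalIntegrable y x hy0 hyx
      have hgi' := ((hgi.const_mul (x ^ a)).neg)
      rw [intervalIntegrable_iff_integrableOn_Ioc_of_le hyx] at hi hgi'
      refine integral_mono_ae hgi' hi ?_
      filter_upwards [ae_mono (Measure.restrict_mono hs le_rfl) hZ'le,
        ae_restrict_mem measurableSet_Ioc] with s hs1 hs2
      refine le_trans ?_ (hs1 (hs2.2.trans hx1))
      rw [neg_le_neg_iff]
      exact mul_le_mul_of_nonneg_right (Real.rpow_le_rpow (hy0.trans hs2.1).le hs2.2 (by linarith))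
        (norm_nonneg _)
    rw [intervalIntegral.integral_neg, intervalIntegral.integral_const_mul] at e2
    have e3 : ∫ s in y..x, ‖g s‖ ≤ x ^ (1 / 2 : ℝ) * G := by
      have h1 := sq_integral_norm_le_mul_norm_sq hg hy0.le hyx
      rw [← Real.sqrt_eq_rpow]
      refine abs_le_of_sq_le_sq' ?_ (by positivity) |>.2
      rw [mul_pow, Real.sq_sqrt hx.le]
      refine h1.trans (mul_le_mul_of_nonneg_right (by linarith) (by positivity))
    have e4 := mul_le_mul_of_nonneg_left e3 (Real.rpow_nonneg hx.le a)
    linarith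
  -- The derivative of x^(-a) (W - ε) is x^(-2a) Z ≥ -G x^(1/2 - a). The added term has derivative G
  -- x^(1/2 - a), and a < 3/2 keeps it nonnegative and finite. So Φ is increasing and Φ x₀ ≤ Φ 1 is
  -- the claim up to ε.
  set Φ : ℝ → ℝ := fun x => x ^ (-a) * (W x - ε) + G / (3 / 2 - a) * x ^ (3 / 2 - a) with hΦ
  have hΦd : ∀ x, 0 < x → HasDerivAt Φ (-a * x ^ (-a - 1) * (W x - ε) + x ^ (-a) * (P x * (W x)⁻¹) +
      G / (3 / 2 - a) * ((3 / 2 - a) * x ^ (3 / 2 - a - 1))) x := fun x hx =>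
    ((Real.hasDerivAt_rpow_const (Or.inl hx.ne')).mul ((hWd x hx).sub_const ε)).add
      ((Real.hasDerivAt_rpow_const (Or.inl hx.ne')).const_mul _)
  have hmono : MonotoneOn Φ (Icc x₀ 1) := by
    have hpos : ∀ x ∈ Icc x₀ 1, 0 < x := fun x hx => hx₀.trans_le hx.1
    refine monotoneOn_of_deriv_nonneg (convex_Icc _ _)
      (fun x hx => (hΦd x (hpos x hx)).continuousAt.continuousWithinAt)
      (fun x hx => (hΦd x (hpos x (interior_subset hx))).differentiableAt.differentiableWithinAt)
      fun x hx => ?_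
    have hx' := interior_subset hx
    have hx0 := hpos x hx'
    rw [(hΦd x hx0).deriv]
    have h1 := mul_le_mul_of_nonneg_left (hZlow x hx0 hx'.2) (Real.rpow_nonneg hx0.le (-(2 * a)))
    have r1 : x ^ (-a) = x ^ (-(2 * a)) * x ^ a := by
      rw [← Real.rpow_add hx0]; congr 1; ring
    have r2 : x ^ (-a - 1) = x ^ (-(2 * a)) * x ^ (a - 1) := by
      rw [← Real.rpow_add hx0]; congr 1; ring
    have r3 : x ^ (3 / 2 - a - 1) = x ^ (-(2 * a)) * (x ^ a * x ^ (1 / 2 : ℝ)) := by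
      rw [← Real.rpow_add hx0, ← Real.rpow_add hx0]; congr 1; ring
    have r4 : G / (3 / 2 - a) * ((3 / 2 - a) * x ^ (3 / 2 - a - 1)) = G * x ^ (3 / 2 - a - 1) := by
      rw [← mul_assoc, div_mul_cancel₀ _ ha3.ne']
    rw [r4, r1, r2, r3]
    simp only [hZdef] at h1
    linear_combination h1
  have hfin := hmono ⟨le_rfl, hx₁⟩ ⟨hx₁, le_rfl⟩ hx₁
  simp only [hΦ, Real.one_rpow, one_mul, mul_one] at hfin
  have hx0a : 0 < x₀ ^ a := Real.rpow_pos_of_pos hx₀ a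
  have h1 : x₀ ^ (-a) * (W x₀ - ε) ≤ ‖u 1‖ + G / (3 / 2 - a) := by
    have : 0 ≤ G / (3 / 2 - a) * x₀ ^ (3 / 2 - a) := by positivity
    linarith [hWu 1]
  rw [Real.rpow_neg hx₀.le, inv_mul_le_iff₀ hx0a] at h1
  linarith [huW x₀]


lemma memLp_rpow_Ioo {s : ℝ} {p : ENNReal} (hp : 1 ≤ p) (hp' : p ≠ ⊤) (hs : -1 < s * p.toReal) :
    MemLp (fun x : ℝ => x ^ s) p (volume.restrict (Ioo 0 1)) := by
  have hmeas : AEStronglyMeasurable (fun x : ℝ => x ^ s) (volume.restrict (Ioo 0 1)) :=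
    (continuousOn_id.rpow_const fun x hx => Or.inl (ne_of_gt hx.1)).aestronglyMeasurable
      measurableSet_Ioo
  rw [← integrable_norm_rpow_iff hmeas (by positivity) hp']
  have h1 := intervalIntegral.intervalIntegrable_rpow' (a := 0) (b := 1) hs
  rw [intervalIntegrable_iff_integrableOn_Ioo_of_le zero_le_one] at h1
  refine h1.congr ?_
  filter_upwards [ae_restrict_mem measurableSet_Ioo] with x hx
  rw [Real.norm_of_nonneg (Real.rpow_nonneg hx.1.le _), ← Real.rpow_mul hx.1.le]

lemma memLp_Ioo_of_le {z g : ℝ → ℂ} (hz : AEStronglyMeasurable z halfLine) (hg : MemLp g 2 halfLine)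
    {K s : ℝ} {p : ENNReal} (hp : 1 ≤ p) (hp2 : p ≤ 2) (hs : -1 < s * p.toReal)
    (hle : ∀ᵐ x ∂halfLine, x ≤ 1 → ‖z x‖ ≤ K * x ^ s + ‖g x‖) :
    MemLp z p (volume.restrict (Ioo 0 1)) := by
  have hsub : Ioo (0 : ℝ) 1 ⊆ Ioi 0 := Ioo_subset_Ioi_self
  have hmono : volume.restrict (Ioo (0 : ℝ) 1) ≤ halfLine := Measure.restrict_mono hsub le_rfl
  have h1 := (memLp_rpow_Ioo hp (ne_top_of_le_ne_top (by norm_num) hp2) hs).const_mul K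
  have h2 : MemLp (fun x => ‖g x‖) p (volume.restrict (Ioo 0 1)) :=
    ((hg.mono_measure hmono).mono_exponent hp2).norm
  refine (h1.add h2).mono' (hz.mono_measure hmono) ?_
  filter_upwards [ae_mono hmono hle, ae_restrict_mem measurableSet_Ioo] with x hx hx1
    using hx hx1.2.le

lemma tendsto_nhdsGT_of_intervalIntegrable {v z : ℝ → ℂ} (h : IsPrimitive v z)
    (hz : IntervalIntegrable z volume 0 1) :
    Tendsto v (𝓝[>] 0) (𝓝 (v 1 - ∫ x in (0 : ℝ)..1, z x)) := by
  have h1 := intervalIntegral.continuousOn_primitive_interval' hz left_mem_uIcc 0 left_mem_uIcc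
  rw [ContinuousWithinAt, intervalIntegral.integral_same, uIcc_of_le zero_le_one,
    nhdsWithin_Icc_eq_nhdsGE zero_lt_one] at h1
  have h2 := (h1.mono_left (nhdsWithin_mono _ Ioi_subset_Ici_self)).const_add
    (v 1 - ∫ x in (0 : ℝ)..1, z x)
  rw [add_zero] at h2
  refine h2.congr' ?_
  filter_upwards [Ioo_mem_nhdsGT (zero_lt_one' ℝ)] with x hx
  have hx1 : x ∈ uIcc (0 : ℝ) 1 := by
    rw [uIcc_of_le zero_le_one]
    exact ⟨hx.1.le, hx.2.le⟩
  have e1 := intervalIntegral.integral_add_adjacent_intervals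
    (hz.mono_set (uIcc_subset_uIcc left_mem_uIcc hx1))
    (hz.mono_set (uIcc_subset_uIcc hx1 right_mem_uIcc))
  rw [h.eq_add hx.1 one_pos, ← e1]
  ring

/-- A limit of the derivative at the endpoint is the one-sided derivative there, while the
difference quotients at 0 are at most C x^(a - 1) with a > 1. -/
lemma eq_zero_of_tendsto_deriv {u v : ℝ → ℂ} (hu : ∀ x, 0 < x → HasDerivAt u (v x) x) (hu0 : u 0 = 0)
    {L : ℂ} (hv : Tendsto v (𝓝[>] 0) (𝓝 L)) {C a : ℝ} (ha : 1 < a)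
    (hle : ∀ x, 0 < x → x ≤ 1 → ‖u x‖ ≤ C * x ^ a) (hut : Tendsto u (𝓝[>] 0) (𝓝 0)) : L = 0 := by
  have h1 : HasDerivWithinAt u L (Ici 0) 0 := by
    refine hasDerivWithinAt_Ici_of_tendsto_deriv (s := Ioi 0)
      (fun x hx => (hu x hx).differentiableAt.differentiableWithinAt) ?_ self_mem_nhdsWithin ?_
    · rw [ContinuousWithinAt, hu0]
      exact hut
    · refine hv.congr' ?_
      filter_upwards [self_mem_nhdsWithin] with x hx using (hu x hx).deriv.symm
  have h2 := (hasDerivWithinAt_iff_tendsto_slope' (by simp)).1 h1.Ioi_of_Ici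
  have h3 : Tendsto (fun x : ℝ => C * x ^ (a - 1)) (𝓝[>] 0) (𝓝 0) := by
    have := (Real.continuousAt_rpow_const (0 : ℝ) (a - 1) (Or.inr (by linarith))).tendsto
    rw [Real.zero_rpow (by linarith)] at this
    simpa using (this.mono_left nhdsWithin_le_nhds).const_mul C
  refine tendsto_nhds_unique h2 (squeeze_zero_norm' ?_ h3)
  filter_upwards [Ioo_mem_nhdsGT (zero_lt_one' ℝ)] with x hx
  rw [slope_def_module, hu0, sub_zero, sub_zero, norm_smul, norm_inv, Real.norm_of_nonneg hx.1.le,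
    inv_mul_le_iff₀ hx.1]
  refine (hle x hx.1 hx.2.le).trans (le_of_eq ?_)
  rw [Real.rpow_sub hx.1, Real.rpow_one]
  have := hx.1.ne'
  field_simp

namespace IsAdmissible

section

variable {q : ℝ → ℝ} (hq : IsAdmissible q)

include hq

/-- The second order equation satisfied by `lift g`. -/
lemma exists_deriv_lift (g : HL2) : ∃ v : ℝ → ℂ,
    (∀ x, 0 < x → HasDerivAt (hq.lift g).toFun (v x) x) ∧ IsPrimitive v (hq.liftSecond g) ∧
    deriv (hq.lift g).toFun =ᵐ[halfLine] v ∧ MemLp v 2 halfLine := by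
  obtain ⟨c, hc⟩ := hq.exists_ae_deriv_lift g
  have hv := IsPrimitive.of_intervalIntegrable (hq.intervalIntegrable_liftSecond g) c
  refine ⟨_, fun x hx => ?_, hv, hc, (hq.lift g).memLp_deriv.ae_eq hc⟩
  have hp := (hq.lift g).isPrimitive.congr (fun _ _ => rfl) (hc.mono fun _ h => h.symm)
  have hi : IntervalIntegrable (fun x => c + ∫ y in (1 : ℝ)..x, hq.liftSecond g y) volume 1 x :=
    hp.intervalIntegrable' one_pos hx
  have h1 := intervalIntegral.integral_hasDerivAt_right hi
    (hv.continuousOn.stronglyMeasurableAtFilter isOpen_Ioi x hx)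
    (hv.continuousOn.continuousAt (Ioi_mem_nhds hx))
  refine (h1.const_add ((hq.lift g).toFun 1)).congr_of_eventuallyEq ?_
  filter_upwards [Ioi_mem_nhds hx] with y hy using hp.eq_add one_pos hy

lemma aestronglyMeasurable_liftSecond (g : HL2) : AEStronglyMeasurable (hq.liftSecond g) halfLine :=
  ((Complex.continuous_ofReal.comp_aestronglyMeasurable
    (hq.continuousOn_formPotential.aestronglyMeasurable measurableSet_Ioi)).mul
    ((hq.lift g).continuousOn.aestronglyMeasurable measurableSet_Ioi)).sub (Lp.memLp g).1

lemma norm_liftSecond_le (g : HL2) {C K s a : ℝ}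
    (hC : ∀ x, 0 < x → x ≤ 1 → ‖(hq.lift g).toFun x‖ ≤ C * x ^ a)
    (hK : ∀ x, 0 < x → x ≤ 1 → formPotential q x ≤ K * x ^ (s - a)) {x : ℝ} (hx : 0 < x) (hx1 : x ≤ 1) :
    ‖hq.liftSecond g x‖ ≤ K * C * x ^ s + ‖g x‖ := by
  have hpos := hq.formPotential_pos hx
  refine (norm_sub_le _ _).trans (add_le_add_left ?_ _)
  rw [norm_mul, Complex.norm_real, Real.norm_of_nonneg hpos.le]
  refine (mul_le_mul (hK x hx hx1) (hC x hx hx1) (norm_nonneg _) (hpos.le.trans (hK x hx hx1))).trans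
    (le_of_eq ?_)
  rw [show s = (s - a) + a by ring, Real.rpow_add hx]
  ring_nf

lemma memLp_two_liftSecond (g : HL2) : MemLp (hq.liftSecond g) 2 (volume.restrict (Ioi 1)) := by
  have hsub : Ioi (1 : ℝ) ⊆ Ioi 0 := Ioi_subset_Ioi zero_le_one
  have hmono : volume.restrict (Ioi (1 : ℝ)) ≤ halfLine := Measure.restrict_mono hsub le_rfl
  refine MemLp.sub ?_ ((Lp.memLp g).mono_measure hmono)
  refine ((hq.memLp_toFun (hq.lift g)).mono_measure hmono).of_le_mul (c := formPotential q 1) ?_ ?_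
  · exact ((Complex.continuous_ofReal.comp_continuousOn hq.continuousOn_formPotential).mul
      (hq.lift g).continuousOn).mono hsub |>.aestronglyMeasurable measurableSet_Ioi
  · filter_upwards [ae_restrict_mem measurableSet_Ioi] with x hx
    have hx0 : (0 : ℝ) < x := hsub hx
    rw [norm_mul, Complex.norm_real, Real.norm_of_nonneg (hq.formPotential_pos hx0).le]
    refine mul_le_mul_of_nonneg_right ?_ (norm_nonneg _)
    have := hq.antitoneOn (show (0 : ℝ) < 1 from one_pos) hx0 (le_of_lt hx)
    simp only [formPotential]
    linarith

end

section

variable {lam : ℝ} {q₀ : ℝ → ℝ} (hq : IsAdmissible (potential lam q₀))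

/-- The equation u'' = (q + 1) u - g converts decay of u into integrability of u''. For λ ≥ 3/4 one
has a (a - 1) ≤ 3/4 ≤ λ for 1 ≤ a < 3/2, hence u'' = O(x^(a - 2)) plus an L² function; for λ = 0 the
exponent a = 1 and the growth condition give O(x^(1 - κ)) instead. -/
lemma domainConditions_lift (hlam : lam = 0 ∨ 3 / 4 ≤ lam) (hr : IsRepulsive q₀) (hg : GrowthAtZero q₀)
    (g : HL2) : ∃ v, DomainConditions lam (hq.lift g).toFun v (hq.liftSecond g) := by
  obtain ⟨v, hu, hv, hae, hv2⟩ := hq.exists_deriv_lift g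
  have hgm := Lp.memLp g
  have hmeas := hq.aestronglyMeasurable_liftSecond g
  have hu0 := (hq.lift g).tendsto_toFun_zero
  have hbound : ∀ a : ℝ, 1 ≤ a → a < 3 / 2 → (∀ x, 0 < x → x ≤ 1 →
      a * (a - 1) * (x ^ 2)⁻¹ ≤ formPotential (potential lam q₀) x) →
      ∃ C, 0 ≤ C ∧ ∀ x, 0 < x → x ≤ 1 → ‖(hq.lift g).toFun x‖ ≤ C * x ^ a :=
    fun a ha1 ha2 hp => exists_norm_le_rpow ha1 ha2 hu hv (Eventually.of_forall fun _ => rfl) hp hgm hu0 hv2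
  have hbound' : 3 / 4 ≤ lam → ∀ a : ℝ, 1 ≤ a → a < 3 / 2 →
      ∃ C, 0 ≤ C ∧ ∀ x, 0 < x → x ≤ 1 → ‖(hq.lift g).toFun x‖ ≤ C * x ^ a := by
    intro hl a ha1 ha2
    refine hbound a ha1 ha2 fun x hx _ => ?_
    have h1 := hr.pos x hx
    have h2 : a * (a - 1) ≤ lam := by nlinarith
    have h3 : 0 < (x ^ 2)⁻¹ := by positivity
    rw [formPotential, potential, div_eq_mul_inv]
    nlinarith
  have hmem : 3 / 4 ≤ lam → ∀ p : ENNReal, 1 ≤ p → p < 2 →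
      MemLp (hq.liftSecond g) p (volume.restrict (Ioo 0 1)) := by
    intro hl p hp1 hp2
    have hptop : p ≠ ⊤ := ne_top_of_lt hp2
    set r := p.toReal with hr'
    have hr1 : 1 ≤ r := by
      rw [hr', ← ENNReal.toReal_one]
      exact ENNReal.toReal_mono hptop hp1
    have hr2 : r < 2 := by
      rw [hr', ← ENNReal.toReal_ofNat]
      exact ENNReal.toReal_strict_mono (by norm_num) hp2
    have hri : 1 / 2 < r⁻¹ := by
      rw [one_div]
      exact inv_strictAnti₀ (by linarith) hr2
    have hri1 : r⁻¹ ≤ 1 := inv_le_one_of_one_le₀ hr1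
    -- x^(a - 2) lies in L^r near zero as soon as a > 2 - 1/r. The exponent chosen is the midpoint
    -- of 2 - 1/r and 3/2, and r < 2 makes that interval nonempty.
    obtain ⟨C, hC0, hC⟩ := hbound' hl ((7 / 2 - r⁻¹) / 2) (by linarith) (by linarith)
    obtain ⟨D, hD0, hD⟩ := hq.bound
    refine memLp_Ioo_of_le (K := (2 * D + 1) * C) (s := (7 / 2 - r⁻¹) / 2 - 2) hmeas hgm hp1 hp2.le
      ?_ ?_
    · have : r⁻¹ * r = 1 := inv_mul_cancel₀ (by linarith)
      rw [← hr']
      linarith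
    · filter_upwards [ae_restrict_mem measurableSet_Ioi] with x hx hx1
      refine hq.norm_liftSecond_le g hC (fun y hy hy1 => ?_) hx hx1
      have h1 : (1 : ℝ) ≤ (y ^ 2)⁻¹ := (one_le_inv₀ (by positivity)).2 (pow_le_one₀ hy.le hy1)
      have h2 := hD y hy
      rw [sub_right_comm, sub_self, zero_sub, Real.rpow_neg hy.le, Real.rpow_two, formPotential]
      nlinarith
  have hlam' : lam ≠ 0 → 3 / 4 ≤ lam := fun h => hlam.resolve_left h
  have hone : MemLp (hq.liftSecond g) 1 (volume.restrict (Ioo 0 1)) := by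
    rcases hlam with hl | hl
    · obtain ⟨κ, D, hκ, hκ2, hD0, hD⟩ := GrowthAtZero.exists_bound hr hg
      -- For a = 1 the comparison potential vanishes, so nonnegativity of the potential suffices;
      -- x^(1 - κ) is integrable because κ < 2.
      obtain ⟨C, hC0, hC⟩ := hbound 1 le_rfl (by norm_num) fun x hx _ => by
        rw [sub_self, mul_zero, zero_mul]
        exact (hq.formPotential_pos hx).le
      refine memLp_Ioo_of_le (K := (D + 1) * C) (s := 1 - κ) hmeas hgm le_rfl (by norm_num) ?_ ?_
      · rw [ENNReal.toReal_one]
        linarith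
      · filter_upwards [ae_restrict_mem measurableSet_Ioi] with x hx hx1
        refine hq.norm_liftSecond_le g hC (fun y hy hy1 => ?_) hx hx1
        have h1 := hD y hy hy1
        have h2 : 1 ≤ y ^ (-κ) := Real.one_le_rpow_of_pos_of_le_one_of_nonpos hy hy1 (by linarith)
        rw [sub_right_comm, sub_self, zero_sub, formPotential, potential, hl, zero_div]
        nlinarith
    · exact hmem hl 1 le_rfl (by norm_num)
  refine ⟨v, hu, ?_, hv.sub_eq, hone, hq.memLp_two_liftSecond g, hu0, fun h => hmem (hlam' h),
    fun h => ?_⟩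
  · rw [locallyIntegrableOn_iff isOpen_Ioi.isLocallyClosed]
    intro k hk hkc
    rcases k.eq_empty_or_nonempty with rfl | hne
    · simp
    have hm := hkc.sInf_mem hne
    have hM := hkc.sSup_mem hne
    have hsub : k ⊆ Icc (sInf k) (sSup k) := fun x hx =>
      ⟨csInf_le hkc.bddBelow hx, le_csSup hkc.bddAbove hx⟩
    have hle : sInf k ≤ sSup k := (hsub hm).2
    have := hq.intervalIntegrable_liftSecond g _ _ (hk hm) hle
    rw [intervalIntegrable_iff_integrableOn_Icc_of_le hle] at this
    exact this.mono_set hsub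
  · obtain ⟨C, hC0, hC⟩ := hbound' (hlam' h) (5 / 4) (by norm_num) (by norm_num)
    have hz : IntervalIntegrable (hq.liftSecond g) volume 0 1 := by
      rw [intervalIntegrable_iff_integrableOn_Ioo_of_le zero_le_one]
      exact memLp_one_iff_integrable.1 hone
    have h1 := tendsto_nhdsGT_of_intervalIntegrable hv hz
    rwa [eq_zero_of_tendsto_deriv hu ((hq.lift g).toFun_of_nonpos le_rfl) h1 (by norm_num) hC hu0] at h1

lemma mem_operatorGraph (hlam : lam = 0 ∨ 3 / 4 ≤ lam) (hr : IsRepulsive q₀) (hg : GrowthAtZero q₀)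
    (g : HL2) : (hq.resolvent g, g - hq.resolvent g) ∈ operatorGraph lam q₀ := by
  obtain ⟨v, hv⟩ := hq.domainConditions_lift hlam hr hg g
  refine ⟨_, v, _, hv, hq.coeFn_embL _, ?_⟩
  filter_upwards [hq.coeFn_embL (hq.lift g), Lp.coeFn_sub g (hq.resolvent g)] with x h1 h2
  rw [h2, Pi.sub_apply, show hq.resolvent g x = _ from h1, liftSecond, formPotential]
  push_cast
  ring

end

end IsAdmissible

/-! ### Functions in the domain of A are weak solutions -/

lemma memLp_halfLine_of_bounded {f : ℝ → ℂ} (hf : AEStronglyMeasurable f halfLine) {M : ℝ}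
    (hM : ∀ x, 0 < x → x ≤ 1 → ‖f x‖ ≤ M) (h : MemLp f 2 (volume.restrict (Ioi 1))) :
    MemLp f 2 halfLine := by
  rw [memLp_two_iff_integrable_sq_norm hf]
  change IntegrableOn _ (Ioi (0 : ℝ)) volume
  rw [show Ioi (0 : ℝ) = Ioc 0 1 ∪ Ioi 1 from (Ioc_union_Ioi_eq_Ioi zero_le_one).symm]
  refine IntegrableOn.union ?_ ((memLp_two_iff_integrable_sq_norm h.1).1 h)
  refine Integrable.mono' (g := fun _ => M ^ 2) (by simp) ?_ ?_
  · exact (hf.mono_measure (Measure.restrict_mono Ioc_subset_Ioi_self le_rfl)).norm.pow 2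
  · filter_upwards [ae_restrict_mem measurableSet_Ioc] with x hx
    rw [Real.norm_of_nonneg (by positivity)]
    exact pow_le_pow_left₀ (norm_nonneg _) (hM x hx.1 hx.2) 2

namespace DomainConditions

variable {lam : ℝ} {u v z : ℝ → ℂ} (h : DomainConditions lam u v z)

include h

lemma isPrimitive_deriv : IsPrimitive v z where
  intervalIntegrable _ _ ha hab := h.intervalIntegrable ha hab
  sub_eq := h.sub_eq_integral

lemma isPrimitive : IsPrimitive u v := IsPrimitive.of_hasDerivAt h.hasDerivAt h.isPrimitive_deriv.continuousOn

/-- Since u'' is integrable on (0, 1), u' is bounded there, and u(0) = 0 then gives u = O(x). -/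
lemma exists_bound : ∃ M, 0 ≤ M ∧ ∀ x, 0 < x → x ≤ 1 → ‖v x‖ ≤ M ∧ ‖u x‖ ≤ M * x := by
  have hz : IntegrableOn z (Ioc 0 1) := by
    rw [integrableOn_Ioc_iff_integrableOn_Ioo]
    exact memLp_one_iff_integrable.1 h.memLp_one
  set M := ‖v 1‖ + ∫ x in Ioc (0 : ℝ) 1, ‖z x‖ with hM
  have hM0 : 0 ≤ M := add_nonneg (norm_nonneg _) (integral_nonneg fun _ => norm_nonneg _)
  have hv : ∀ x, 0 < x → x ≤ 1 → ‖v x‖ ≤ M := by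
    intro x hx hx1
    have h1 := h.sub_eq_integral x 1 hx hx1
    rw [show v x = v 1 - ∫ y in x..1, z y by rw [← h1]; ring]
    refine (norm_sub_le _ _).trans (add_le_add_right ?_ _)
    rw [intervalIntegral.integral_of_le hx1]
    refine (norm_integral_le_integral_norm _).trans ?_
    exact setIntegral_mono_set hz.norm (Eventually.of_forall fun _ => norm_nonneg _)
      (Ioc_subset_Ioc_left hx.le).eventuallyLE
  refine ⟨M, hM0, fun x hx hx1 => ⟨hv x hx hx1, ?_⟩⟩
  have h1 : ∀ᶠ y in 𝓝[>] (0 : ℝ), ‖u x‖ ≤ M * x + ‖u y‖ := by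
    filter_upwards [Ioo_mem_nhdsGT hx] with y hy
    have h2 := h.isPrimitive.sub_eq y x hy.1 hy.2.le
    have h3 : ‖∫ t in y..x, v t‖ ≤ M * |x - y| :=
      intervalIntegral.norm_integral_le_of_norm_le_const fun t ht => by
        rw [uIoc_of_le hy.2.le] at ht
        exact hv t (hy.1.trans ht.1) (ht.2.trans hx1)
    rw [show u x = (∫ t in y..x, v t) + u y by rw [← h2]; ring]
    refine (norm_add_le _ _).trans (add_le_add_left (h3.trans ?_) _)
    rw [abs_of_nonneg (by linarith [hy.2])]
    exact mul_le_mul_of_nonneg_left (by linarith [hy.1]) hM0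
  have h2 := h.tendsto_zero.norm.const_add (M * x)
  rw [norm_zero, add_zero] at h2
  exact ge_of_tendsto h2 h1

/-- Near zero v is bounded. On (1, ∞), |v|² is the derivative of F = Re(ū v) minus the integrable
function Re(ū z), so ∫ |v|² is bounded once F is bounded above along a sequence. If F ≥ 1 held
eventually, |u|² would grow linearly, contradicting u ∈ L². -/
lemma memLp_deriv (hu : MemLp u 2 halfLine) : MemLp v 2 halfLine := by
  obtain ⟨M, hM0, hM⟩ := h.exists_bound
  have hmeas : AEStronglyMeasurable v halfLine :=
    h.isPrimitive_deriv.continuousOn.aestronglyMeasurable measurableSet_Ioi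
  have hsub : Ioi (1 : ℝ) ⊆ Ioi 0 := Ioi_subset_Ioi zero_le_one
  have hmono : volume.restrict (Ioi (1 : ℝ)) ≤ halfLine := Measure.restrict_mono hsub le_rfl
  refine memLp_halfLine_of_bounded hmeas (fun x hx hx1 => (hM x hx hx1).1) ?_
  have hu1 := hu.mono_measure hmono
  rw [memLp_two_iff_integrable_sq_norm (hmeas.mono_measure hmono)]
  set F : ℝ → ℝ := fun x => (starRingEnd ℂ (u x) * v x).re with hF
  have hFp : IsPrimitive F fun x => ‖v x‖ ^ 2 + (starRingEnd ℂ (u x) * z x).re :=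
    (h.isPrimitive.re_conj_mul h.isPrimitive_deriv).congr (fun _ _ => rfl)
      (Eventually.of_forall fun x => by rw [conj_mul_self_re])
  have huz : IntegrableOn (fun x => ‖u x‖ * ‖z x‖) (Ioi 1) := hu1.norm.integrable_mul h.memLp_two.norm
  have hfreq : ∃ᶠ x in atTop, F x < 1 := by
    intro hcon
    obtain ⟨N, hN⟩ := eventually_atTop.1 hcon
    have hu2 : IntegrableOn (fun x => ‖u x‖ ^ 2) (Ioi 1) :=
      (memLp_two_iff_integrable_sq_norm hu1.1).1 hu1
    refine frequently_norm_lt_of_integrableOn hu2 one_pos ?_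
    filter_upwards [eventually_ge_atTop (max N 1 + 1)] with x hx
    have hN1 : (1 : ℝ) ≤ max N 1 := le_max_right _ _
    have h1 : ∀ y ∈ Icc (max N 1) x, HasDerivAt (fun x => ‖u x‖ ^ 2) (2 * F y) y := fun y hy =>
      hasDerivAt_norm_sq (h.hasDerivAt y (by linarith [hy.1]))
    obtain ⟨y, hy, hy'⟩ := exists_hasDerivAt_eq_slope (fun x => ‖u x‖ ^ 2) (fun y => 2 * F y)
      (show max N 1 < x by linarith)
      (fun y hy => (h1 y hy).continuousAt.continuousWithinAt)
      (fun y hy => h1 y (Ioo_subset_Icc_self hy))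
    have h2 : 1 ≤ F y := not_lt.1 (hN y ((le_max_left _ _).trans hy.1.le))
    rw [eq_div_iff (by linarith)] at hy'
    rw [not_lt, Real.norm_of_nonneg (by positivity)]
    nlinarith [sq_nonneg ‖u (max N 1)‖]
  -- The filter of points tending to infinity along which F < 1; bounding the integral up to such
  -- points is enough for integrability.
  set l : Filter ℝ := atTop ⊓ 𝓟 {x | F x < 1}
  have : l.NeBot := inf_principal_neBot_iff.2 fun s hs => hfreq.and_eventually hs |>.exists.imp
    fun x hx => ⟨hx.2, hx.1⟩
  refine integrableOn_Ioi_of_intervalIntegral_norm_bounded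
    (1 - F 1 + ∫ x in Ioi 1, ‖u x‖ * ‖z x‖) 1 (l := l) (b := id) (fun b => ?_)
    (tendsto_id.mono_left inf_le_left) ?_
  · rcases le_or_gt b 1 with hb | hb
    · simp [Ioc_eq_empty (not_lt.2 hb)]
    · refine (ContinuousOn.integrableOn_Icc ?_).mono_set Ioc_subset_Icc_self
      exact (h.isPrimitive_deriv.continuousOn.mono fun x hx => lt_of_lt_of_le one_pos hx.1).norm.pow 2
  · filter_upwards [mem_inf_of_left (eventually_ge_atTop (1 : ℝ)), mem_inf_of_right (mem_principal_self _)]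
      with b hb hb1
    have hb1 : F b < 1 := hb1
    have e1 := hFp.sub_eq 1 b one_pos hb
    have i1 : IntervalIntegrable (fun x => ‖v x‖ ^ 2) volume 1 b := by
      refine ContinuousOn.intervalIntegrable ?_
      rw [uIcc_of_le hb]
      exact (h.isPrimitive_deriv.continuousOn.mono fun x hx => lt_of_lt_of_le one_pos hx.1).norm.pow 2
    have i2 : IntervalIntegrable (fun x => ‖u x‖ * ‖z x‖) volume 1 b := by
      rw [intervalIntegrable_iff_integrableOn_Ioc_of_le hb]
      exact huz.mono_set Ioc_subset_Ioi_self
    have e2 : ∫ x in (1 : ℝ)..b, (‖v x‖ ^ 2 - ‖u x‖ * ‖z x‖) ≤ F b - F 1 := by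
      rw [e1]
      refine intervalIntegral.integral_mono_on hb (i1.sub i2)
        (hFp.intervalIntegrable 1 b one_pos hb) fun x _ => ?_
      linarith [(abs_le.1 (abs_re_conj_mul_le (u x) (z x))).1]
    rw [intervalIntegral.integral_sub i1 i2] at e2
    have e3 : ∫ x in (1 : ℝ)..b, ‖u x‖ * ‖z x‖ ≤ ∫ x in Ioi 1, ‖u x‖ * ‖z x‖ := by
      rw [intervalIntegral.integral_of_le hb]
      exact setIntegral_mono_set huz (Eventually.of_forall fun _ => by positivity)
        Ioc_subset_Ioi_self.eventuallyLE
    have e4 : ∫ x in (1 : ℝ)..b, ‖‖v x‖ ^ 2‖ = ∫ x in (1 : ℝ)..b, ‖v x‖ ^ 2 := by simp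
    rw [id, e4]
    linarith

end DomainConditions

namespace IsAdmissible

section

variable {lam : ℝ} {q₀ : ℝ → ℝ} (hq : IsAdmissible (potential lam q₀))

include hq

/-- The square root of the form potential is at most a multiple of 1 + 1/x. The singularity is
compensated by u = O(x) near zero, and for x > 1 the weight is bounded. -/
lemma memLp_sqrt_mul_of_domainConditions {u v z : ℝ → ℂ} (h : DomainConditions lam u v z)
    (hu : MemLp u 2 halfLine) :
    MemLp (fun x => (√(formPotential (potential lam q₀) x) : ℂ) * u x) 2 halfLine := by
  obtain ⟨M, hM0, hM⟩ := h.exists_bound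
  obtain ⟨D, hD0, hD⟩ := hq.bound
  have hcont : ContinuousOn (fun x => (√(formPotential (potential lam q₀) x) : ℂ) * u x) (Ioi 0) :=
    (Complex.continuous_ofReal.comp_continuousOn
      (Real.continuous_sqrt.comp_continuousOn hq.continuousOn_formPotential)).mul h.isPrimitive.continuousOn
  have hle : ∀ x, 0 < x → √(formPotential (potential lam q₀) x) ≤ √(D + 1) * (1 + x⁻¹) := by
    intro x hx
    have h1 := hD x hx
    have h2 : 0 < x⁻¹ := inv_pos.2 hx
    rw [← Real.sqrt_sq (show 0 ≤ 1 + x⁻¹ by positivity), ← Real.sqrt_mul (by linarith)]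
    refine Real.sqrt_le_sqrt ?_
    rw [formPotential]
    have h3 : (x ^ 2)⁻¹ = x⁻¹ ^ 2 := by rw [inv_pow]
    nlinarith [mul_nonneg hD0 h2.le]
  refine memLp_halfLine_of_bounded (M := √(D + 1) * (2 * M))
    (hcont.aestronglyMeasurable measurableSet_Ioi) (fun x hx hx1 => ?_) ?_
  · rw [norm_mul, Complex.norm_real, Real.norm_of_nonneg (Real.sqrt_nonneg _)]
    refine (mul_le_mul (hle x hx) (hM x hx hx1).2 (norm_nonneg _) (by positivity)).trans ?_
    rw [mul_assoc]
    refine mul_le_mul_of_nonneg_left ?_ (Real.sqrt_nonneg _)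
    have : (1 + x⁻¹) * (M * x) = M * x + M := by field_simp
    rw [this]
    nlinarith
  · have hsub : Ioi (1 : ℝ) ⊆ Ioi 0 := Ioi_subset_Ioi zero_le_one
    have hmono : volume.restrict (Ioi (1 : ℝ)) ≤ halfLine := Measure.restrict_mono hsub le_rfl
    refine (hu.mono_measure hmono).of_le_mul (c := √(D + 1) * 2)
      ((hcont.mono hsub).aestronglyMeasurable measurableSet_Ioi) ?_
    filter_upwards [ae_restrict_mem measurableSet_Ioi] with x hx
    have hx1 : (1 : ℝ) < x := hx
    rw [norm_mul, Complex.norm_real, Real.norm_of_nonneg (Real.sqrt_nonneg _)]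
    refine mul_le_mul_of_nonneg_right ((hle x (hsub hx)).trans ?_) (norm_nonneg _)
    have := inv_le_one_of_one_le₀ hx1.le
    gcongr
    linarith

/-- The graph of the operator is contained in the graph given by the resolvent. -/
lemma eq_lift_of_domainConditions {u v z : ℝ → ℂ} (h : DomainConditions lam u v z) {p₁ p₂ : HL2}
    (h1 : p₁ =ᵐ[halfLine] u)
    (h2 : p₂ =ᵐ[halfLine] fun x => -z x + (potential lam q₀ x : ℂ) * u x) :
    p₁ = hq.resolvent (p₁ + p₂) := by
  have hu : MemLp u 2 halfLine := (Lp.memLp p₁).ae_eq h1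
  have hv := h.memLp_deriv hu
  obtain ⟨M, hM0, hM⟩ := h.exists_bound
  have hsqu := hq.memLp_sqrt_mul_of_domainConditions h hu
  set w : HDot (formPotential (potential lam q₀)) :=
    HDot.ofPrimitive u v h.isPrimitive h.tendsto_zero hv hsqu with hw
  have key : w = hq.lift (p₁ + p₂) := by
    refine ext_inner_right ℂ fun k => ?_
    rw [hq.inner_lift, HDot.inner_eq, ← sub_eq_zero, hw, HDot.derivL_ofPrimitive,
      HDot.potL_ofPrimitive, L2.inner_def, L2.inner_def, L2.inner_def,
      ← integral_add (L2.integrable_inner _ _) (L2.integrable_inner _ _),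
      ← integral_sub ((L2.integrable_inner _ _).add (L2.integrable_inner _ _))
      (L2.integrable_inner _ _)]
    -- The difference between the two sides of the weak equation is the integral of (v̄ k)'. The
    -- boundary term vanishes at zero because v is bounded and k tends to 0, and at infinity because
    -- v̄ k is integrable.
    have hG := h.isPrimitive_deriv.conj.mul k.isPrimitive
    have hint := ((L2.integrable_inner (𝕜 := ℂ) (hv.toLp v) (HDot.derivL _ k)).add
      (L2.integrable_inner (𝕜 := ℂ) (hsqu.toLp _) (HDot.potL _ k))).sub
      (L2.integrable_inner (𝕜 := ℂ) (p₁ + p₂) (hq.embL k))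
    have hae : ∀ᵐ x ∂halfLine, inner ℂ (hv.toLp v x) (HDot.derivL _ k x) +
        inner ℂ (hsqu.toLp _ x) (HDot.potL _ k x) - inner ℂ ((p₁ + p₂) x) (hq.embL k x) =
        starRingEnd ℂ (z x) * k.toFun x + starRingEnd ℂ (v x) * deriv k.toFun x := by
      filter_upwards [hv.coeFn_toLp, HDot.coeFn_derivL k, hsqu.coeFn_toLp, HDot.coeFn_potL k,
        Lp.coeFn_add p₁ p₂, hq.coeFn_embL k, h1, h2, ae_restrict_mem measurableSet_Ioi]
        with x e1 e2 e3 e4 e5 e6 e7 e8 hx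
      rw [e1, e2, e3, e4, e5, e6, Pi.add_apply, e7, e8]
      simp only [RCLike.inner_apply, map_mul, map_add, map_neg, Complex.conj_ofReal]
      have h3 : ((√(formPotential (potential lam q₀) x) : ℝ) : ℂ) *
          (√(formPotential (potential lam q₀) x) : ℝ) = (potential lam q₀ x : ℂ) + 1 := by
        rw [← Complex.ofReal_mul, Real.mul_self_sqrt (hq.formPotential_pos hx).le, formPotential]
        push_cast
        rfl
      linear_combination (k.toFun x * starRingEnd ℂ (u x)) * h3
    rw [integral_congr_ae hae]
    refine hG.integral_eq_zero ?_ ?_ (hint.congr hae)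
    · refine squeeze_zero_norm' (a := fun x => M * ‖k.toFun x‖) ?_ ?_
      · filter_upwards [Ioo_mem_nhdsGT (zero_lt_one' ℝ)] with x hx
        rw [norm_mul, RCLike.norm_conj]
        exact mul_le_mul_of_nonneg_right (hM x hx.1 hx.2.le).1 (norm_nonneg _)
      · simpa using k.tendsto_toFun_zero.norm.const_mul M
    · have h3 : Integrable (fun x => starRingEnd ℂ (v x) * k.toFun x) halfLine :=
        hv.star.integrable_mul (hq.memLp_toFun k)
      exact IntegrableOn.mono_set (s := Ioi 1) h3 (Ioi_subset_Ioi zero_le_one)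
  rw [resolvent, ContinuousLinearMap.comp_apply, ← key]
  refine Lp.ext (h1.trans ?_)
  filter_upwards [hq.coeFn_embL w, ae_restrict_mem measurableSet_Ioi] with x hx hx0
  rw [hx, hw, HDot.toFun_ofPrimitive _ _ _ _ hx0]

lemma eq_resolvent_of_mem_operatorGraph {p : HL2 × HL2} (hp : p ∈ operatorGraph lam q₀) :
    p.1 = hq.resolvent (p.1 + p.2) := by
  obtain ⟨u, v, z, h, h1, h2⟩ := hp
  exact hq.eq_lift_of_domainConditions h h1 h2

end
end IsAdmissible

/-- If u = 0 almost everywhere, continuity gives u = 0, then v = 0, then z = 0 almost everywhere.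
This is what makes `operatorGraph` the graph of `halfLineOperator`. -/
lemma operatorGraph_single_valued {lam : ℝ} {q₀ : ℝ → ℝ} {p : HL2 × HL2}
    (hp : p ∈ operatorGraph lam q₀) (h0 : p.1 = 0) : p.2 = 0 := by
  obtain ⟨u, v, z, h, h1, h2⟩ := hp
  rw [h0] at h1
  have hu : ∀ᵐ x ∂halfLine, u x = 0 := by
    filter_upwards [h1, Lp.coeFn_zero ℂ 2 halfLine] with x e1 e2
    rw [← e1, e2, Pi.zero_apply]
  have hu0 : EqOn u (fun _ => 0) (Ioi 0) := Measure.eqOn_open_of_ae_eq hu isOpen_Ioi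
    h.isPrimitive.continuousOn continuousOn_const
  have hv : ∀ x, 0 < x → v x = 0 := fun x hx =>
    (h.hasDerivAt x hx).unique ((hasDerivAt_const x 0).congr_of_eventuallyEq
      (hu0.eventuallyEq_of_mem (Ioi_mem_nhds hx)))
  refine Lp.eq_zero_iff_ae_eq_zero.2 ?_
  filter_upwards [h2, hu, h.isPrimitive_deriv.ae_hasDerivAt_halfLine,
    ae_restrict_mem measurableSet_Ioi] with x e1 e2 e3 hx
  have hz : z x = 0 := e3.unique ((hasDerivAt_const x 0).congr_of_eventuallyEq
    (eventually_of_mem (Ioi_mem_nhds hx) hv))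
  rw [e1, e2, hz, mul_zero, neg_zero, add_zero, Pi.zero_apply]

/-! ### Identification of the resolvent of A -/

namespace IsAdmissible

variable {lam : ℝ} {q₀ : ℝ → ℝ} (hq : IsAdmissible (potential lam q₀))
  (hlam : lam = 0 ∨ 3 / 4 ≤ lam) (hr : IsRepulsive q₀) (hg : GrowthAtZero q₀)

include hlam hr hg

/-- If the resolvent kills g, then (0, g) lies in the graph, which is single valued. -/
lemma resolvent_injective : Function.Injective hq.resolvent := by
  refine (injective_iff_map_eq_zero _).2 fun g h0 => ?_
  have := operatorGraph_single_valued (hq.mem_operatorGraph hlam hr hg g) h0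
  rwa [h0, sub_zero] at this

lemma resolvent_mem_domain (g : HL2) : hq.resolvent g ∈ (halfLineOperator lam q₀).domain :=
  ⟨_, hq.mem_operatorGraph hlam hr hg g, rfl⟩

omit hlam hr hg in
lemma mem_operatorGraph_domain (w : (halfLineOperator lam q₀).domain) :
    ((w : HL2), halfLineOperator lam q₀ w) ∈ operatorGraph lam q₀ :=
  Submodule.mem_graph_toLinearPMap (fun _ hp h0 => operatorGraph_single_valued hp h0) w

omit hlam hr hg in
lemma coe_eq_resolvent (w : (halfLineOperator lam q₀).domain) :
    (w : HL2) = hq.resolvent (w + halfLineOperator lam q₀ w) :=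
  hq.eq_resolvent_of_mem_operatorGraph (mem_operatorGraph_domain w)

lemma add_halfLineOperator_resolvent (g : HL2) (h : hq.resolvent g ∈ (halfLineOperator lam q₀).domain) :
    hq.resolvent g + halfLineOperator lam q₀ ⟨hq.resolvent g, h⟩ = g :=
  (hq.resolvent_injective hlam hr hg (hq.coe_eq_resolvent ⟨hq.resolvent g, h⟩)).symm

/-- `shiftedInverse` is made by choice, but any operator with its defining property equals the
resolvent, since each w in the domain is the resolvent of w + A w. -/
lemma shiftedInverse_halfLineOperator : shiftedInverse (halfLineOperator lam q₀) = hq.resolvent := by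
  have hex : ∃ R : HL2 →L[ℂ] HL2, ∀ g, ∃ hg : R g ∈ (halfLineOperator lam q₀).domain,
      R g + halfLineOperator lam q₀ ⟨R g, hg⟩ = g :=
    ⟨hq.resolvent, fun g => ⟨hq.resolvent_mem_domain hlam hr hg g,
      hq.add_halfLineOperator_resolvent hlam hr hg g _⟩⟩
  rw [shiftedInverse, dif_pos hex]
  ext1 g
  obtain ⟨h, e⟩ := hex.choose_spec g
  have := hq.coe_eq_resolvent ⟨_, h⟩
  rwa [e] at this

end IsAdmissible

/-! ### A Morawetz estimate -/

/-- The weight `(1 + x)⁻¹`. -/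
noncomputable def decay (x : ℝ) : ℝ := (1 + x)⁻¹

lemma decay_pos {x : ℝ} (hx : 0 < x) : 0 < decay x := inv_pos.2 (by linarith)

lemma decay_le_one {x : ℝ} (hx : 0 < x) : decay x ≤ 1 := inv_le_one_of_one_le₀ (by linarith)

lemma decay_le_inv {x : ℝ} (hx : 0 < x) : decay x ≤ x⁻¹ := inv_anti₀ hx (by linarith)

lemma hasDerivAt_decay {x : ℝ} (hx : 0 < x) : HasDerivAt decay (-decay x ^ 2) x := by
  have := ((hasDerivAt_id x).const_add 1).inv (show 1 + id x ≠ 0 by simp only [id]; positivity)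
  refine this.congr_deriv ?_
  simp [decay, div_eq_mul_inv]

lemma continuousOn_decay : ContinuousOn decay (Ioi 0) := fun _ hx =>
  (hasDerivAt_decay hx).continuousAt.continuousWithinAt

lemma decay_pow_le_one {x : ℝ} (hx : 0 < x) (n : ℕ) : decay x ^ n ≤ 1 :=
  pow_le_one₀ (decay_pos hx).le (decay_le_one hx)

lemma decay_sq_mul_le {x : ℝ} (hx : 0 < x) : decay x ^ 2 * (1 + (x ^ 2)⁻¹) ≤ x⁻¹ ^ 2 := by
  rw [decay, inv_pow, inv_pow, inv_mul_le_iff₀ (by positivity)]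
  have : (1 + x) ^ 2 * (x ^ 2)⁻¹ = (x ^ 2)⁻¹ + 2 * x⁻¹ + 1 := by
    field_simp
    ring
  rw [this]
  have : 0 < x⁻¹ := inv_pos.2 hx
  linarith

/-- The positivity behind the Morawetz estimate, with s = (1 + x)⁻¹, y = 1/x, a = |u|, b = |u'|, P =
Re(ū u'), p = q and r = φ' = s². The term -3/2 s⁴ a² is the bad contribution -φ'''/4. The terms with
17/12 and 17/24 come from subtracting the derivative of 17/24 s² y |u|², a weighted Hardy trick that
compensates it. The terms with η are small perturbations, needed later to control the velocity. -/
lemma morawetz_pointwise {s y r φ p p' η C a b P : ℝ} (hs : 0 < s) (hs1 : s ≤ 1) (hsy : s ≤ y)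
    (hφ : 0 ≤ φ) (hp' : p' ≤ 0) (hC0 : 0 ≤ C) (hC : s ^ 2 * p ≤ C * y ^ 2) (hη : 0 < η)
    (hηC : 200 * η * (1 + C) ≤ 1) (hP : |P| ≤ a * b) (hr : r = s ^ 2) :
    1 / 36 * (r * b ^ 2 + r * y ^ 2 * a ^ 2) ≤
      r * b ^ 2 - η * s ^ 4 * b ^ 2 - η * s ^ 4 * p * a ^ 2 + 4 * η * s ^ 5 * P - φ * p' / 2 * a ^ 2 -
        3 / 2 * s ^ 4 * a ^ 2 + 17 / 12 * s ^ 3 * y * a ^ 2 + 17 / 24 * r * y ^ 2 * a ^ 2 -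
        17 / 12 * r * y * P := by
  have hP1 := abs_le.1 hP
  have hy : 0 < y := hs.trans_le hsy
  have h0 : 0 ≤ -(φ * p' / 2 * a ^ 2) := by
    have := mul_nonneg (mul_nonneg hφ (neg_nonneg.2 hp')) (sq_nonneg a)
    linarith
  have h1 : η * s ^ 2 * b ^ 2 ≤ η * b ^ 2 := by
    have : s ^ 2 ≤ 1 := pow_le_one₀ hs.le hs1
    have := mul_le_mul_of_nonneg_left this (mul_nonneg hη.le (sq_nonneg b))
    linarith
  have h2 : η * (s ^ 2 * p) * a ^ 2 ≤ η * (C * y ^ 2) * a ^ 2 := by gcongr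
  have h3 : -(2 * η * (b ^ 2 + y ^ 2 * a ^ 2)) ≤ 4 * η * s ^ 3 * P := by
    have e1 : s ^ 3 * |P| ≤ y * (a * b) := by
      refine mul_le_mul ?_ hP (abs_nonneg _) hy.le
      calc s ^ 3 = s * s ^ 2 := by ring
        _ ≤ y * 1 := mul_le_mul hsy (pow_le_one₀ hs.le hs1) (by positivity) hy.le
        _ = y := mul_one y
    have e2 : 2 * (y * (a * b)) ≤ b ^ 2 + y ^ 2 * a ^ 2 := by nlinarith [sq_nonneg (b - y * a)]
    have e3 : -(s ^ 3 * |P|) ≤ s ^ 3 * P := by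
      rw [← mul_neg]
      exact mul_le_mul_of_nonneg_left (neg_abs_le P) (by positivity)
    have := mul_le_mul_of_nonneg_left (show -(b ^ 2 + y ^ 2 * a ^ 2) ≤ 2 * (s ^ 3 * P) by linarith)
      (show 0 ≤ 2 * η by positivity)
    linarith
  -- The coefficient 17/24 is chosen for this step: 17/12 + 1/12 = 3/2, so s ≤ y gives 17/12 s y +
  -- 1/12 y² ≥ 3/2 s².
  have h4 : -(1 / 12 * y ^ 2 * a ^ 2) ≤ 17 / 12 * s * y * a ^ 2 - 3 / 2 * s ^ 2 * a ^ 2 := by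
    have : 0 ≤ (17 / 12 * s * y - 3 / 2 * s ^ 2 + 1 / 12 * y ^ 2) * a ^ 2 := by
      refine mul_nonneg ?_ (sq_nonneg a)
      nlinarith [mul_nonneg hs.le (sub_nonneg.2 hsy)]
    linarith
  -- Young's inequality with weight 3/4. It leaves b²/18 and (17/24 - 17/32 - 1/12) y² a² = 3/32 y²
  -- a² to pay for the η terms and the lower bound.
  have h5 : 17 / 12 * y * P ≤ 17 / 18 * b ^ 2 + 17 / 32 * y ^ 2 * a ^ 2 := by
    have := mul_le_mul_of_nonneg_left hP1.2 hy.le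
    nlinarith [sq_nonneg (b - 3 / 4 * y * a)]
  have h6 : 200 * η ≤ 1 := by nlinarith
  have h7 : η * b ^ 2 ≤ 1 / 200 * b ^ 2 := by nlinarith [sq_nonneg b]
  have h8 : η * (1 + C) * (y ^ 2 * a ^ 2) ≤ 1 / 200 * (y ^ 2 * a ^ 2) :=
    mul_le_mul_of_nonneg_right (by linarith) (by positivity)
  have h9 : η * (y ^ 2 * a ^ 2) ≤ 1 / 200 * (y ^ 2 * a ^ 2) :=
    mul_le_mul_of_nonneg_right (by linarith) (by positivity)
  have hya : 0 ≤ y ^ 2 * a ^ 2 := by positivity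
  have key : 1 / 36 * (b ^ 2 + y ^ 2 * a ^ 2) ≤ b ^ 2 - η * s ^ 2 * b ^ 2 - η * (s ^ 2 * p) * a ^ 2 +
      4 * η * s ^ 3 * P - 3 / 2 * s ^ 2 * a ^ 2 + 17 / 12 * s * y * a ^ 2 + 17 / 24 * y ^ 2 * a ^ 2 -
      17 / 12 * y * P := by
    nlinarith [sq_nonneg b]
  have := mul_le_mul_of_nonneg_left key (sq_nonneg s)
  subst hr
  linarith

/-- Multiplication by the weight `(1 + x)⁻¹` on `L²`. -/
noncomputable def decayL : HL2 →L[ℂ] HL2 :=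
  mulL decay (continuousOn_decay.aestronglyMeasurable measurableSet_Ioi) 1 fun x hx => by
    rw [abs_of_pos (decay_pos hx)]; exact decay_le_one hx

lemma coeFn_decayL (w : HL2) : decayL w =ᵐ[halfLine] fun x => (decay x : ℂ) * w x := coeFn_mulL _ _ _ _

/-- Multiplication by the weight `1 - (1 + x)⁻¹` on `L²`. -/
noncomputable def oneSubDecayL : HL2 →L[ℂ] HL2 :=
  mulL (fun x => 1 - decay x)
    ((continuousOn_const.sub continuousOn_decay).aestronglyMeasurable measurableSet_Ioi) 1 fun x hx => by
      have h1 := decay_pos hx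
      have h2 := decay_le_one hx
      rw [abs_le]
      constructor <;> linarith

lemma coeFn_oneSubDecayL (w : HL2) :
    oneSubDecayL w =ᵐ[halfLine] fun x => ((1 - decay x : ℝ) : ℂ) * w x := coeFn_mulL _ _ _ _

/-- Multiplication by the weight `(1 + x)⁻²` on `L²`. -/
noncomputable def localVel : HL2 →L[ℂ] HL2 :=
  mulL (fun x => decay x ^ 2) ((continuousOn_decay.pow 2).aestronglyMeasurable measurableSet_Ioi) 1
    fun x hx => by
      rw [abs_of_pos (pow_pos (decay_pos hx) 2)]; exact decay_pow_le_one hx 2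

lemma coeFn_localVel (w : HL2) : localVel w =ᵐ[halfLine] fun x => ((decay x ^ 2 : ℝ) : ℂ) * w x :=
  coeFn_mulL _ _ _ _

lemma integrable_re_inner (f g : HL2) :
    IntegrableOn (fun x => (starRingEnd ℂ (f x) * g x).re) (Ioi 0) := by
  refine (L2.integrable_inner (𝕜 := ℂ) f g).re.congr (Eventually.of_forall fun x => ?_)
  simp [RCLike.inner_apply, mul_comm]

lemma re_inner_eq_integral (f g : HL2) :
    (inner ℂ f g).re = ∫ x in Ioi 0, (starRingEnd ℂ (f x) * g x).re := by
  rw [L2.inner_def]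
  refine (integral_re (L2.integrable_inner (𝕜 := ℂ) f g)).symm.trans
    (integral_congr_ae (Eventually.of_forall fun x => ?_))
  simp [RCLike.inner_apply, mul_comm]

namespace IsAdmissible

section

variable {q : ℝ → ℝ} (hq : IsAdmissible q)

/-- The operator `g ↦ (1 + A)⁻¹ g` with values in the energy space. -/
noncomputable def energyLift : HL2 →L[ℂ] HDot q := hq.toEnergy ∘L hq.lift

lemma toFun_energyLift (g : HL2) : (hq.energyLift g).toFun = (hq.lift g).toFun :=
  hq.toFun_toEnergy (hq.lift g)

lemma coeFn_resolvent (g : HL2) : hq.resolvent g =ᵐ[halfLine] (hq.energyLift g).toFun := by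
  rw [toFun_energyLift]
  exact hq.coeFn_embL _

/-- Multiplication by the weight `((1 + x) x)⁻¹` on the energy space. -/
noncomputable def localMul : HDot q →L[ℂ] HL2 :=
  HDot.mulL (fun x => decay x * x⁻¹) ((continuousOn_decay.mul
    (continuousOn_inv₀.mono fun _ hx => ne_of_gt hx)).aestronglyMeasurable measurableSet_Ioi) 1 zero_le_one
    fun x hx => by
      have h1 := hq.pos x hx
      have h2 := decay_pow_le_one hx 2
      have h3 : 0 ≤ (x ^ 2)⁻¹ := by positivity
      rw [mul_pow, inv_pow, one_mul]
      nlinarith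

lemma coeFn_localMul (w : HDot q) :
    hq.localMul w =ᵐ[halfLine] fun x => ((decay x * x⁻¹ : ℝ) : ℂ) * w.toFun x :=
  HDot.coeFn_mulL _ _ _ _ _

/-- The Morawetz multiplier `φ w' + (φ'/2 - η (1 + x)⁻⁴) w` with `φ = 1 - (1 + x)⁻¹`. -/
noncomputable def multiplier (η : ℝ) : HDot q →L[ℂ] HL2 := oneSubDecayL ∘L HDot.derivL q +
  HDot.mulL (fun x => decay x ^ 2 / 2 - η * decay x ^ 4)
    (((continuousOn_decay.pow 2).div_const 2).sub
      (continuousOn_const.mul (continuousOn_decay.pow 4)) |>.aestronglyMeasurable measurableSet_Ioi)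
    ((1 + |η|) ^ 2) (by positivity) fun x hx => by
      have h1 := hq.pos x hx
      have h2 := decay_pos hx
      have h3 := decay_le_inv hx
      have h4 := decay_le_one hx
      have h5 : |decay x ^ 2 / 2 - η * decay x ^ 4| ≤ (1 + |η|) * x⁻¹ := by
        have e1 : decay x ^ 2 ≤ x⁻¹ := by nlinarith
        have e2 : decay x ^ 4 ≤ x⁻¹ := by
          have := decay_pow_le_one hx 2
          nlinarith [pow_pos h2 2]
        refine (abs_sub _ _).trans ?_
        rw [abs_mul, abs_of_pos (pow_pos h2 4), abs_of_pos (by positivity)]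
        nlinarith [abs_nonneg η, pow_pos h2 2]
      rw [← sq_abs]
      refine (pow_le_pow_left₀ (abs_nonneg _) h5 2).trans ?_
      rw [mul_pow, inv_pow]
      exact mul_le_mul_of_nonneg_left (by linarith) (by positivity)

lemma coeFn_multiplier (η : ℝ) (w : HDot q) :
    hq.multiplier η w =ᵐ[halfLine] fun x => ((1 - decay x : ℝ) : ℂ) * deriv w.toFun x +
      ((decay x ^ 2 / 2 - η * decay x ^ 4 : ℝ) : ℂ) * w.toFun x := by
  refine (Lp.coeFn_add _ _).trans ?_
  refine EventuallyEq.add ?_ (HDot.coeFn_mulL _ _ _ _ w)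
  refine (coeFn_oneSubDecayL _).trans ?_
  filter_upwards [HDot.coeFn_derivL w] with x hx
  exact congrArg _ hx

end

section

variable {lam : ℝ} {q₀ : ℝ → ℝ} (hq : IsAdmissible (potential lam q₀))
  (hlam : lam = 0 ∨ 3 / 4 ≤ lam) (hr : IsRepulsive q₀) (hg : GrowthAtZero q₀)

include hlam hr hg

/-- Here g - (1 + A)⁻¹ g = A u with u = (1 + A)⁻¹ g. The real part of the product of the multiplier
with A u is a total derivative plus the quadratic form of `morawetz_pointwise`, and
`integral_nonneg_of_le` disposes of the total derivative. -/
lemma re_inner_multiplier_ge {C η : ℝ} (hC0 : 0 ≤ C)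
    (hC : ∀ x, 0 < x → potential lam q₀ x ≤ C * (1 + (x ^ 2)⁻¹)) (hη : 0 < η)
    (hηC : 200 * η * (1 + C) ≤ 1) (g : HL2) :
    1 / 36 * (‖decayL (HDot.derivL _ (hq.energyLift g))‖ ^ 2 + ‖hq.localMul (hq.energyLift g)‖ ^ 2) ≤
      (inner ℂ (hq.multiplier η (hq.energyLift g)) (g - hq.resolvent g)).re := by
  obtain ⟨v, hd⟩ := hq.domainConditions_lift hlam hr hg g
  set q := potential lam q₀
  set u := (hq.lift g).toFun with hu
  set z := hq.liftSecond g
  have hu2 : MemLp u 2 halfLine := hq.memLp_toFun _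
  have hv2 := hd.memLp_deriv hu2
  have hup := hd.isPrimitive
  have hvp := hd.isPrimitive_deriv
  obtain ⟨M, hM0, hM⟩ := hd.exists_bound
  have hN : IsPrimitive (fun x => ‖v x‖ ^ 2) fun x => 2 * (starRingEnd ℂ (v x) * z x).re :=
    (hvp.re_conj_mul hvp).congr (fun x _ => (conj_mul_self_re _).symm) (Eventually.of_forall fun x => by
      simp only [Complex.mul_re, Complex.conj_re, Complex.conj_im]; ring)
  have hU : IsPrimitive (fun x => ‖u x‖ ^ 2) fun x => 2 * (starRingEnd ℂ (u x) * v x).re :=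
    (hup.re_conj_mul hup).congr (fun x _ => (conj_mul_self_re _).symm) (Eventually.of_forall fun x => by
      simp only [Complex.mul_re, Complex.conj_re, Complex.conj_im]; ring)
  have hP : IsPrimitive (fun x => (starRingEnd ℂ (u x) * v x).re)
      fun x => ‖v x‖ ^ 2 + (starRingEnd ℂ (u x) * z x).re :=
    (hup.re_conj_mul hvp).congr (fun _ _ => rfl) (Eventually.of_forall fun x => by rw [conj_mul_self_re])
  have hc1 : IsPrimitive (fun x => -(1 - decay x) / 2) fun x => -decay x ^ 2 / 2 := by
    refine IsPrimitive.of_hasDerivAt (fun x hx => ?_) ((continuousOn_decay.pow 2).neg.div_const 2)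
    refine ((((hasDerivAt_decay hx).const_sub 1).neg).div_const 2).congr_deriv ?_
    ring
  have hc2 : IsPrimitive (fun x => η * decay x ^ 4 - decay x ^ 2 / 2)
      fun x => -4 * η * decay x ^ 5 + decay x ^ 3 := by
    refine IsPrimitive.of_hasDerivAt (fun x hx => ?_)
      ((continuousOn_const.mul (continuousOn_decay.pow 5)).add (continuousOn_decay.pow 3))
    refine ((((hasDerivAt_decay hx).pow 4).const_mul η).sub
      (((hasDerivAt_decay hx).pow 2).div_const 2)).congr_deriv ?_
    push_cast
    ring
  -- The coefficient of |u|² in the total derivative: φ q/2 - s³/2 comes from integrating the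
  -- multiplier by parts, and 17/24 s²/x is the Hardy correction.
  have hc3 : IsPrimitive
      (fun x => (1 - decay x) * q x / 2 - decay x ^ 3 / 2 + 17 / 24 * (decay x ^ 2 * x⁻¹))
      fun x => decay x ^ 2 * q x / 2 + (1 - decay x) * deriv q x / 2 + 3 / 2 * decay x ^ 4 -
        17 / 12 * decay x ^ 3 * x⁻¹ - 17 / 24 * decay x ^ 2 * x⁻¹ ^ 2 := by
    have hinv : ContinuousOn (fun x : ℝ => x⁻¹) (Ioi 0) := continuousOn_inv₀.mono fun _ hx => ne_of_gt hx
    have hdc := continuousOn_decay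
    have hqc := hq.continuousOn
    have hqc' := hq.continuousOn_deriv
    refine IsPrimitive.of_hasDerivAt (fun x hx => ?_) (by fun_prop)
    refine (((((hasDerivAt_decay hx).const_sub 1).mul (hq.hasDerivAt x hx)).div_const 2).sub
      (((hasDerivAt_decay hx).pow 3).div_const 2) |>.add
      ((((hasDerivAt_decay hx).pow 2).mul (hasDerivAt_inv hx.ne')).const_mul (17 / 24))).congr_deriv ?_
    simp only [Pi.pow_apply]
    push_cast
    ring
  have hf := ((hc1.real_mul hN).add (hc2.real_mul hP)).add (hc3.real_mul hU)
  set k := g - hq.resolvent g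
  set w := hq.energyLift g
  have hint := (integrable_re_inner (hq.multiplier η w) k).sub
    (((integrableOn_norm_sq (Lp.memLp (decayL (HDot.derivL _ w)))).add
      (integrableOn_norm_sq (Lp.memLp (hq.localMul w)))).const_mul (1 / 36))
  -- The lower bound is moved inside the integral, so the whole integrand is the majorant of the
  -- total derivative.
  suffices h : 0 ≤ ∫ x in Ioi 0, ((starRingEnd ℂ (hq.multiplier η w x) * k x).re -
      1 / 36 * (‖decayL (HDot.derivL _ w) x‖ ^ 2 + ‖hq.localMul w x‖ ^ 2)) by
    rw [integral_sub, integral_const_mul, integral_add, ← re_inner_eq_integral, ← norm_sq_HL2,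
      ← norm_sq_HL2] at h
    · linarith
    · exact integrableOn_norm_sq (Lp.memLp _)
    · exact integrableOn_norm_sq (Lp.memLp _)
    · exact integrable_re_inner _ _
    · exact ((integrableOn_norm_sq (Lp.memLp (decayL (HDot.derivL _ w)))).add
        (integrableOn_norm_sq (Lp.memLp (hq.localMul w)))).const_mul (1 / 36)
  have hdx : ∀ x, 0 < x → 1 - decay x ≤ x := fun x hx => by
    have h1 : decay x * (1 + x) = 1 := inv_mul_cancel₀ (by positivity)
    have h2 := decay_le_one hx
    nlinarith [decay_pos hx]
  have hcoef : ∀ x, 0 < x →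
      |(1 - decay x) * q x / 2 - decay x ^ 3 / 2 + 17 / 24 * (decay x ^ 2 * x⁻¹)| ≤
        (1 - decay x) * q x / 2 + 1 / 2 + x⁻¹ := fun x hx => by
    have h1 := decay_pow_le_one hx 3
    have h2 := decay_pow_le_one hx 2
    have h3 : 0 < x⁻¹ := inv_pos.2 hx
    have h4 := mul_nonneg (sub_nonneg.2 (decay_le_one hx)) (hq.pos x hx).le
    have h5 := pow_pos (decay_pos hx) 3
    have h6 : decay x ^ 2 * x⁻¹ ≤ x⁻¹ := by nlinarith
    have h7 : 0 ≤ decay x ^ 2 * x⁻¹ := by positivity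
    rw [abs_le]
    constructor <;> linarith
  have hcoef2 : ∀ x, 0 < x → |η * decay x ^ 4 - decay x ^ 2 / 2| ≤ 2 := fun x hx => by
    have h1 := decay_pow_le_one hx 4
    have h2 := decay_pow_le_one hx 2
    have h3 : η ≤ 1 := by nlinarith
    have h4 := pow_pos (decay_pos hx) 4
    have h5 := pow_pos (decay_pos hx) 2
    have h6 : η * decay x ^ 4 ≤ 1 := by nlinarith
    rw [abs_le]
    constructor <;> nlinarith
  refine hf.integral_nonneg_of_le ?_ ?_ hint ?_
  -- Every boundary term is O(x) at zero: φ ≤ x in the first, u = O(x) and u' = O(1) in the second,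
  -- and in the third a coefficient O(1/x) times |u|² = O(x²).
  · refine squeeze_zero_norm' (a := fun x => (M ^ 2 + 2 * M ^ 2 + (C + 2) * M ^ 2) * x) ?_ ?_
    · filter_upwards [Ioo_mem_nhdsGT (zero_lt_one' ℝ)] with x hx
      have hx0 : 0 < x := hx.1
      have hv1 := (hM x hx0 hx.2.le).1
      have hu1 := (hM x hx0 hx.2.le).2
      have hN1 : ‖v x‖ ^ 2 ≤ M ^ 2 := pow_le_pow_left₀ (norm_nonneg _) hv1 2
      have hU1 : ‖u x‖ ^ 2 ≤ M ^ 2 * x ^ 2 := by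
        rw [← mul_pow]
        exact pow_le_pow_left₀ (norm_nonneg _) hu1 2
      have hP1 : |(starRingEnd ℂ (u x) * v x).re| ≤ M ^ 2 * x := by
        refine (abs_re_conj_mul_le _ _).trans ((mul_le_mul hu1 hv1 (norm_nonneg _) (by positivity)).trans ?_)
        linarith
      have h3 : |(1 - decay x) * q x / 2 - decay x ^ 3 / 2 + 17 / 24 * (decay x ^ 2 * x⁻¹)| ≤
          (C + 2) * x⁻¹ := by
        refine (hcoef x hx0).trans ?_
        have e1 : (1 - decay x) * q x ≤ x * (C * (1 + (x ^ 2)⁻¹)) :=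
          mul_le_mul (hdx x hx0) (hC x hx0) (hq.pos x hx0).le hx0.le
        have e2 : x * (C * (1 + (x ^ 2)⁻¹)) = C * (x + x⁻¹) := by
          field_simp
        have e3 : 1 ≤ x⁻¹ := (one_le_inv₀ hx0).2 hx.2.le
        nlinarith [hx.2]
      have h1 : |-(1 - decay x) / 2| ≤ x := by
        have e1 := hdx x hx0
        have e2 := decay_le_one hx0
        rw [abs_le]
        constructor <;> linarith
      rw [Real.norm_eq_abs]
      refine (abs_add_three _ _ _).trans ?_
      rw [abs_mul, abs_mul, abs_mul, abs_of_nonneg (sq_nonneg ‖v x‖), abs_of_nonneg (sq_nonneg ‖u x‖)]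
      have a1 := mul_le_mul h1 hN1 (sq_nonneg _) hx0.le
      have a2 := mul_le_mul (hcoef2 x hx0) hP1 (abs_nonneg _) (by norm_num)
      have a3 := mul_le_mul h3 hU1 (sq_nonneg _) (by positivity)
      have a4 : (C + 2) * x⁻¹ * (M ^ 2 * x ^ 2) = (C + 2) * M ^ 2 * x := by
        field_simp
      linarith
    · have : Tendsto (fun x : ℝ => (M ^ 2 + 2 * M ^ 2 + (C + 2) * M ^ 2) * x) (𝓝 0)
          (𝓝 ((M ^ 2 + 2 * M ^ 2 + (C + 2) * M ^ 2) * 0)) := tendsto_id.const_mul _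
      rw [mul_zero] at this
      exact this.mono_left nhdsWithin_le_nhds
  -- For x > 1 all coefficients are bounded, so the total derivative is that of a function dominated
  -- by |u|² + |u'|².
  · have hsub : Ioi (1 : ℝ) ⊆ Ioi 0 := Ioi_subset_Ioi zero_le_one
    have hi : IntegrableOn (fun x => 3 * ‖v x‖ ^ 2 + (C + 4) * ‖u x‖ ^ 2) (Ioi 1) :=
      IntegrableOn.mono_set (((integrableOn_norm_sq hv2).const_mul 3).add
        ((integrableOn_norm_sq hu2).const_mul (C + 4))) hsub
    refine hi.mono' ((hf.continuousOn.mono hsub).aestronglyMeasurable measurableSet_Ioi) ?_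
    filter_upwards [ae_restrict_mem measurableSet_Ioi] with x hx
    have hx1 : 1 < x := hx
    have hx0 : 0 < x := hsub hx
    have hxi : x⁻¹ ≤ 1 := inv_le_one_of_one_le₀ hx1.le
    have hd1 := decay_pos hx0
    have hP1 : |(starRingEnd ℂ (u x) * v x).re| ≤ (‖u x‖ ^ 2 + ‖v x‖ ^ 2) / 2 := by
      refine (abs_re_conj_mul_le _ _).trans ?_
      nlinarith [sq_nonneg (‖u x‖ - ‖v x‖)]
    have h3 : |(1 - decay x) * q x / 2 - decay x ^ 3 / 2 + 17 / 24 * (decay x ^ 2 * x⁻¹)| ≤ C + 2 := by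
      refine (hcoef x hx0).trans ?_
      have e0 : (x ^ 2)⁻¹ ≤ 1 := inv_le_one_of_one_le₀ (one_le_pow₀ hx1.le)
      have e1 : (1 - decay x) * q x ≤ 1 * (C * (1 + (x ^ 2)⁻¹)) :=
        mul_le_mul (by linarith) (hC x hx0) (hq.pos x hx0).le zero_le_one
      nlinarith
    have h1 : |-(1 - decay x) / 2| ≤ 1 := by
      have e2 := decay_le_one hx0
      rw [abs_le]
      constructor <;> linarith
    rw [Real.norm_eq_abs]
    refine (abs_add_three _ _ _).trans ?_
    rw [abs_mul, abs_mul, abs_mul, abs_of_nonneg (sq_nonneg ‖v x‖), abs_of_nonneg (sq_nonneg ‖u x‖)]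
    have a1 := mul_le_mul_of_nonneg_right h1 (sq_nonneg ‖v x‖)
    have a2 := mul_le_mul (hcoef2 x hx0) hP1 (abs_nonneg _) (by norm_num)
    have a3 := mul_le_mul_of_nonneg_right h3 (sq_nonneg ‖u x‖)
    linarith [sq_nonneg ‖v x‖, sq_nonneg ‖u x‖]
  · have hwu : w.toFun = u := hq.toFun_energyLift g
    have hdv : deriv w.toFun =ᵐ[halfLine] v := by
      filter_upwards [ae_restrict_mem measurableSet_Ioi] with x hx
      rw [hwu]
      exact (hd.hasDerivAt x hx).deriv
    have hk : k =ᵐ[halfLine] fun x => -z x + (q x : ℂ) * u x := by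
      filter_upwards [hq.coeFn_resolvent g, Lp.coeFn_sub g (hq.resolvent g)] with x h1 h2
      rw [h2, Pi.sub_apply, h1, hq.toFun_energyLift]
      simp only [z, liftSecond, formPotential, u]
      push_cast
      ring
    filter_upwards [hq.coeFn_multiplier η w, coeFn_decayL (HDot.derivL _ w), hq.coeFn_localMul w, hk,
      HDot.coeFn_derivL w, hdv, ae_restrict_mem measurableSet_Ioi] with x e1 e2 e3 e4 e5 e6 hx
    have hx0 : 0 < x := hx
    rw [e1, e2, e3, e4, e5, e6, hwu, norm_mul, norm_mul, Complex.norm_real, Complex.norm_real,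
      Real.norm_of_nonneg (decay_pos hx0).le,
      Real.norm_of_nonneg (mul_pos (decay_pos hx0) (inv_pos.2 hx0)).le]
    have hq2 : decay x ^ 2 * q x ≤ C * x⁻¹ ^ 2 := by
      have h1 := mul_le_mul_of_nonneg_left (hC x hx0) (sq_nonneg (decay x))
      have h2 := mul_le_mul_of_nonneg_left (decay_sq_mul_le hx0) hC0
      linarith
    have key := morawetz_pointwise (decay_pos hx0) (decay_le_one hx0) (decay_le_inv hx0)
      (sub_nonneg.2 (decay_le_one hx0)) (hq.deriv_nonpos x hx0) hC0 hq2 hη hηC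
      (abs_re_conj_mul_le (u x) (v x)) rfl
    have hX : (starRingEnd ℂ (((1 - decay x : ℝ) : ℂ) * v x +
        ((decay x ^ 2 / 2 - η * decay x ^ 4 : ℝ) : ℂ) * u x) * (-z x + (q x : ℂ) * u x)).re =
        (1 - decay x) * (-(starRingEnd ℂ (v x) * z x).re + q x * (starRingEnd ℂ (u x) * v x).re) +
        (decay x ^ 2 / 2 - η * decay x ^ 4) *
          (-(starRingEnd ℂ (u x) * z x).re + q x * ‖u x‖ ^ 2) := by
      rw [← conj_mul_self_re]
      simp only [map_add, map_mul, Complex.conj_ofReal, Complex.mul_re, Complex.add_re, Complex.neg_re,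
        Complex.ofReal_re, Complex.ofReal_im, Complex.conj_re, Complex.conj_im, Complex.add_im,
        Complex.mul_im, Complex.neg_im]
      ring
    rw [hX]
    linarith

end

section

variable {q : ℝ → ℝ} (hq : IsAdmissible q)

/-- φ Re(ū u') + φ'/2 |u|² is the derivative of φ |u|²/2 and integrates to zero, so only the
correction with η survives. Without it the multiplier would give no control of the velocity. -/
lemma re_inner_multiplier_self_le (η : ℝ) (g : HL2) :
    (inner ℂ (hq.multiplier η (hq.energyLift g)) (hq.resolvent g)).re ≤
      -η * ‖localVel (hq.resolvent g)‖ ^ 2 := by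
  set u := (hq.lift g).toFun with hu
  set w := hq.energyLift g
  have hwu : w.toFun = u := hq.toFun_energyLift g
  have hup : IsPrimitive u (deriv u) := (hq.lift g).isPrimitive
  have hu2 : MemLp u 2 halfLine := hq.memLp_toFun _
  have hU : IsPrimitive (fun x => ‖u x‖ ^ 2) fun x => 2 * (starRingEnd ℂ (u x) * deriv u x).re :=
    (hup.re_conj_mul hup).congr (fun x _ => (conj_mul_self_re _).symm) (Eventually.of_forall fun x => by
      simp only [Complex.mul_re, Complex.conj_re, Complex.conj_im]; ring)
  have hc : IsPrimitive (fun x => -(1 - decay x) / 2) fun x => -decay x ^ 2 / 2 := by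
    refine IsPrimitive.of_hasDerivAt (fun x hx => ?_) ((continuousOn_decay.pow 2).neg.div_const 2)
    refine ((((hasDerivAt_decay hx).const_sub 1).neg).div_const 2).congr_deriv ?_
    ring
  have hf := hc.real_mul hU
  have hb : ∀ x, 0 < x → ‖-(1 - decay x) / 2 * ‖u x‖ ^ 2‖ ≤ ‖u x‖ ^ 2 := fun x hx => by
    have e1 := decay_pos hx
    have e2 := decay_le_one hx
    rw [norm_mul, Real.norm_eq_abs, Real.norm_of_nonneg (sq_nonneg _)]
    refine mul_le_of_le_one_left (sq_nonneg _) ?_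
    rw [abs_le]
    constructor <;> linarith
  have hint := ((integrable_re_inner (hq.multiplier η w) (hq.resolvent g)).add
    ((integrableOn_norm_sq (Lp.memLp (localVel (hq.resolvent g)))).const_mul η)).neg
  suffices h : 0 ≤ ∫ x in Ioi 0, -((starRingEnd ℂ (hq.multiplier η w x) * hq.resolvent g x).re +
      η * ‖localVel (hq.resolvent g) x‖ ^ 2) by
    rw [integral_neg, integral_add, integral_const_mul, ← re_inner_eq_integral, ← norm_sq_HL2] at h
    · linarith
    · exact integrable_re_inner _ _
    · exact (integrableOn_norm_sq (Lp.memLp _)).const_mul η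
  refine hf.integral_nonneg_of_le ?_ ?_ hint ?_
  · refine squeeze_zero_norm' (a := fun x => ‖u x‖ ^ 2) ?_ ?_
    · filter_upwards [self_mem_nhdsWithin] with x hx using hb x hx
    · simpa using (hq.lift g).tendsto_toFun_zero.norm.pow 2
  · have hsub : Ioi (1 : ℝ) ⊆ Ioi 0 := Ioi_subset_Ioi zero_le_one
    refine ((integrableOn_norm_sq hu2).mono_set hsub).mono'
      ((hf.continuousOn.mono hsub).aestronglyMeasurable measurableSet_Ioi) ?_
    filter_upwards [ae_restrict_mem measurableSet_Ioi] with x hx using hb x (hsub hx)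
  · filter_upwards [hq.coeFn_multiplier η w, coeFn_localVel (hq.resolvent g), hq.coeFn_resolvent g,
      ae_restrict_mem measurableSet_Ioi] with x e1 e2 e3 hx
    have hx0 : 0 < x := hx
    rw [e2, e1, e3, hwu, norm_mul, Complex.norm_real, Real.norm_of_nonneg (sq_nonneg _)]
    refine le_of_eq ?_
    rw [mul_pow, ← conj_mul_self_re]
    simp only [map_add, map_mul, Complex.conj_ofReal, Complex.mul_re, Complex.add_re,
      Complex.ofReal_re, Complex.ofReal_im, Complex.conj_re, Complex.conj_im, Complex.add_im,
      Complex.mul_im]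
    ring

end

end IsAdmissible

/-! ### The wave group of a positive operator given by its resolvent -/

/-- The frequency `√(y⁻¹ - 1)` belonging to the point `y` of the spectrum of the resolvent. -/
noncomputable def freq (y : ℝ) : ℝ := √(y⁻¹ - 1)

lemma freq_nonneg (y : ℝ) : 0 ≤ freq y := Real.sqrt_nonneg _

lemma mul_freq_sq {y : ℝ} (hy : 0 < y) (hy1 : y ≤ 1) : y * freq y ^ 2 = 1 - y := by
  rw [freq, Real.sq_sqrt (sub_nonneg.2 ((one_le_inv₀ hy).2 hy1)), mul_sub, mul_inv_cancel₀ hy.ne', mul_one]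

lemma sq_mul_freq_sq {y : ℝ} (hy : y ∈ Icc (0 : ℝ) 1) : y ^ 2 * freq y ^ 2 = y * (1 - y) := by
  rcases hy.1.eq_or_lt with rfl | h
  · simp
  · rw [← mul_freq_sq h hy.2]
    ring

lemma mul_freq_sq_le_one {y : ℝ} (hy : y ∈ Icc (0 : ℝ) 1) : y * freq y ^ 2 ≤ 1 := by
  rcases hy.1.eq_or_lt with rfl | h
  · simp
  · rw [mul_freq_sq h hy.2]
    linarith

lemma mul_freq_le_sqrt {y : ℝ} (hy : y ∈ Icc (0 : ℝ) 1) : y * freq y ≤ √y := by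
  refine Real.le_sqrt_of_sq_le ?_
  rw [mul_pow, sq_mul_freq_sq hy]
  nlinarith [hy.1]

lemma mul_freq_le_one {y : ℝ} (hy : y ∈ Icc (0 : ℝ) 1) : y * freq y ≤ 1 :=
  (mul_freq_le_sqrt hy).trans (Real.sqrt_le_one.2 hy.2)

lemma mul_freq_nonneg {y : ℝ} (hy : y ∈ Icc (0 : ℝ) 1) : 0 ≤ y * freq y := mul_nonneg hy.1 (freq_nonneg y)

lemma continuousOn_freq : ContinuousOn freq (Ioc 0 1) :=
  Real.continuous_sqrt.comp_continuousOn
    ((continuousOn_inv₀.mono fun _ hx => ne_of_gt hx.1).sub continuousOn_const)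

/-- The frequency is unbounded as y decreases to 0, while the functional calculus needs continuity
on all of [0, 1]. A bound by √y forces the value 0 at 0 and gives continuity there; it holds for y ·
`freq` y, because its square is y (1 - y). -/
lemma continuousOn_Icc_of_le_sqrt {f : ℝ → ℝ} (hf : ContinuousOn f (Ioc 0 1)) {K : ℝ}
    (hK : ∀ y ∈ Icc (0 : ℝ) 1, |f y| ≤ K * √y) : ContinuousOn f (Icc 0 1) := by
  intro y hy
  rcases hy.1.eq_or_lt with rfl | h
  · have h0 : f 0 = 0 := by simpa using hK 0 ⟨le_rfl, zero_le_one⟩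
    rw [ContinuousWithinAt, h0]
    refine squeeze_zero_norm' (a := fun y => K * √y) ?_ ?_
    · filter_upwards [self_mem_nhdsWithin] with y hy using hK y hy
    · have : Continuous fun y : ℝ => K * √y := by fun_prop
      simpa using (this.tendsto 0).mono_left nhdsWithin_le_nhds
  · refine (hf y ⟨h, hy.2⟩).mono_of_mem_nhdsWithin ?_
    filter_upwards [self_mem_nhdsWithin, mem_nhdsWithin_of_mem_nhds (Ioi_mem_nhds h)] with x hx hx'
      using ⟨hx', hx.2⟩

lemma le_sqrt_of_mem_Icc {y : ℝ} (hy : y ∈ Icc (0 : ℝ) 1) : y ≤ √y :=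
  Real.le_sqrt_of_sq_le (by nlinarith [hy.1, hy.2])

/-- The function of the resolvent which represents `cos(t √A) (1 + A)⁻¹`. -/
noncomputable def cosFun (t y : ℝ) : ℝ := y * Real.cos (t * freq y)

/-- The function of the resolvent which represents `A^{-1/2} sin(t √A) (1 + A)⁻¹`. -/
noncomputable def sincFun (t y : ℝ) : ℝ := y * (t * Real.sinc (t * freq y))

/-- The function of the resolvent which represents `A^{1/2} sin(t √A) (1 + A)⁻¹`. -/
noncomputable def sinFun (t y : ℝ) : ℝ := y * (freq y * Real.sin (t * freq y))

lemma continuousOn_cosFun (t : ℝ) : ContinuousOn (cosFun t) (Icc 0 1) := by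
  refine continuousOn_Icc_of_le_sqrt (K := 1)
    (continuousOn_id.mul (Real.continuous_cos.comp_continuousOn (continuousOn_freq.const_mul t)))
    fun y hy => ?_
  rw [cosFun, abs_mul, abs_of_nonneg hy.1, one_mul]
  exact (mul_le_of_le_one_right hy.1 (Real.abs_cos_le_one _)).trans (le_sqrt_of_mem_Icc hy)

lemma continuousOn_sincFun (t : ℝ) : ContinuousOn (sincFun t) (Icc 0 1) := by
  refine continuousOn_Icc_of_le_sqrt (K := |t|) (continuousOn_id.mul (continuousOn_const.mul
    (Real.continuous_sinc.comp_continuousOn (continuousOn_freq.const_mul t)))) fun y hy => ?_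
  rw [sincFun, abs_mul, abs_mul, abs_of_nonneg hy.1, mul_comm]
  exact mul_le_mul (mul_le_of_le_one_right (abs_nonneg t) (Real.abs_sinc_le_one _))
    (le_sqrt_of_mem_Icc hy) hy.1 (abs_nonneg t)

lemma continuousOn_sinFun (t : ℝ) : ContinuousOn (sinFun t) (Icc 0 1) := by
  refine continuousOn_Icc_of_le_sqrt (K := 1) (continuousOn_id.mul (continuousOn_freq.mul
    (Real.continuous_sin.comp_continuousOn (continuousOn_freq.const_mul t)))) fun y hy => ?_
  rw [sinFun, ← mul_assoc, abs_mul, abs_of_nonneg (mul_freq_nonneg hy), one_mul]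
  exact (mul_le_of_le_one_right (mul_freq_nonneg hy) (Real.abs_sin_le_one _)).trans (mul_freq_le_sqrt hy)

lemma abs_cosFun_le_one {y : ℝ} (hy : y ∈ Icc (0 : ℝ) 1) (t : ℝ) : |cosFun t y| ≤ 1 := by
  rw [cosFun, abs_mul, abs_of_nonneg hy.1]
  exact mul_le_one₀ hy.2 (abs_nonneg _) (Real.abs_cos_le_one _)

lemma abs_sinFun_le_one {y : ℝ} (hy : y ∈ Icc (0 : ℝ) 1) (t : ℝ) : |sinFun t y| ≤ 1 := by
  rw [sinFun, ← mul_assoc, abs_mul, abs_of_nonneg (mul_freq_nonneg hy)]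
  exact mul_le_one₀ (mul_freq_le_one hy) (abs_nonneg _) (Real.abs_sin_le_one _)

lemma one_sub_mul_sincFun {y : ℝ} (hy : y ∈ Icc (0 : ℝ) 1) (t : ℝ) :
    (1 - y) * sincFun t y = y * sinFun t y := by
  rcases hy.1.eq_or_lt with rfl | h
  · simp [sincFun]
  · rw [← mul_freq_sq h hy.2, sincFun, sinFun]
    by_cases hs : t * freq y = 0
    · rcases mul_eq_zero.1 hs with h0 | h0 <;> simp [h0]
    · have ht : t ≠ 0 := left_ne_zero_of_mul hs
      have hf : freq y ≠ 0 := right_ne_zero_of_mul hs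
      rw [Real.sinc_of_ne_zero hs]
      field_simp

lemma cosFun_sq_add {y : ℝ} (t : ℝ) :
    cosFun t y * cosFun t y + sincFun t y * sinFun t y = y * y := by
  have h : t * Real.sinc (t * freq y) * (freq y * Real.sin (t * freq y)) = Real.sin (t * freq y) ^ 2 := by
    by_cases hs : t * freq y = 0
    · rcases mul_eq_zero.1 hs with h0 | h0 <;> simp [h0]
    · rw [Real.sinc_of_ne_zero hs]
      have ht : t ≠ 0 := left_ne_zero_of_mul hs
      have hf : freq y ≠ 0 := right_ne_zero_of_mul hs
      field_simp
  have h2 := Real.sin_sq_add_cos_sq (t * freq y)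
  simp only [cosFun, sincFun, sinFun]
  linear_combination y ^ 2 * h + y ^ 2 * h2

lemma hasDerivAt_cosFun (t y : ℝ) : HasDerivAt (fun t => cosFun t y) (-sinFun t y) t := by
  refine (((hasDerivAt_mul_const (freq y)).cos).const_mul y).congr_deriv ?_
  simp only [sinFun]
  ring

lemma hasDerivAt_sincFun (t y : ℝ) : HasDerivAt (fun t => sincFun t y) (cosFun t y) t := by
  simp only [sincFun, cosFun]
  refine HasDerivAt.const_mul y ?_
  by_cases hf : freq y = 0
  · simpa [hf] using hasDerivAt_id' t
  · have h1 : (fun t => t * Real.sinc (t * freq y)) = fun t => Real.sin (t * freq y) / freq y := by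
      funext t
      by_cases ht : t = 0
      · simp [ht]
      · rw [Real.sinc_of_ne_zero (mul_ne_zero ht hf)]
        field_simp
    rw [h1]
    refine (((hasDerivAt_mul_const (freq y)).sin).div_const (freq y)).congr_deriv ?_
    field_simp

/-- Without the extra factor y, the derivative of `sinFun` would be (1 - y) cos(t `freq` y) for y >
0, which has no continuous extension to y = 0 in general. The second time derivative is therefore
taken only after one more application of the resolvent. -/
lemma hasDerivAt_mul_sinFun {y : ℝ} (hy : y ∈ Icc (0 : ℝ) 1) (t : ℝ) :
    HasDerivAt (fun t => y * sinFun t y) ((1 - y) * cosFun t y) t := by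
  refine ((((hasDerivAt_mul_const (freq y)).sin).const_mul (freq y)).const_mul y |>.const_mul y).congr_deriv ?_
  simp only [cosFun]
  linear_combination Real.cos (t * freq y) * sq_mul_freq_sq hy

lemma abs_sinFun_sub_le {y : ℝ} (hy : y ∈ Icc (0 : ℝ) 1) (t t' : ℝ) :
    |-sinFun t y - -sinFun t' y| ≤ |t - t'| := by
  rw [neg_sub_neg, sinFun, sinFun, ← mul_sub, ← mul_sub, ← mul_assoc, abs_mul,
    abs_of_nonneg (mul_freq_nonneg hy)]
  have h1 := Real.abs_sin_sub_sin_le (t' * freq y) (t * freq y)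
  rw [← sub_mul, abs_mul, abs_of_nonneg (freq_nonneg y), abs_sub_comm t' t] at h1
  have h2 := mul_le_mul_of_nonneg_left h1 (mul_freq_nonneg hy)
  have h3 := mul_le_mul_of_nonneg_right (mul_freq_sq_le_one hy) (abs_nonneg (t - t'))
  linarith

lemma abs_cosFun_sub_le {y : ℝ} (hy : y ∈ Icc (0 : ℝ) 1) (t t' : ℝ) :
    |cosFun t y - cosFun t' y| ≤ |t - t'| := by
  rw [cosFun, cosFun, ← mul_sub, abs_mul, abs_of_nonneg hy.1]
  have h1 := Real.abs_cos_sub_cos_le (t * freq y) (t' * freq y)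
  rw [← sub_mul, abs_mul, abs_of_nonneg (freq_nonneg y)] at h1
  have h2 := mul_le_mul_of_nonneg_left h1 hy.1
  have h3 := mul_le_mul_of_nonneg_right (mul_freq_le_one hy) (abs_nonneg (t - t'))
  linarith

lemma abs_sub_sub_le_sq {φ φ' : ℝ → ℝ} (h : ∀ t, HasDerivAt φ (φ' t) t)
    (hL : ∀ t t', |φ' t - φ' t'| ≤ |t - t'|) (t t' : ℝ) :
    |φ t' - φ t - (t' - t) * φ' t| ≤ (t' - t) ^ 2 := by
  have h1 := Convex.norm_image_sub_le_of_norm_hasDerivWithin_le (f := fun s => φ s - s * φ' t)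
    (f' := fun s => φ' s - 1 * φ' t) (s := uIcc t t') (C := |t' - t|)
    (fun s _ => ((h s).sub ((hasDerivAt_id s).mul_const _)).hasDerivWithinAt)
    (fun s hs => by
      rw [one_mul]
      exact (hL s t).trans (abs_sub_left_of_mem_uIcc hs))
    (convex_uIcc t t') left_mem_uIcc right_mem_uIcc
  rw [Real.norm_eq_abs, Real.norm_eq_abs, abs_mul_abs_self] at h1
  convert h1 using 2 <;> ring

section Operator

variable {H E : Type*} [NormedAddCommGroup H] [InnerProductSpace ℂ H] [CompleteSpace H]

lemma ofReal_smul_apply_cfc {R : H →L[ℂ] H} {f : ℝ → ℝ} (hf : ContinuousOn f (spectrum ℝ R)) (r : ℝ) (g : H) :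
    cfc (fun y => r * f y) R g = r • cfc f R g := by
  rw [cfc_const_mul r f R hf]
  rfl

/-- A Lipschitz derivative makes the first order Taylor remainder at most (t' - t)², uniformly over
the spectrum. The functional calculus turns this uniform bound into a bound in operator norm. -/
lemma hasDerivAt_cfc_apply {R : H →L[ℂ] H} (hs : spectrum ℝ R ⊆ Icc 0 1)
    {f f' : ℝ → ℝ → ℝ} (hf : ∀ t, ContinuousOn (f t) (Icc 0 1)) (hf' : ∀ t, ContinuousOn (f' t) (Icc 0 1))
    (hd : ∀ t, ∀ y ∈ Icc (0 : ℝ) 1, HasDerivAt (fun t => f t y) (f' t y) t)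
    (hL : ∀ y ∈ Icc (0 : ℝ) 1, ∀ t t', |f' t y - f' t' y| ≤ |t - t'|) (g : H) (t : ℝ) :
    HasDerivAt (fun t => cfc (f t) R g) (cfc (f' t) R g) t := by
  rw [hasDerivAt_iff_isLittleO]
  have hle : ∀ t', ‖cfc (f t') R g - cfc (f t) R g - (t' - t) • cfc (f' t) R g‖ ≤
      ‖g‖ * ‖(t' - t) ^ 2‖ := by
    intro t'
    have e : cfc (f t') R g - cfc (f t) R g - (t' - t) • cfc (f' t) R g =
        cfc (fun y => f t' y - f t y - (t' - t) * f' t y) R g := by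
      rw [cfc_sub (fun y => f t' y - f t y) (fun y => (t' - t) * f' t y) R
        (((hf t').sub (hf t)).mono hs) ((continuousOn_const.mul (hf' t)).mono hs),
        cfc_sub (f t') (f t) R ((hf t').mono hs) ((hf t).mono hs), sub_apply,
        sub_apply, ofReal_smul_apply_cfc ((hf' t).mono hs)]
    rw [e, mul_comm]
    refine ContinuousLinearMap.le_of_opNorm_le _ (norm_cfc_le (norm_nonneg _) fun y hy => ?_) g
    rw [Real.norm_eq_abs, Real.norm_eq_abs, abs_of_nonneg (sq_nonneg (t' - t))]
    exact abs_sub_sub_le_sq (fun s => hd s y (hs hy)) (hL y (hs hy)) t t'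
  refine (IsBigO.of_bound ‖g‖ (Eventually.of_forall hle)).trans_isLittleO ?_
  exact (isLittleO_pow_sub_sub t one_lt_two).congr_left fun x => by rw [Real.norm_eq_abs, sq_abs]

variable [NormedAddCommGroup E] [InnerProductSpace ℂ E]

/-- `R` is the resolvent `(1 + A)⁻¹` of a positive self-adjoint operator `A`, and `T` is `R` with values
in the completion `E` of `D(A)` in the norm `⟪A w, w⟫ ^ (1 / 2)`. -/
structure IsResolventPair (R : H →L[ℂ] H) (T : H →L[ℂ] E) : Prop where
  isSelfAdjoint : IsSelfAdjoint R
  spectrum_subset : spectrum ℝ R ⊆ Icc 0 1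
  injective : Function.Injective R
  inner_eq : ∀ g k, inner ℂ (T g) (T k) = inner ℂ (g - R g) (R k)
  denseRange : DenseRange T

/-- The solution at time `t` of the abstract wave equation with initial data `R (R g.1)`, `R (R g.2)` is
`R` applied to `waveSol R t g`. -/
noncomputable def waveSol (R : H →L[ℂ] H) (t : ℝ) : H × H →L[ℂ] H :=
  (cfc (cosFun t) R).coprod (cfc (sincFun t) R)

/-- The time derivative of `waveSol`. -/
noncomputable def waveSolDeriv (R : H →L[ℂ] H) (t : ℝ) : H × H →L[ℂ] H :=
  (-cfc (sinFun t) R).coprod (cfc (cosFun t) R)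

lemma waveSol_apply (R : H →L[ℂ] H) (t : ℝ) (g : H × H) :
    waveSol R t g = cfc (cosFun t) R g.1 + cfc (sincFun t) R g.2 := rfl

lemma waveSolDeriv_apply (R : H →L[ℂ] H) (t : ℝ) (g : H × H) :
    waveSolDeriv R t g = -cfc (sinFun t) R g.1 + cfc (cosFun t) R g.2 := rfl

namespace IsResolventPair

variable {R : H →L[ℂ] H} {T : H →L[ℂ] E} (h : IsResolventPair R T)

include h

lemma continuousOn {f : ℝ → ℝ} (hf : ContinuousOn f (Icc 0 1)) : ContinuousOn f (spectrum ℝ R) :=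
  hf.mono h.spectrum_subset

lemma cfc_mul_left {f : ℝ → ℝ} (hf : ContinuousOn f (Icc 0 1)) :
    cfc (fun y => y * f y) R = R * cfc f R := by
  rw [cfc_mul (fun y => y) f R continuousOn_id (h.continuousOn hf),
    cfc_id' ℝ R h.isSelfAdjoint]

lemma cfc_mul_left_apply {f : ℝ → ℝ} (hf : ContinuousOn f (Icc 0 1)) (g : H) :
    R (cfc f R g) = cfc (fun y => y * f y) R g := by
  rw [h.cfc_mul_left hf]
  rfl

lemma cfc_one_sub_mul_apply {f : ℝ → ℝ} (hf : ContinuousOn f (Icc 0 1)) (g : H) :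
    cfc (fun y => (1 - y) * f y) R g = cfc f R g - R (cfc f R g) := by
  rw [h.cfc_mul_left_apply hf, ← sub_apply, ← cfc_sub f (fun y => y * f y) R (h.continuousOn hf)
    (h.continuousOn (continuousOn_id.mul hf))]
  simp only [sub_mul, one_mul]

omit h in
lemma cfc_commute (f : ℝ → ℝ) (g : H) : R (cfc f R g) = cfc f R (R g) :=
  congrArg (fun L : H →L[ℂ] H => L g) (((Commute.refl R).cfc_real f).eq).symm

lemma norm_cfc_apply_le {f : ℝ → ℝ} (hf : ∀ y ∈ Icc (0 : ℝ) 1, |f y| ≤ 1) (g : H) :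
    ‖cfc f R g‖ ≤ ‖g‖ := by
  have h1 : ‖cfc f R‖ ≤ 1 := norm_cfc_le zero_le_one fun y hy => hf y (h.spectrum_subset hy)
  simpa using ContinuousLinearMap.le_of_opNorm_le _ h1 g

/-- The orthogonal complement of the range is the kernel of the adjoint, here of the injective
operator R itself. -/
lemma denseRange_resolvent : DenseRange R := by
  have h1 := ContinuousLinearMap.orthogonal_range R
  rw [h.isSelfAdjoint.adjoint_eq, LinearMap.ker_eq_bot.2 h.injective] at h1
  have h2 := (Submodule.topologicalClosure_eq_top_iff (K := LinearMap.range R.toLinearMap)).2 h1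
  have h3 := (Submodule.dense_iff_topologicalClosure_eq_top).2 h2
  exact h3

lemma hasDerivAt_waveSol (g : H × H) (t : ℝ) :
    HasDerivAt (fun t => waveSol R t g) (waveSolDeriv R t g) t := by
  have h1 := hasDerivAt_cfc_apply (R := R) h.spectrum_subset (f := cosFun) (f' := fun t y => -sinFun t y)
    continuousOn_cosFun (fun t => (continuousOn_sinFun t).neg) (fun t y _ => hasDerivAt_cosFun t y)
    (fun y hy => abs_sinFun_sub_le hy) g.1 t
  have h2 := hasDerivAt_cfc_apply (R := R) h.spectrum_subset (f := sincFun) (f' := cosFun)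
    continuousOn_sincFun continuousOn_cosFun (fun t y _ => hasDerivAt_sincFun t y)
    (fun y hy => abs_cosFun_sub_le hy) g.2 t
  rw [cfc_neg] at h1
  exact h1.add h2

lemma apply_waveSolDeriv (g : H × H) (t : ℝ) : R (waveSolDeriv R t g) =
    -cfc (fun y => y * sinFun t y) R g.1 + cfc (fun y => y * cosFun t y) R g.2 := by
  rw [waveSolDeriv_apply, map_add, map_neg, h.cfc_mul_left_apply (continuousOn_sinFun t),
    h.cfc_mul_left_apply (continuousOn_cosFun t)]

lemma sub_apply_waveSol (g : H × H) (t : ℝ) : waveSol R t g - R (waveSol R t g) =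
    cfc (fun y => (1 - y) * cosFun t y) R g.1 + cfc (fun y => y * sinFun t y) R g.2 := by
  have e : cfc (fun y => y * sinFun t y) R = cfc (fun y => (1 - y) * sincFun t y) R :=
    cfc_congr fun y hy => (one_sub_mul_sincFun (h.spectrum_subset hy) t).symm
  rw [e, h.cfc_one_sub_mul_apply (continuousOn_cosFun t), h.cfc_one_sub_mul_apply (continuousOn_sincFun t),
    waveSol_apply, map_add]
  abel

/-- The wave equation itself: for u = R w with w = `waveSol`, one has u_tt = -A u = R w - w. -/
lemma hasDerivAt_apply_waveSolDeriv (g : H × H) (t : ℝ) :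
    HasDerivAt (fun t => R (waveSolDeriv R t g)) (R (waveSol R t g) - waveSol R t g) t := by
  have h1 := hasDerivAt_cfc_apply (R := R) h.spectrum_subset (f := fun t y => y * sinFun t y)
    (f' := fun t y => (1 - y) * cosFun t y)
    (fun t => continuousOn_id.mul (continuousOn_sinFun t))
    (fun t => (continuousOn_const.sub continuousOn_id).mul (continuousOn_cosFun t))
    (fun t y hy => hasDerivAt_mul_sinFun hy t)
    (fun y hy t t' => by
      rw [← mul_sub, abs_mul]
      refine (mul_le_of_le_one_left (abs_nonneg _) ?_).trans (abs_cosFun_sub_le hy t t')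
      rw [abs_le]
      constructor <;> linarith [hy.1, hy.2]) g.1 t
  have h2 := hasDerivAt_cfc_apply (R := R) h.spectrum_subset (f := fun t y => y * cosFun t y)
    (f' := fun t y => y * -sinFun t y)
    (fun t => continuousOn_id.mul (continuousOn_cosFun t))
    (fun t => continuousOn_id.mul (continuousOn_sinFun t).neg)
    (fun t y _ => (hasDerivAt_cosFun t y).const_mul y)
    (fun y hy t t' => by
      rw [← mul_sub, abs_mul, abs_of_nonneg hy.1]
      exact (mul_le_of_le_one_left (abs_nonneg _) hy.2).trans (abs_sinFun_sub_le hy t t')) g.2 t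
  have h3 := h1.neg.add h2
  rw [← neg_sub, h.sub_apply_waveSol]
  simp only [mul_neg] at h3
  rw [cfc_neg] at h3
  refine (h3.congr_deriv ?_).congr_of_eventuallyEq (Eventually.of_forall fun t => h.apply_waveSolDeriv g t)
  rw [neg_add]
  rfl

end IsResolventPair

end Operator


/-! ### The unitary group on the energy space -/

section Group

variable {H E : Type*} [NormedAddCommGroup H] [InnerProductSpace ℂ H] [CompleteSpace H]
  [NormedAddCommGroup E] [InnerProductSpace ℂ E]

/-- The solution of the abstract wave equation, as an element of the energy space. -/
noncomputable def energySol (R : H →L[ℂ] H) (T : H →L[ℂ] E) (t : ℝ) : H × H →L[ℂ] WithLp 2 (E × H) :=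
  (WithLp.prodContinuousLinearEquiv 2 ℂ E H).symm.toContinuousLinearMap ∘L
    ((T ∘L waveSol R t).prod (R ∘L waveSolDeriv R t))

lemma energySol_apply (R : H →L[ℂ] H) (T : H →L[ℂ] E) (t : ℝ) (g : H × H) :
    energySol R T t g = WithLp.toLp 2 (T (waveSol R t g), R (waveSolDeriv R t g)) := rfl

lemma cosFun_neg (t : ℝ) : cosFun (-t) = cosFun t := by
  funext y
  simp [cosFun]

lemma sincFun_neg (t : ℝ) : sincFun (-t) = fun y => -sincFun t y := by
  funext y
  simp [sincFun]

lemma sinFun_neg (t : ℝ) : sinFun (-t) = fun y => -sinFun t y := by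
  funext y
  simp [sinFun]

/-- The wave propagation operators on the energy space. -/
noncomputable def waveGroup (R : H →L[ℂ] H) (T : H →L[ℂ] E) [CompleteSpace E] (t : ℝ) :
    WithLp 2 (E × H) →L[ℂ] WithLp 2 (E × H) :=
  (energySol R T t).toLinearMap.extendOfNorm (energySol R T 0).toLinearMap

namespace IsResolventPair

variable {R : H →L[ℂ] H} {T : H →L[ℂ] E} (h : IsResolventPair R T)

include h

lemma waveSol_zero (g : H × H) : waveSol R 0 g = R g.1 := by
  have h1 : cosFun 0 = fun y => y := by
    funext y
    simp [cosFun]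
  have h2 : sincFun 0 = fun _ => 0 := by
    funext y
    simp [sincFun]
  rw [waveSol_apply, h1, h2, cfc_id' ℝ R h.isSelfAdjoint, cfc_const_zero]
  simp

lemma waveSolDeriv_zero (g : H × H) : waveSolDeriv R 0 g = R g.2 := by
  have h1 : cosFun 0 = fun y => y := by
    funext y
    simp [cosFun]
  have h2 : sinFun 0 = fun _ => 0 := by
    funext y
    simp [sinFun]
  rw [waveSolDeriv_apply, h1, h2, cfc_id' ℝ R h.isSelfAdjoint, cfc_const_zero]
  simp

lemma energySol_zero (g : H × H) : energySol R T 0 g = WithLp.toLp 2 (T (R g.1), R (R g.2)) := by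
  rw [energySol_apply, h.waveSol_zero, h.waveSolDeriv_zero]

lemma denseRange_data : DenseRange fun g : H × H => (WithLp.toLp 2 (T g.1, R g.2) : WithLp 2 (E × H)) :=
  (WithLp.prodContinuousLinearEquiv 2 ℂ E H).symm.surjective.denseRange.comp
    (h.denseRange.prodMap h.denseRange_resolvent) (WithLp.prodContinuousLinearEquiv 2 ℂ E H).symm.continuous

lemma denseRange_map_resolvent : DenseRange (Prod.map R R) :=
  h.denseRange_resolvent.prodMap h.denseRange_resolvent

omit h [CompleteSpace H] in
lemma continuous_data :
    Continuous fun g : H × H => (WithLp.toLp 2 (T g.1, R g.2) : WithLp 2 (E × H)) :=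
  (WithLp.prodContinuousLinearEquiv 2 ℂ E H).symm.continuous.comp
    ((T.continuous.comp continuous_fst).prodMk (R.continuous.comp continuous_snd))

lemma denseRange_energySol_zero : DenseRange (energySol R T 0) := by
  have := h.denseRange_data.comp h.denseRange_map_resolvent continuous_data
  convert! this using 1
  funext g
  exact h.energySol_zero g

omit h in
lemma norm_sq_energySol (t : ℝ) (g : H × H) : ‖energySol R T t g‖ ^ 2 =
    ‖T (waveSol R t g)‖ ^ 2 + ‖R (waveSolDeriv R t g)‖ ^ 2 := WithLp.prod_norm_sq_eq_of_L2 _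

lemma hasDerivAt_energy (g : H × H) (t : ℝ) : HasDerivAt (fun t => T (waveSol R t g)) (T (waveSolDeriv R t g)) t :=
  (T.restrictScalars ℝ).hasFDerivAt.comp_hasDerivAt t (h.hasDerivAt_waveSol g t)

omit h in
lemma hasDerivAt_re_inner {F : Type*} [NormedAddCommGroup F] [InnerProductSpace ℂ F] {f k : ℝ → F}
    {f' k' : F} {t : ℝ} (hf : HasDerivAt f f' t) (hk : HasDerivAt k k' t) :
    HasDerivAt (fun t => (inner ℂ (f t) (k t)).re) ((inner ℂ f' (k t)).re + (inner ℂ (f t) k').re) t := by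
  refine (Complex.reCLM.hasFDerivAt.comp_hasDerivAt t (hf.inner ℂ hk)).congr_deriv ?_
  simp [add_comm]

omit h in
lemma hasDerivAt_norm_sq {F : Type*} [NormedAddCommGroup F] [InnerProductSpace ℂ F] {f : ℝ → F}
    {f' : F} {t : ℝ} (hf : HasDerivAt f f' t) :
    HasDerivAt (fun t => ‖f t‖ ^ 2) (2 * (inner ℂ (f t) f').re) t := by
  have h1 := hasDerivAt_re_inner hf hf
  refine (h1.congr_deriv ?_).congr_of_eventuallyEq (Eventually.of_forall fun s => ?_)
  · rw [← inner_conj_symm f' (f t), Complex.conj_re]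
    ring
  · exact norm_sq_eq_re_inner (𝕜 := ℂ) (f s)

/-- Conservation of energy. With w = `waveSol` and ẇ = `waveSolDeriv`, the derivative of the energy
is 2 Re⟨(w - R w) + (R w - w), R ẇ⟩ = 0. -/
lemma norm_energySol (t : ℝ) (g : H × H) : ‖energySol R T t g‖ = ‖energySol R T 0 g‖ := by
  have hd : ∀ s, HasDerivAt (fun t => ‖T (waveSol R t g)‖ ^ 2 + ‖R (waveSolDeriv R t g)‖ ^ 2) 0 s := by
    intro s
    refine ((hasDerivAt_norm_sq (h.hasDerivAt_energy g s)).add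
      (hasDerivAt_norm_sq (h.hasDerivAt_apply_waveSolDeriv g s))).congr_deriv ?_
    rw [h.inner_eq, ← inner_conj_symm (R (waveSolDeriv R s g)), Complex.conj_re, ← mul_add,
      ← Complex.add_re, ← inner_add_left, sub_add_sub_cancel, sub_self, inner_zero_left, Complex.zero_re,
      mul_zero]
  have h1 := is_const_of_deriv_eq_zero (fun s => (hd s).differentiableAt) (fun s => (hd s).deriv) t 0
  rw [← norm_sq_energySol, ← norm_sq_energySol] at h1
  exact (pow_left_inj₀ (norm_nonneg _) (norm_nonneg _) two_ne_zero).1 h1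

section

variable [CompleteSpace E]

lemma waveGroup_energySol (t : ℝ) (g : H × H) :
    waveGroup R T t (energySol R T 0 g) = energySol R T t g :=
  LinearMap.extendOfNorm_eq h.denseRange_energySol_zero
    ⟨1, fun x => (one_mul ‖energySol R T 0 x‖).symm ▸ (h.norm_energySol t x).le⟩ g

lemma norm_waveGroup (t : ℝ) (f : WithLp 2 (E × H)) : ‖waveGroup R T t f‖ = ‖f‖ := by
  refine isClosed_property h.denseRange_energySol_zero
    (isClosed_eq (waveGroup R T t).continuous.norm continuous_norm) (fun g => ?_) f
  rw [h.waveGroup_energySol, h.norm_energySol]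

omit h [CompleteSpace E] in
lemma waveSol_map (t : ℝ) (g : H × H) : waveSol R t (Prod.map R R g) = R (waveSol R t g) := by
  rw [waveSol_apply, waveSol_apply, map_add, cfc_commute, cfc_commute]
  rfl

omit h [CompleteSpace E] in
lemma waveSolDeriv_map (t : ℝ) (g : H × H) :
    waveSolDeriv R t (Prod.map R R g) = R (waveSolDeriv R t g) := by
  rw [waveSolDeriv_apply, waveSolDeriv_apply, map_add, map_neg, cfc_commute, cfc_commute]
  rfl

omit [CompleteSpace E] in
lemma cfc_cos_sq_add (t : ℝ) (g : H) :
    cfc (cosFun t) R (cfc (cosFun t) R g) + cfc (sincFun t) R (cfc (sinFun t) R g) = R (R g) := by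
  have e : cfc (fun y => cosFun t y * cosFun t y + sincFun t y * sinFun t y) R =
      cfc (fun y => y * y) R := cfc_congr fun y _ => cosFun_sq_add t
  have hc := h.continuousOn (continuousOn_cosFun t)
  have hs := h.continuousOn (continuousOn_sinFun t)
  have hn := h.continuousOn (continuousOn_sincFun t)
  rw [cfc_add R (fun y => cosFun t y * cosFun t y) (fun y => sincFun t y * sinFun t y) (hc.mul hc) (hn.mul hs), cfc_mul _ _ R hc hc, cfc_mul _ _ R hn hs,
    cfc_mul (fun y => y) (fun y => y) R continuousOn_id continuousOn_id,
    cfc_id' ℝ R h.isSelfAdjoint] at e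
  exact congrArg (fun L : H →L[ℂ] H => L g) e

omit h [CompleteSpace E] in
lemma cfc_comm_apply (f k : ℝ → ℝ) (g : H) : cfc f R (cfc k R g) = cfc k R (cfc f R g) :=
  congrArg (fun L : H →L[ℂ] H => L g) (cfc_commute_cfc f k R).eq

/-- Checked on a dense set by cos² + sin² = 1. -/
lemma waveGroup_neg_waveGroup (t : ℝ) (f : WithLp 2 (E × H)) :
    waveGroup R T (-t) (waveGroup R T t f) = f := by
  have hd : DenseRange (energySol R T 0 ∘ Prod.map R R) :=
    h.denseRange_energySol_zero.comp h.denseRange_map_resolvent (energySol R T 0).continuous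
  refine isClosed_property hd (isClosed_eq (((waveGroup R T (-t)).continuous).comp
    (waveGroup R T t).continuous) continuous_id) (fun g => ?_) f
  -- `energySol` at time 0 carries one more factor R than a general state. Starting from data with
  -- that extra factor makes the state at time t again initial data, to which the group can be
  -- applied once more.
  have e1 : energySol R T t (Prod.map R R g) = energySol R T 0 (waveSol R t g, waveSolDeriv R t g) := by
    rw [h.energySol_zero, energySol_apply, waveSol_map, waveSolDeriv_map]
  have e2 : waveSol R (-t) (waveSol R t g, waveSolDeriv R t g) = R (R g.1) := by
    rw [waveSol_apply, waveSol_apply, waveSolDeriv_apply, cosFun_neg, sincFun_neg, cfc_neg, map_add,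
      map_add, neg_apply, neg_apply, map_neg, ← h.cfc_cos_sq_add t, cfc_comm_apply (sincFun t) (cosFun t)]
    abel
  have e3 : waveSolDeriv R (-t) (waveSol R t g, waveSolDeriv R t g) = R (R g.2) := by
    rw [waveSolDeriv_apply, waveSol_apply, waveSolDeriv_apply, cosFun_neg, sinFun_neg, cfc_neg, map_add,
      map_add, neg_apply, neg_apply, map_neg, ← h.cfc_cos_sq_add t,
      cfc_comm_apply (sinFun t) (cosFun t), cfc_comm_apply (sinFun t) (sincFun t)]
    abel
  simp only [Function.comp_apply, id]
  rw [h.waveGroup_energySol, e1, h.waveGroup_energySol, h.energySol_zero,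
    energySol_apply, e2, e3]
  rfl

lemma inner_waveGroup (t : ℝ) (f k : WithLp 2 (E × H)) :
    inner ℂ (waveGroup R T t f) (waveGroup R T t k) = inner ℂ f k :=
  LinearIsometry.inner_map_map ⟨(waveGroup R T t).toLinearMap, h.norm_waveGroup t⟩ f k

lemma inner_waveGroup_neg (t : ℝ) (f k : WithLp 2 (E × H)) :
    inner ℂ (waveGroup R T (-t) f) k = inner ℂ f (waveGroup R T t k) := by
  rw [← h.inner_waveGroup t]
  congr 1
  simpa using h.waveGroup_neg_waveGroup (-t) f

lemma waveGroup_data_snd (t : ℝ) (g : H × H) :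
    (waveGroup R T t (WithLp.toLp 2 (T g.1, R g.2))).snd =
      -cfc (sinFun t) R g.1 + cfc (cosFun t) R g.2 := by
  rw [← waveSolDeriv_apply]
  refine isClosed_property h.denseRange_map_resolvent (isClosed_eq
    ((WithLp.sndL 2 ℂ E H).continuous.comp ((waveGroup R T t).continuous.comp continuous_data))
    (waveSolDeriv R t).continuous) (fun g => ?_) g
  simp only [Function.comp_apply]
  rw [waveSolDeriv_map]
  change (waveGroup R T t (WithLp.toLp 2 (T (R g.1), R (R g.2)))).snd = _
  rw [← h.energySol_zero, h.waveGroup_energySol]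
  rfl

/-- The completion E need not embed into H, so the first component is compared with an element of H
through maps of both spaces into a common space F. -/
lemma map_waveGroup_data_fst {F : Type*} [NormedAddCommGroup F] [NormedSpace ℂ F] (L₁ : E →L[ℂ] F)
    (L₂ : H →L[ℂ] F) (hL : ∀ x, L₁ (T x) = L₂ (R x)) (t : ℝ) (g : H × H) :
    L₁ (waveGroup R T t (WithLp.toLp 2 (T g.1, R g.2))).fst =
      L₂ (cfc (cosFun t) R g.1 + cfc (sincFun t) R g.2) := by
  rw [← waveSol_apply]
  refine isClosed_property h.denseRange_map_resolvent (isClosed_eq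
    (L₁.continuous.comp ((WithLp.fstL 2 ℂ E H).continuous.comp
      ((waveGroup R T t).continuous.comp continuous_data)))
    (L₂.continuous.comp (waveSol R t).continuous)) (fun g => ?_) g
  simp only [Function.comp_apply]
  rw [waveSol_map]
  change L₁ (waveGroup R T t (WithLp.toLp 2 (T (R g.1), R (R g.2)))).fst = _
  rw [← h.energySol_zero, h.waveGroup_energySol, ← hL]
  rfl

end

end IsResolventPair

end Group

/-! ### The propagator of A is the abstract group -/

namespace IsAdmissible

section

variable {q : ℝ → ℝ} (hq : IsAdmissible q)

/-- Multiplication by the weight `(1 + x)⁻¹` on the energy space. -/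
noncomputable def weightL : HDot q →L[ℂ] HL2 :=
  HDot.mulL decay (continuousOn_decay.aestronglyMeasurable measurableSet_Ioi) 1 zero_le_one fun x hx => by
    have h1 := hq.pos x hx
    have h2 := pow_le_pow_left₀ (decay_pos hx).le (decay_le_inv hx) 2
    rw [inv_pow] at h2
    linarith

lemma coeFn_weightL (w : HDot q) : hq.weightL w =ᵐ[halfLine] fun x => (decay x : ℂ) * w.toFun x :=
  HDot.coeFn_mulL _ _ _ _ _

/-- Elements of the energy space need not be square integrable, but become so after multiplication
by (1 + x)⁻¹, which vanishes nowhere; equality of functions is tested there. -/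
lemma weightL_eq_decayL_iff {w : HDot q} {f : HL2} :
    hq.weightL w = decayL f ↔ w.toFun =ᵐ[halfLine] f := by
  constructor
  · intro h
    have h1 := hq.coeFn_weightL w
    rw [h] at h1
    filter_upwards [h1, coeFn_decayL f, ae_restrict_mem measurableSet_Ioi] with x e1 e2 hx
    rw [e2] at e1
    exact (mul_left_cancel₀ (Complex.ofReal_ne_zero.2 (decay_pos hx).ne') e1).symm
  · intro h
    refine Lp.ext ?_
    filter_upwards [hq.coeFn_weightL w, coeFn_decayL f, h] with x e1 e2 e3
    rw [e1, e2, e3]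

lemma _root_.HalfLineWave.HDot.eq_of_toFun_ae_eq {w w' : HDot q} (h : w.toFun =ᵐ[halfLine] w'.toFun) : w = w' :=
  HDot.ext_toFun fun _ hx => Measure.eqOn_open_of_ae_eq h isOpen_Ioi w.continuousOn w'.continuousOn hx

lemma norm_embL_le (w : HDot (formPotential q)) : ‖hq.embL w‖ ≤ ‖w‖ := by
  have h1 := congrArg Complex.re (hq.inner_toEnergy w w)
  have h2 : ∀ {F : Type} [NormedAddCommGroup F] [InnerProductSpace ℂ F] (x : F),
      (inner ℂ x x).re = ‖x‖ ^ 2 := fun x => (norm_sq_eq_re_inner (𝕜 := ℂ) x).symm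
  rw [Complex.sub_re, h2, h2, h2] at h1
  exact (pow_le_pow_iff_left₀ (norm_nonneg _) (norm_nonneg _) two_ne_zero).1
    (by linarith [sq_nonneg ‖hq.toEnergy w‖])

/-- The resolvent is ι ι* for an embedding ι of norm at most one. -/
lemma spectrum_resolvent_subset : spectrum ℝ hq.resolvent ⊆ Icc 0 1 := by
  have hpos : 0 ≤ hq.resolvent := (ContinuousLinearMap.nonneg_iff_isPositive _).2
    (ContinuousLinearMap.isPositive_self_comp_adjoint hq.embL)
  have h1 : ‖hq.embL‖ ≤ 1 := ContinuousLinearMap.opNorm_le_bound _ zero_le_one fun w => by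
    rw [one_mul]
    exact hq.norm_embL_le w
  have h2 : ‖hq.lift‖ ≤ 1 := by
    rw [lift, LinearIsometryEquiv.norm_map]
    exact h1
  have h3 : ‖hq.resolvent‖ ≤ 1 :=
    (ContinuousLinearMap.opNorm_comp_le _ _).trans (mul_le_one₀ h1 (norm_nonneg _) h2)
  intro y hy
  refine ⟨spectrum_nonneg_of_nonneg hpos hy, ?_⟩
  rcases subsingleton_or_nontrivial HL2 with hs | hs
  · exact absurd hy (by simp [spectrum.of_subsingleton])
  · exact (le_abs_self y).trans ((spectrum.norm_le_norm_of_mem hy).trans h3)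

lemma embL_injective : Function.Injective hq.embL := fun w w' h => HDot.ext_toFun fun _ hx =>
  Measure.eqOn_open_of_ae_eq (((hq.coeFn_embL w).symm.trans (by rw [h])).trans (hq.coeFn_embL w'))
    isOpen_Ioi w.continuousOn w'.continuousOn hx

lemma denseRange_lift : DenseRange hq.lift := by
  have h1 := ContinuousLinearMap.orthogonal_range hq.lift
  rw [lift, ContinuousLinearMap.adjoint_adjoint, LinearMap.ker_eq_bot.2 hq.embL_injective] at h1
  have h2 := (Submodule.topologicalClosure_eq_top_iff (K := LinearMap.range hq.lift.toLinearMap)).2 h1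
  exact (Submodule.dense_iff_topologicalClosure_eq_top).2 h2

end

section

variable {lam : ℝ} {q₀ : ℝ → ℝ} (hq : IsAdmissible (potential lam q₀))
  (hlam : lam = 0 ∨ 3 / 4 ≤ lam) (hr : IsRepulsive q₀) (hg : GrowthAtZero q₀)

include hlam hr hg

lemma isResolventPair : IsResolventPair hq.resolvent hq.energyLift where
  isSelfAdjoint := (ContinuousLinearMap.isPositive_self_comp_adjoint hq.embL).isSelfAdjoint
  spectrum_subset := hq.spectrum_resolvent_subset
  injective := hq.resolvent_injective hlam hr hg
  inner_eq g k := by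
    rw [inner_sub_left]
    change inner ℂ (hq.toEnergy (hq.lift g)) (hq.toEnergy (hq.lift k)) = _
    rw [hq.inner_toEnergy, hq.inner_lift]
    rfl
  denseRange := hq.denseRange_toEnergy.comp hq.denseRange_lift hq.toEnergy.continuous

lemma isPropagatorAt_waveGroup (t : ℝ) :
    IsPropagatorAt lam q₀ t (waveGroup hq.resolvent hq.energyLift t) := by
  intro f w₀ w₁ h0 h1
  have hp := hq.isResolventPair hlam hr hg
  set g : HL2 × HL2 := (w₀ + halfLineOperator lam q₀ w₀, w₁ + halfLineOperator lam q₀ w₁)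
  have e0 : (w₀ : HL2) = hq.resolvent g.1 := hq.coe_eq_resolvent w₀
  have e1 : (w₁ : HL2) = hq.resolvent g.2 := hq.coe_eq_resolvent w₁
  have hf : f = WithLp.toLp 2 (hq.energyLift g.1, hq.resolvent g.2) := by
    refine WithLp.ofLp_injective 2 (Prod.ext (HDot.eq_of_toFun_ae_eq ?_) (h1.trans e1))
    rw [e0] at h0
    exact h0.trans (hq.coeFn_resolvent g.1)
  have hR := hq.shiftedInverse_halfLineOperator hlam hr hg
  rw [hf]
  refine ⟨?_, ?_⟩
  · rw [← hq.weightL_eq_decayL_iff, hp.map_waveGroup_data_fst hq.weightL decayL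
      (fun x => hq.weightL_eq_decayL_iff.2 (hq.coeFn_resolvent x).symm)]
    simp only [cosSqrt, sinSqrtDiv, funCalc]
    rw [hR]
    rfl
  · rw [hp.waveGroup_data_snd]
    simp only [cosSqrt, sqrtMulSin, funCalc]
    rw [hR]
    rfl

/-- The propagator is defined by choice from its values on D(A) × D(A). This set is dense in the
energy space, so any two candidates coincide. -/
lemma wavePropagator_eq (t : ℝ) :
    wavePropagator lam q₀ t = waveGroup hq.resolvent hq.energyLift t := by
  have hp := hq.isResolventPair hlam hr hg
  have hS := hq.isPropagatorAt_waveGroup hlam hr hg t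
  have hex : ∃ U, IsPropagatorAt lam q₀ t U := ⟨_, hS⟩
  rw [wavePropagator, dif_pos hex]
  have hU := hex.choose_spec
  refine ContinuousLinearMap.coeFn_injective (hp.denseRange_data.equalizer
    hex.choose.continuous (waveGroup hq.resolvent hq.energyLift t).continuous (funext fun g => ?_))
  have hm := hq.resolvent_mem_domain hlam hr hg
  have h0 := (hq.coeFn_resolvent g.1).symm
  obtain ⟨a1, a2⟩ := hU (WithLp.toLp 2 (hq.energyLift g.1, hq.resolvent g.2)) ⟨_, hm g.1⟩ ⟨_, hm g.2⟩ h0 rfl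
  obtain ⟨b1, b2⟩ := hS (WithLp.toLp 2 (hq.energyLift g.1, hq.resolvent g.2)) ⟨_, hm g.1⟩ ⟨_, hm g.2⟩ h0 rfl
  exact WithLp.ofLp_injective 2 (Prod.ext (HDot.eq_of_toFun_ae_eq (a1.trans b1.symm)) (a2.trans b2.symm))

end

end IsAdmissible


/-! ### Decay of local energies and existence of wave operators, abstractly -/

/-- A form of Barbălat's lemma: f is nonnegative, integrable and bounded with bounded derivative, so
f² and its derivative 2 f f' are both integrable, and f² tends to zero. -/
lemma tendsto_zero_of_integral_le {f f' : ℝ → ℝ} (hf : ∀ t, HasDerivAt f (f' t) t) (h0 : ∀ t, 0 ≤ f t)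
    {M K C : ℝ} (hM : ∀ t, f t ≤ M) (hK : ∀ t, |f' t| ≤ K)
    (hC : ∀ t, 0 ≤ t → ∫ s in (0 : ℝ)..t, f s ≤ C) : Tendsto f atTop (𝓝 0) := by
  have hcont : Continuous f := continuous_iff_continuousAt.2 fun t => (hf t).continuousAt
  have hint : IntegrableOn f (Ioi 0) := by
    refine integrableOn_Ioi_of_intervalIntegral_norm_bounded C 0 (l := atTop) (b := id)
      (fun t => (hcont.integrableOn_Icc (a := 0) (b := t)).mono_set Ioc_subset_Icc_self) tendsto_id ?_
    filter_upwards [eventually_ge_atTop 0] with t ht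
    simp only [id, Real.norm_of_nonneg (h0 _)]
    exact hC t ht
  have hd : ∀ t, HasDerivAt (fun t => f t ^ 2) (2 * f t * f' t) t := fun t =>
    ((hf t).pow 2).congr_deriv (by push_cast; ring)
  have hmeas : AEStronglyMeasurable (fun t => 2 * f t * f' t) (volume.restrict (Ioi 0)) := by
    have : (fun t => 2 * f t * f' t) = deriv fun t => f t ^ 2 := funext fun t => (hd t).deriv.symm
    rw [this]
    exact (measurable_deriv _).aestronglyMeasurable
  have h1 : Tendsto (fun t => f t ^ 2) atTop (𝓝 0) := by
    refine tendsto_zero_of_hasDerivAt_of_integrableOn_Ioi (a := 0) (fun t _ => hd t)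
      ((hint.const_mul (2 * K)).mono' hmeas (Eventually.of_forall fun t => ?_))
      ((hint.const_mul M).mono' (hcont.pow 2).aestronglyMeasurable (Eventually.of_forall fun t => ?_))
    · rw [norm_mul, norm_mul, Real.norm_of_nonneg (h0 t), Real.norm_eq_abs, Real.norm_eq_abs, abs_two]
      have := mul_le_mul_of_nonneg_left (hK t) (h0 t)
      linarith
    · rw [Real.norm_of_nonneg (sq_nonneg _), sq]
      exact mul_le_mul_of_nonneg_right (hM t) (h0 t)
  have h2 := h1.sqrt
  rw [Real.sqrt_zero] at h2
  exact h2.congr fun t => Real.sqrt_sq (h0 t)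

/-! ### Decay of local energies from a multiplier -/

section Abstract

variable {H E : Type*} [NormedAddCommGroup H] [InnerProductSpace ℂ H] [CompleteSpace H]
  [NormedAddCommGroup E] [InnerProductSpace ℂ E]
  {F : Type*} [NormedAddCommGroup F] [InnerProductSpace ℂ F]

/-- The time derivative of `energySol`. -/
noncomputable def energySolDeriv (R : H →L[ℂ] H) (T : H →L[ℂ] E) (t : ℝ) (g : H × H) : WithLp 2 (E × H) :=
  WithLp.toLp 2 (T (waveSolDeriv R t g), R (waveSol R t g) - waveSol R t g)

/-- `B` is a multiplier which shows that `∫ ‖L u‖² dt` is finite for all solutions `u`. -/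
structure IsMultiplier (R : H →L[ℂ] H) (T : H →L[ℂ] E) (B : E →L[ℂ] H) (L : WithLp 2 (E × H) →L[ℂ] F)
    (c : ℝ) : Prop where
  pos : 0 < c
  le : ∀ g k, c * ‖L (WithLp.toLp 2 (T g, R k))‖ ^ 2 ≤
    (inner ℂ (B (T g)) (g - R g)).re - (inner ℂ (B (T k)) (R k)).re

namespace IsResolventPair

variable {R : H →L[ℂ] H} {T : H →L[ℂ] E} (h : IsResolventPair R T)

include h

lemma hasDerivAt_energySol (g : H × H) (t : ℝ) :
    HasDerivAt (fun t => energySol R T t g) (energySolDeriv R T t g) t :=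
  (((WithLp.prodContinuousLinearEquiv 2 ℂ E H).symm.toContinuousLinearMap.restrictScalars
    ℝ).hasFDerivAt).comp_hasDerivAt t ((h.hasDerivAt_energy g t).prodMk (h.hasDerivAt_apply_waveSolDeriv g t))

lemma exists_norm_energySolDeriv_le (g : H × H) : ∃ K, ∀ t, ‖energySolDeriv R T t g‖ ≤ K := by
  refine ⟨‖T‖ * (‖g.1‖ + ‖g.2‖) + (‖g.1‖ + ‖g.2‖), fun t => ?_⟩
  have h1 : ‖waveSolDeriv R t g‖ ≤ ‖g.1‖ + ‖g.2‖ := by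
    rw [waveSolDeriv_apply]
    refine (norm_add_le _ _).trans (add_le_add ?_ (h.norm_cfc_apply_le (fun y hy => abs_cosFun_le_one hy t) _))
    rw [norm_neg]
    exact h.norm_cfc_apply_le (fun y hy => abs_sinFun_le_one hy t) _
  have h2 : ‖R (waveSol R t g) - waveSol R t g‖ ≤ ‖g.1‖ + ‖g.2‖ := by
    rw [norm_sub_rev, h.sub_apply_waveSol]
    refine (norm_add_le _ _).trans (add_le_add (h.norm_cfc_apply_le (fun y hy => ?_) _)
      (h.norm_cfc_apply_le (fun y hy => ?_) _))
    · rw [abs_mul, abs_of_nonneg (sub_nonneg.2 hy.2)]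
      exact mul_le_one₀ (by linarith [hy.1]) (abs_nonneg _) (abs_cosFun_le_one hy t)
    · rw [abs_mul, abs_of_nonneg hy.1]
      exact mul_le_one₀ hy.2 (abs_nonneg _) (abs_sinFun_le_one hy t)
  have h3 : ‖energySolDeriv R T t g‖ ≤ ‖T (waveSolDeriv R t g)‖ + ‖R (waveSol R t g) - waveSol R t g‖ := by
    refine (pow_le_pow_iff_left₀ (norm_nonneg _) (by positivity) two_ne_zero).1 ?_
    rw [WithLp.prod_norm_sq_eq_of_L2]
    change ‖T (waveSolDeriv R t g)‖ ^ 2 + ‖R (waveSol R t g) - waveSol R t g‖ ^ 2 ≤ _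
    nlinarith [norm_nonneg (T (waveSolDeriv R t g)), norm_nonneg (R (waveSol R t g) - waveSol R t g)]
  refine h3.trans (add_le_add ?_ h2)
  exact (T.le_opNorm _).trans (mul_le_mul_of_nonneg_left h1 (norm_nonneg _))

omit h [CompleteSpace H] in
lemma _root_.HalfLineWave.norm_clm_apply_le {X Y : Type*} [NormedAddCommGroup X] [NormedSpace ℂ X]
    [NormedAddCommGroup Y] [NormedSpace ℂ Y] (L : X →L[ℂ] Y) {x : X} {K : ℝ} (hx : ‖x‖ ≤ K) :
    ‖L x‖ ≤ ‖L‖ * K :=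
  (L.le_opNorm x).trans (mul_le_mul_of_nonneg_left hx (norm_nonneg _))

lemma hasDerivAt_norm_sq_apply (L : WithLp 2 (E × H) →L[ℂ] F) (g : H × H) (t : ℝ) :
    HasDerivAt (fun t => ‖L (energySol R T t g)‖ ^ 2)
      (2 * (inner ℂ (L (energySol R T t g)) (L (energySolDeriv R T t g))).re) t :=
  hasDerivAt_norm_sq ((L.restrictScalars ℝ).hasFDerivAt.comp_hasDerivAt t (h.hasDerivAt_energySol g t))

lemma continuous_norm_sq_apply (L : WithLp 2 (E × H) →L[ℂ] F) (g : H × H) :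
    Continuous fun t => ‖L (energySol R T t g)‖ ^ 2 :=
  continuous_iff_continuousAt.2 fun t => (h.hasDerivAt_norm_sq_apply L g t).continuousAt

/-- The derivative of -Re⟨B u, u_t⟩ is Re⟨B u, A u⟩ - Re⟨B u_t, u_t⟩, which dominates c ‖L (u,
u_t)‖². The functional itself is bounded by ‖B‖ times the energy at every time; the factor 2 counts
the two endpoints. -/
lemma integral_norm_sq_le {B : E →L[ℂ] H} {L : WithLp 2 (E × H) →L[ℂ] F} {c : ℝ}
    (hB : IsMultiplier R T B L c) (g : H × H) {t : ℝ} (ht : 0 ≤ t) :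
    ∫ s in (0 : ℝ)..t, ‖L (energySol R T s g)‖ ^ 2 ≤ 2 * ‖B‖ / c * ‖energySol R T 0 g‖ ^ 2 := by
  have hd : ∀ s, HasDerivAt (fun s => -(inner ℂ (B (T (waveSol R s g))) (R (waveSolDeriv R s g))).re)
      (-((inner ℂ (B (T (waveSolDeriv R s g))) (R (waveSolDeriv R s g))).re +
        (inner ℂ (B (T (waveSol R s g))) (R (waveSol R s g) - waveSol R s g)).re)) s := fun s =>
    (hasDerivAt_re_inner ((B.restrictScalars ℝ).hasFDerivAt.comp_hasDerivAt s (h.hasDerivAt_energy g s))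
      (h.hasDerivAt_apply_waveSolDeriv g s)).neg
  have h1 := intervalIntegral.integral_le_sub_of_hasDeriv_right_of_le ht
    (fun s _ => (hd s).continuousAt.continuousWithinAt) (fun s _ => (hd s).hasDerivWithinAt)
    (φ := fun s => c * ‖L (energySol R T s g)‖ ^ 2)
    ((continuous_const.mul (h.continuous_norm_sq_apply L g)).integrableOn_Icc) (fun s _ => by
      have := hB.le (waveSol R s g) (waveSolDeriv R s g)
      rw [← neg_sub (R (waveSol R s g)), inner_neg_right, Complex.neg_re] at this
      rw [energySol_apply]
      linarith)
  have h2 : ∀ s, |(inner ℂ (B (T (waveSol R s g))) (R (waveSolDeriv R s g))).re| ≤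
      ‖B‖ * ‖energySol R T 0 g‖ ^ 2 := by
    intro s
    refine (Complex.abs_re_le_norm _).trans ((norm_inner_le_norm _ _).trans ?_)
    rw [← h.norm_energySol s, sq, ← mul_assoc]
    refine mul_le_mul (norm_clm_apply_le B (WithLp.norm_fst_le E (energySol R T s g)))
      (WithLp.norm_snd_le E (energySol R T s g)) (norm_nonneg _) (by positivity)
  rw [intervalIntegral.integral_const_mul] at h1
  have h3 := (abs_le.1 (h2 t)).1
  have h4 := (abs_le.1 (h2 0)).2
  rw [div_mul_eq_mul_div, le_div_iff₀ hB.pos]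
  linarith

lemma tendsto_norm_sq {B : E →L[ℂ] H} {L : WithLp 2 (E × H) →L[ℂ] F} {c : ℝ}
    (hB : IsMultiplier R T B L c) (g : H × H) :
    Tendsto (fun t => ‖L (energySol R T t g)‖ ^ 2) atTop (𝓝 0) := by
  obtain ⟨K, hK⟩ := h.exists_norm_energySolDeriv_le g
  have h1 : ∀ t, ‖L (energySol R T t g)‖ ≤ ‖L‖ * ‖energySol R T 0 g‖ := fun t =>
    norm_clm_apply_le L (h.norm_energySol t g).le
  refine tendsto_zero_of_integral_le (h.hasDerivAt_norm_sq_apply L g) (fun t => sq_nonneg _)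
    (M := (‖L‖ * ‖energySol R T 0 g‖) ^ 2) (K := 2 * (‖L‖ * ‖energySol R T 0 g‖ * (‖L‖ * K)))
    (fun t => pow_le_pow_left₀ (norm_nonneg _) (h1 t) 2) (fun t => ?_)
    (fun t ht => h.integral_norm_sq_le hB g ht)
  rw [abs_mul, abs_two]
  refine mul_le_mul_of_nonneg_left ((Complex.abs_re_le_norm _).trans ((norm_inner_le_norm _ _).trans ?_))
    zero_le_two
  exact mul_le_mul (h1 t) (norm_clm_apply_le L (hK t)) (norm_nonneg _) (by positivity)

lemma tendsto_norm {B : E →L[ℂ] H} {L : WithLp 2 (E × H) →L[ℂ] F} {c : ℝ}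
    (hB : IsMultiplier R T B L c) (g : H × H) :
    Tendsto (fun t => ‖L (energySol R T t g)‖) atTop (𝓝 0) := by
  have h2 := (h.tendsto_norm_sq hB g).sqrt
  rw [Real.sqrt_zero] at h2
  exact h2.congr fun t => Real.sqrt_sq (norm_nonneg _)

end IsResolventPair

end Abstract


/-- A bounded monotone I converges, so its increments from a large time on are small. It suffices to
compare with one fixed time. -/
lemma cauchySeq_of_dist_sq_le {X : Type*} [PseudoMetricSpace X] {u : ℝ → X} {Φ I : ℝ → ℝ} {D : ℝ}
    (hΦ : Tendsto Φ atTop (𝓝 0)) (hI : Monotone I) (hD : ∀ t, 0 ≤ t → I t ≤ D)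
    (h : ∀ s t, 0 ≤ s → s ≤ t → dist (u t) (u s) ^ 2 ≤ Φ t + Φ s + (I t - I s)) : CauchySeq u := by
  have hbdd : BddAbove (range I) := ⟨D, by
    rintro _ ⟨t, rfl⟩
    exact (hI (le_max_left t 0)).trans (hD _ (le_max_right t 0))⟩
  have hlim := tendsto_atTop_ciSup hI hbdd
  refine Metric.cauchySeq_iff'.2 fun ε hε => ?_
  have hε2 : 0 < ε ^ 2 / 4 := by positivity
  obtain ⟨N₁, h1⟩ := eventually_atTop.1 (hΦ.eventually (gt_mem_nhds hε2))
  obtain ⟨N₂, h2⟩ := eventually_atTop.1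
    (hlim.eventually (lt_mem_nhds (show (⨆ t, I t) - ε ^ 2 / 4 < ⨆ t, I t by linarith)))
  refine ⟨max (max N₁ N₂) 0, fun n hn => ?_⟩
  set N := max (max N₁ N₂) 0
  have hN1 : N₁ ≤ N := (le_max_left _ _).trans (le_max_left _ _)
  have e1 := h N n (le_max_right _ _) hn
  have e2 := h1 n (hN1.trans hn)
  have e3 := h1 N hN1
  have e4 := h2 N ((le_max_right _ _).trans (le_max_left _ _))
  have e5 := le_ciSup hbdd n
  exact (pow_lt_pow_iff_left₀ dist_nonneg hε.le two_ne_zero).1 (by linarith)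

lemma cauchySeq_apply_of_dense {X Y : Type*} [NormedAddCommGroup X] [NormedSpace ℂ X]
    [NormedAddCommGroup Y] [NormedSpace ℂ Y] {Ω : ℝ → X →L[ℂ] Y} {K : ℝ} (hK : ∀ t f, ‖Ω t f‖ ≤ K * ‖f‖)
    {ι : Type*} {e : ι → X} (he : DenseRange e) (h : ∀ i, CauchySeq fun t => Ω t (e i)) (f : X) :
    CauchySeq fun t => Ω t f := by
  refine Metric.cauchySeq_iff'.2 fun ε hε => ?_
  have hK1 : 0 < |K| + 1 := by positivity
  obtain ⟨i, hi⟩ := Metric.denseRange_iff.1 he f (ε / (4 * (|K| + 1))) (by positivity)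
  obtain ⟨N, hN⟩ := Metric.cauchySeq_iff'.1 (h i) (ε / 2) (by positivity)
  refine ⟨N, fun n hn => ?_⟩
  have h1 : ∀ t, dist (Ω t f) (Ω t (e i)) < ε / 4 := fun t => by
    rw [dist_eq_norm, ← map_sub]
    refine (hK t _).trans_lt ?_
    rw [← dist_eq_norm]
    calc K * dist f (e i) ≤ (|K| + 1) * dist f (e i) :=
          mul_le_mul_of_nonneg_right ((le_abs_self K).trans (by linarith)) dist_nonneg
      _ < (|K| + 1) * (ε / (4 * (|K| + 1))) := mul_lt_mul_of_pos_left hi hK1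
      _ = ε / 4 := by field_simp
  calc dist (Ω n f) (Ω N f) ≤ dist (Ω n f) (Ω n (e i)) + dist (Ω n (e i)) (Ω N (e i)) +
        dist (Ω N (e i)) (Ω N f) := dist_triangle4 _ _ _ _
    _ < ε / 4 + ε / 2 + ε / 4 := by
        have := h1 N
        rw [dist_comm] at this
        exact add_lt_add (add_lt_add (h1 n) (hN n hn)) this
    _ = ε := by ring

lemma exists_linearIsometry_of_tendsto {X Y : Type*} [NormedAddCommGroup X] [NormedSpace ℂ X]
    [NormedAddCommGroup Y] [NormedSpace ℂ Y] [CompleteSpace Y] {Ω : ℝ → X →L[ℂ] Y} {K : ℝ}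
    (hK : ∀ t f, ‖Ω t f‖ ≤ K * ‖f‖) {ι : Type*} {e : ι → X} (he : DenseRange e)
    (h : ∀ i, CauchySeq fun t => Ω t (e i))
    (hn : ∀ i, Tendsto (fun t => ‖Ω t (e i)‖) atTop (𝓝 ‖e i‖)) :
    ∃ W : X →ₗᵢ[ℂ] Y, ∀ f, Tendsto (fun t => Ω t f) atTop (𝓝 (W f)) := by
  choose w hw using fun f => cauchySeq_tendsto_of_complete (cauchySeq_apply_of_dense hK he h f)
  let W₀ : X →ₗ[ℂ] Y :=
    { toFun := w
      map_add' := fun f k => tendsto_nhds_unique (hw (f + k)) (by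
        simpa only [map_add] using (hw f).add (hw k))
      map_smul' := fun c f => tendsto_nhds_unique (hw (c • f)) (by
        simpa only [map_smul, RingHom.id_apply] using (hw f).const_smul c) }
  let W₁ : X →L[ℂ] Y := W₀.mkContinuous K fun f =>
    le_of_tendsto (hw f).norm (Eventually.of_forall fun t => hK t f)
  have hnorm : ∀ f, ‖W₁ f‖ = ‖f‖ := fun f =>
    isClosed_property he (isClosed_eq W₁.continuous.norm continuous_norm)
      (fun i => tendsto_nhds_unique (hw (e i)).norm (hn i)) f
  exact ⟨⟨W₀, hnorm⟩, hw⟩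

/-! ### Wave operators for local perturbations -/

section Abstract

variable {H E₁ E₂ : Type*} [NormedAddCommGroup H] [InnerProductSpace ℂ H] [CompleteSpace H]
  [NormedAddCommGroup E₁] [InnerProductSpace ℂ E₁] [CompleteSpace E₁]
  [NormedAddCommGroup E₂] [InnerProductSpace ℂ E₂] [CompleteSpace E₂]
  {F : Type*} [NormedAddCommGroup F] [InnerProductSpace ℂ F]
  {R₁ R₂ : H →L[ℂ] H} {T₁ : H →L[ℂ] E₁} {T₂ : H →L[ℂ] E₂}
  {L₁ : WithLp 2 (E₁ × H) →L[ℂ] F} {L₂ : WithLp 2 (E₂ × H) →L[ℂ] F}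

/-- `J` identifies two energy spaces up to local energies, and `P` is a cut off version of `J`, which
intertwines the two wave equations up to local energies. -/
structure IsLocalPerturbation (R₁ R₂ : H →L[ℂ] H) (T₁ : H →L[ℂ] E₁) (T₂ : H →L[ℂ] E₂)
    (L₁ : WithLp 2 (E₁ × H) →L[ℂ] F) (L₂ : WithLp 2 (E₂ × H) →L[ℂ] F)
    (J P : WithLp 2 (E₁ × H) →L[ℂ] WithLp 2 (E₂ × H)) (C : ℝ) : Prop where
  nonneg : 0 ≤ C
  norm_sub_le : ∀ f, ‖J f - P f‖ ≤ C * ‖L₁ f‖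
  abs_norm_sq_sub_le : ∀ f, |‖J f‖ ^ 2 - ‖f‖ ^ 2| ≤ C * ‖L₁ f‖ ^ 2
  norm_inner_add_le : ∀ g g' k k' : H,
    ‖inner ℂ (P (WithLp.toLp 2 (T₁ g', R₁ g - g))) (WithLp.toLp 2 (T₂ k, R₂ k')) +
      inner ℂ (P (WithLp.toLp 2 (T₁ g, R₁ g'))) (WithLp.toLp 2 (T₂ k', R₂ k - k))‖ ≤
    C * (‖L₁ (WithLp.toLp 2 (T₁ g, R₁ g'))‖ * ‖L₂ (WithLp.toLp 2 (T₂ k, R₂ k'))‖)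

namespace IsLocalPerturbation

variable {J P : WithLp 2 (E₁ × H) →L[ℂ] WithLp 2 (E₂ × H)} {C : ℝ}
  (hJ : IsLocalPerturbation R₁ R₂ T₁ T₂ L₁ L₂ J P C) (h₁ : IsResolventPair R₁ T₁)
  (h₂ : IsResolventPair R₂ T₂)

include hJ h₁ h₂

-- The time derivative of ⟨P u₁, u₂⟩ is at most C ‖L₁ u₁‖ ‖L₂ u₂‖, and Young's inequality splits the
-- product. The weight α stays free so that the part with u₂ can be made small against the energy of
-- u₂.
omit [CompleteSpace E₁] [CompleteSpace E₂] in
lemma norm_inner_sub_le (g k : H × H) {α : ℝ} (hα : 0 < α) {s t : ℝ} (hst : s ≤ t) :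
    ‖inner ℂ (P (energySol R₁ T₁ t g)) (energySol R₂ T₂ t k) -
      inner ℂ (P (energySol R₁ T₁ s g)) (energySol R₂ T₂ s k)‖ ≤
    C / 2 * (α * ∫ τ in s..t, ‖L₁ (energySol R₁ T₁ τ g)‖ ^ 2) +
      C / 2 * (α⁻¹ * ∫ τ in s..t, ‖L₂ (energySol R₂ T₂ τ k)‖ ^ 2) := by
  have hd : ∀ τ, HasDerivAt
      (fun τ => inner ℂ (P (energySol R₁ T₁ τ g)) (energySol R₂ T₂ τ k) -
        inner ℂ (P (energySol R₁ T₁ s g)) (energySol R₂ T₂ s k))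
      (inner ℂ (P (energySol R₁ T₁ τ g)) (energySolDeriv R₂ T₂ τ k) +
        inner ℂ (P (energySolDeriv R₁ T₁ τ g)) (energySol R₂ T₂ τ k)) τ := fun τ =>
    (((P.restrictScalars ℝ).hasFDerivAt.comp_hasDerivAt τ (h₁.hasDerivAt_energySol g τ)).inner ℂ
      (h₂.hasDerivAt_energySol k τ)).sub_const _
  have hi₁ : ∀ τ, HasDerivAt (fun t => ∫ τ in s..t, ‖L₁ (energySol R₁ T₁ τ g)‖ ^ 2)
      (‖L₁ (energySol R₁ T₁ τ g)‖ ^ 2) τ := fun τ =>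
    (h₁.continuous_norm_sq_apply L₁ g).integral_hasStrictDerivAt s τ |>.hasDerivAt
  have hi₂ : ∀ τ, HasDerivAt (fun t => ∫ τ in s..t, ‖L₂ (energySol R₂ T₂ τ k)‖ ^ 2)
      (‖L₂ (energySol R₂ T₂ τ k)‖ ^ 2) τ := fun τ =>
    (h₂.continuous_norm_sq_apply L₂ k).integral_hasStrictDerivAt s τ |>.hasDerivAt
  refine image_norm_le_of_norm_deriv_right_le_deriv_boundary (a := s) (b := t)
    (fun τ _ => (hd τ).continuousAt.continuousWithinAt) (fun τ _ => (hd τ).hasDerivWithinAt)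
    (by simp) (fun τ => (((hi₁ τ).const_mul α).const_mul (C / 2)).add
      (((hi₂ τ).const_mul α⁻¹).const_mul (C / 2))) (fun τ _ => ?_) (right_mem_Icc.2 hst)
  have h3 := hJ.norm_inner_add_le (waveSol R₁ τ g) (waveSolDeriv R₁ τ g) (waveSol R₂ τ k)
    (waveSolDeriv R₂ τ k)
  rw [add_comm]
  refine h3.trans ?_
  change C * (‖L₁ (energySol R₁ T₁ τ g)‖ * ‖L₂ (energySol R₂ T₂ τ k)‖) ≤ _
  set a := ‖L₁ (energySol R₁ T₁ τ g)‖
  set b := ‖L₂ (energySol R₂ T₂ τ k)‖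
  have h4 : 2 * (a * b) ≤ α * a ^ 2 + α⁻¹ * b ^ 2 := by
    have e1 : α * a ^ 2 + α⁻¹ * b ^ 2 - 2 * (a * b) = α⁻¹ * (α * a - b) ^ 2 := by
      field_simp
      ring
    have e2 : 0 ≤ α⁻¹ * (α * a - b) ^ 2 := by positivity
    linarith
  have := mul_le_mul_of_nonneg_left h4 hJ.nonneg
  linarith

variable {B₁ : E₁ →L[ℂ] H} {B₂ : E₂ →L[ℂ] H} {c₁ c₂ : ℝ} (hB₁ : IsMultiplier R₁ T₁ B₁ L₁ c₁)
  (hB₂ : IsMultiplier R₂ T₂ B₂ L₂ c₂)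

omit hJ in
lemma norm_comp_le (t : ℝ) (f : WithLp 2 (E₁ × H)) :
    ‖waveGroup R₂ T₂ (-t) (J (waveGroup R₁ T₁ t f))‖ ≤ ‖J‖ * ‖f‖ := by
  rw [h₂.norm_waveGroup]
  exact norm_clm_apply_le J (h₁.norm_waveGroup t f).le

-- The difference of `waveGroup R₂ T₂ (-t) ∘ J ∘ waveGroup R₁ T₁ t` at two times, tested against
-- arbitrary data of the second equation. The replacement of J by P costs the first term; the second
-- comes from `norm_inner_sub_le`.
include hB₂ in
lemma norm_inner_comp_sub_le (g k : H × H) {s t : ℝ} (hs : 0 ≤ s) (hst : s ≤ t) :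
    ‖inner ℂ (waveGroup R₂ T₂ (-t) (J (waveGroup R₁ T₁ t (energySol R₁ T₁ 0 g))) -
      waveGroup R₂ T₂ (-s) (J (waveGroup R₁ T₁ s (energySol R₁ T₁ 0 g)))) (energySol R₂ T₂ 0 k)‖ ≤
    C * (‖L₁ (energySol R₁ T₁ t g)‖ + ‖L₁ (energySol R₁ T₁ s g)‖) * ‖energySol R₂ T₂ 0 k‖ +
      (C / 2 * ((C * (2 * ‖B₂‖ / c₂) + 1) * ∫ τ in s..t, ‖L₁ (energySol R₁ T₁ τ g)‖ ^ 2) +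
        ‖energySol R₂ T₂ 0 k‖ ^ 2 / 2) := by
  have hD0 : 0 ≤ 2 * ‖B₂‖ / c₂ := div_nonneg (by positivity) hB₂.pos.le
  have hC0 := hJ.nonneg
  -- This is the Young parameter α. It exceeds C times the constant of the space-time bound for the
  -- second equation, so the part with u₂ is at most half the energy of the test data; the summand 1
  -- keeps it positive.
  have hα0 : 0 < C * (2 * ‖B₂‖ / c₂) + 1 := by positivity
  have e0 : ∀ τ, inner ℂ (waveGroup R₂ T₂ (-τ) (J (waveGroup R₁ T₁ τ (energySol R₁ T₁ 0 g))))
      (energySol R₂ T₂ 0 k) =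
      inner ℂ (J (energySol R₁ T₁ τ g) - P (energySol R₁ T₁ τ g)) (energySol R₂ T₂ τ k) +
        inner ℂ (P (energySol R₁ T₁ τ g)) (energySol R₂ T₂ τ k) := fun τ => by
    rw [h₂.inner_waveGroup_neg, h₂.waveGroup_energySol, h₁.waveGroup_energySol, ← inner_add_left,
      sub_add_cancel]
  have e1 : ∀ τ, ‖inner ℂ (J (energySol R₁ T₁ τ g) - P (energySol R₁ T₁ τ g)) (energySol R₂ T₂ τ k)‖ ≤
      C * ‖L₁ (energySol R₁ T₁ τ g)‖ * ‖energySol R₂ T₂ 0 k‖ := fun τ => by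
    refine (norm_inner_le_norm _ _).trans ?_
    rw [h₂.norm_energySol]
    exact mul_le_mul_of_nonneg_right (hJ.norm_sub_le _) (norm_nonneg _)
  have e2 := hJ.norm_inner_sub_le h₁ h₂ g k hα0 hst
  have hcont₂ := h₂.continuous_norm_sq_apply L₂ k
  have e3 : ∫ τ in s..t, ‖L₂ (energySol R₂ T₂ τ k)‖ ^ 2 ≤ 2 * ‖B₂‖ / c₂ * ‖energySol R₂ T₂ 0 k‖ ^ 2 := by
    refine le_trans ?_ (h₂.integral_norm_sq_le hB₂ k (hs.trans hst))
    rw [← intervalIntegral.integral_add_adjacent_intervals (hcont₂.intervalIntegrable 0 s)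
      (hcont₂.intervalIntegrable s t)]
    exact le_add_of_nonneg_left (intervalIntegral.integral_nonneg hs fun _ _ => sq_nonneg _)
  have e4 : C / 2 * ((C * (2 * ‖B₂‖ / c₂) + 1)⁻¹ * ∫ τ in s..t, ‖L₂ (energySol R₂ T₂ τ k)‖ ^ 2) ≤
      ‖energySol R₂ T₂ 0 k‖ ^ 2 / 2 := by
    have a1 := mul_le_mul_of_nonneg_left e3
      (show 0 ≤ C / 2 * (C * (2 * ‖B₂‖ / c₂) + 1)⁻¹ by positivity)
    have a2 : C * (2 * ‖B₂‖ / c₂) * (C * (2 * ‖B₂‖ / c₂) + 1)⁻¹ ≤ 1 := by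
      rw [← div_eq_mul_inv, div_le_one hα0]
      linarith
    have a3 := mul_le_mul_of_nonneg_right a2 (sq_nonneg ‖energySol R₂ T₂ 0 k‖)
    linarith
  rw [inner_sub_left, e0 t, e0 s, add_sub_add_comm]
  refine (norm_add_le _ _).trans ?_
  have e5 := (_root_.norm_sub_le (inner ℂ (J (energySol R₁ T₁ t g) - P (energySol R₁ T₁ t g))
    (energySol R₂ T₂ t k)) (inner ℂ (J (energySol R₁ T₁ s g) - P (energySol R₁ T₁ s g))
    (energySol R₂ T₂ s k))).trans (add_le_add (e1 t) (e1 s))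
  linarith

-- By density the bound may be tested at z itself, and the term ‖z‖²/2 is absorbed on the left.
omit [CompleteSpace E₁] [CompleteSpace E₂] hJ h₁ h₂ in
lemma _root_.HalfLineWave.norm_sq_le_of_dense {X ι : Type*} [NormedAddCommGroup X] [InnerProductSpace ℂ X]
    {e : ι → X} (he : DenseRange e) {z : X} {a b : ℝ}
    (h : ∀ i, ‖inner ℂ z (e i)‖ ≤ a * ‖e i‖ + (b + ‖e i‖ ^ 2 / 2)) :
    ‖z‖ ^ 2 ≤ 2 * (a * ‖z‖ + b) := by
  have key : ‖inner ℂ z z‖ ≤ a * ‖z‖ + (b + ‖z‖ ^ 2 / 2) :=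
    isClosed_property (p := fun y => ‖inner ℂ z y‖ ≤ a * ‖y‖ + (b + ‖y‖ ^ 2 / 2)) he
      (isClosed_le (by fun_prop) (by fun_prop)) h z
  rw [inner_self_eq_norm_sq_to_K, norm_pow, RCLike.norm_ofReal, abs_norm] at key
  linarith

include hB₂ in
lemma cauchySeq_energySol (hB₁ : IsMultiplier R₁ T₁ B₁ L₁ c₁) (g : H × H) :
    CauchySeq fun t => waveGroup R₂ T₂ (-t) (J (waveGroup R₁ T₁ t (energySol R₁ T₁ 0 g))) := by
  have hC0 := hJ.nonneg
  have hα0 : 0 ≤ C * (C * (2 * ‖B₂‖ / c₂) + 1) := by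
    have hD0 : 0 ≤ 2 * ‖B₂‖ / c₂ := div_nonneg (by positivity) hB₂.pos.le
    positivity
  have hcont := h₁.continuous_norm_sq_apply L₁ g
  refine cauchySeq_of_dist_sq_le
    (Φ := fun t => 2 * C * (2 * (‖J‖ * ‖energySol R₁ T₁ 0 g‖)) * ‖L₁ (energySol R₁ T₁ t g)‖)
    (I := fun t => C * (C * (2 * ‖B₂‖ / c₂) + 1) * ∫ τ in (0 : ℝ)..t, ‖L₁ (energySol R₁ T₁ τ g)‖ ^ 2)
    (D := C * (C * (2 * ‖B₂‖ / c₂) + 1) * (2 * ‖B₁‖ / c₁ * ‖energySol R₁ T₁ 0 g‖ ^ 2)) ?_ ?_ ?_ ?_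
  · have := (h₁.tendsto_norm hB₁ g).const_mul (2 * C * (2 * (‖J‖ * ‖energySol R₁ T₁ 0 g‖)))
    rwa [mul_zero] at this
  · intro s t hst
    refine mul_le_mul_of_nonneg_left ?_ hα0
    rw [← sub_nonneg, intervalIntegral.integral_interval_sub_left (hcont.intervalIntegrable _ _)
      (hcont.intervalIntegrable _ _)]
    exact intervalIntegral.integral_nonneg hst fun _ _ => sq_nonneg _
  · intro t ht
    exact mul_le_mul_of_nonneg_left (h₁.integral_norm_sq_le hB₁ g ht) hα0
  intro s t hs hst
  rw [← mul_sub, intervalIntegral.integral_interval_sub_left (hcont.intervalIntegrable _ _)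
      (hcont.intervalIntegrable _ _), dist_eq_norm]
  have h5 := norm_sq_le_of_dense h₂.denseRange_energySol_zero
    (fun k => hJ.norm_inner_comp_sub_le h₁ h₂ hB₂ g k hs hst)
  refine h5.trans ?_
  have hzM : ‖waveGroup R₂ T₂ (-t) (J (waveGroup R₁ T₁ t (energySol R₁ T₁ 0 g))) -
      waveGroup R₂ T₂ (-s) (J (waveGroup R₁ T₁ s (energySol R₁ T₁ 0 g)))‖ ≤
      2 * (‖J‖ * ‖energySol R₁ T₁ 0 g‖) := by
    refine (_root_.norm_sub_le _ _).trans ?_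
    have := norm_comp_le (J := J) h₁ h₂ t (energySol R₁ T₁ 0 g)
    have := norm_comp_le (J := J) h₁ h₂ s (energySol R₁ T₁ 0 g)
    linarith
  have h6 := mul_le_mul_of_nonneg_left hzM
    (show 0 ≤ C * (‖L₁ (energySol R₁ T₁ t g)‖ + ‖L₁ (energySol R₁ T₁ s g)‖) by positivity)
  linarith

include hB₁ hB₂ in
/-- Existence of the wave operator. -/
lemma exists_tendsto : ∃ W : WithLp 2 (E₁ × H) →ₗᵢ[ℂ] WithLp 2 (E₂ × H), ∀ f,
    Tendsto (fun t => waveGroup R₂ T₂ (-t) (J (waveGroup R₁ T₁ t f))) atTop (𝓝 (W f)) := by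
  refine exists_linearIsometry_of_tendsto
    (Ω := fun t => waveGroup R₂ T₂ (-t) ∘L J ∘L waveGroup R₁ T₁ t) (K := ‖J‖)
    (norm_comp_le h₁ h₂) h₁.denseRange_energySol_zero
    (hJ.cauchySeq_energySol h₁ h₂ hB₂ hB₁) fun g => ?_
  have e1 : ∀ t, ‖(waveGroup R₂ T₂ (-t) ∘L J ∘L waveGroup R₁ T₁ t) (energySol R₁ T₁ 0 g)‖ =
      ‖J (energySol R₁ T₁ t g)‖ := fun t => by
    rw [ContinuousLinearMap.comp_apply, ContinuousLinearMap.comp_apply, h₂.norm_waveGroup,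
      h₁.waveGroup_energySol]
  simp only [e1]
  -- J is not isometric, but its defect is bounded by the local energy, which tends to zero along
  -- the evolution.
  have e2 : Tendsto (fun t => ‖J (energySol R₁ T₁ t g)‖ ^ 2) atTop (𝓝 (‖energySol R₁ T₁ 0 g‖ ^ 2)) := by
    rw [tendsto_iff_norm_sub_tendsto_zero]
    refine squeeze_zero (fun _ => norm_nonneg _) (fun t => ?_)
      (by simpa using (h₁.tendsto_norm_sq hB₁ g).const_mul C)
    rw [← h₁.norm_energySol t]
    exact hJ.abs_norm_sq_sub_le _
  have e3 := e2.sqrt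
  rw [Real.sqrt_sq (norm_nonneg _)] at e3
  exact e3.congr fun t => Real.sqrt_sq (norm_nonneg _)

omit hJ in
/-- The wave operators for the two directions are inverse to each other. -/
lemma apply_apply_of_tendsto (J : WithLp 2 (E₁ × H) ≃L[ℂ] WithLp 2 (E₂ × H))
    {W : WithLp 2 (E₁ × H) →ₗᵢ[ℂ] WithLp 2 (E₂ × H)} {f : WithLp 2 (E₂ × H)} {k : WithLp 2 (E₁ × H)}
    (hW : Tendsto (fun t => waveGroup R₂ T₂ (-t) (J (waveGroup R₁ T₁ t k))) atTop (𝓝 (W k)))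
    (hk : Tendsto (fun t => waveGroup R₁ T₁ (-t) (J.symm (waveGroup R₂ T₂ t f))) atTop (𝓝 k)) :
    W k = f := by
  refine tendsto_nhds_unique hW ?_
  rw [tendsto_iff_norm_sub_tendsto_zero] at hk ⊢
  refine squeeze_zero (fun _ => norm_nonneg _) (fun t => ?_)
    (by simpa using hk.const_mul ‖(J : WithLp 2 (E₁ × H) →L[ℂ] WithLp 2 (E₂ × H))‖)
  -- f itself is obtained by evolving forward with the second group, applying the inverse of J, and
  -- undoing everything; so the error is the uniformly bounded family applied to the error of the
  -- opposite limit.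
  have e1 : waveGroup R₂ T₂ (-t) (J (waveGroup R₁ T₁ t k)) - f =
      waveGroup R₂ T₂ (-t) (J (waveGroup R₁ T₁ t
        (k - waveGroup R₁ T₁ (-t) (J.symm (waveGroup R₂ T₂ t f))))) := by
    have e2 := h₁.waveGroup_neg_waveGroup (-t) (J.symm (waveGroup R₂ T₂ t f))
    rw [neg_neg] at e2
    rw [map_sub, e2, map_sub, J.apply_symm_apply, map_sub, h₂.waveGroup_neg_waveGroup]
  rw [e1, norm_sub_rev (waveGroup R₁ T₁ (-t) (J.symm (waveGroup R₂ T₂ t f))) k]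
  exact norm_comp_le (J := (J : WithLp 2 (E₁ × H) →L[ℂ] WithLp 2 (E₂ × H))) h₁ h₂ t _

end IsLocalPerturbation

end Abstract


/-! ### Local energy decay of the concrete wave equation -/

namespace IsAdmissible

section

variable {q : ℝ → ℝ} (hq : IsAdmissible q)

/-- The local energy `(w₀, w₁) ↦ ((1 + x)⁻¹ w₀', ((1 + x) x)⁻¹ w₀, (1 + x)⁻² w₁)`. -/
noncomputable def localL : EnergySpace q →L[ℂ] WithLp 2 (WithLp 2 (HL2 × HL2) × HL2) :=
  ((WithLp.prodContinuousLinearEquiv 2 ℂ (WithLp 2 (HL2 × HL2)) HL2).symm :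
      WithLp 2 (HL2 × HL2) × HL2 →L[ℂ] WithLp 2 (WithLp 2 (HL2 × HL2) × HL2)) ∘L
    (((((WithLp.prodContinuousLinearEquiv 2 ℂ HL2 HL2).symm :
      HL2 × HL2 →L[ℂ] WithLp 2 (HL2 × HL2)) ∘L
        ((decayL ∘L HDot.derivL q).prod hq.localMul)) ∘L WithLp.fstL 2 ℂ (HDot q) HL2).prod
      (localVel ∘L WithLp.sndL 2 ℂ (HDot q) HL2))

lemma norm_sq_localL (f : EnergySpace q) : ‖hq.localL f‖ ^ 2 =
    ‖decayL (HDot.derivL q f.fst)‖ ^ 2 + ‖hq.localMul f.fst‖ ^ 2 + ‖localVel f.snd‖ ^ 2 := by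
  rw [WithLp.prod_norm_sq_eq_of_L2 (hq.localL f)]
  exact congrArg (· + _) (WithLp.prod_norm_sq_eq_of_L2 (hq.localL f).fst)

lemma norm_decayL_derivL_le (f : EnergySpace q) :
    ‖decayL (HDot.derivL q f.fst)‖ ≤ ‖hq.localL f‖ := by
  refine (pow_le_pow_iff_left₀ (norm_nonneg _) (norm_nonneg _) two_ne_zero).1 ?_
  rw [norm_sq_localL, add_assoc]
  exact le_add_of_nonneg_right (by positivity)

lemma norm_localMul_le (f : EnergySpace q) : ‖hq.localMul f.fst‖ ≤ ‖hq.localL f‖ := by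
  refine (pow_le_pow_iff_left₀ (norm_nonneg _) (norm_nonneg _) two_ne_zero).1 ?_
  rw [norm_sq_localL, add_comm (‖decayL _‖ ^ 2), add_assoc]
  exact le_add_of_nonneg_right (by positivity)

lemma norm_localVel_le (f : EnergySpace q) : ‖localVel f.snd‖ ≤ ‖hq.localL f‖ := by
  refine (pow_le_pow_iff_left₀ (norm_nonneg _) (norm_nonneg _) two_ne_zero).1 ?_
  rw [norm_sq_localL]
  exact le_add_of_nonneg_left (by positivity)

end

lemma exists_isMultiplier {lam : ℝ} {q₀ : ℝ → ℝ} (hq : IsAdmissible (potential lam q₀))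
    (hlam : lam = 0 ∨ 3 / 4 ≤ lam) (hr : IsRepulsive q₀) (hg : GrowthAtZero q₀) :
    ∃ B c, IsMultiplier hq.resolvent hq.energyLift B hq.localL c := by
  obtain ⟨C, hC0, hC⟩ := hq.bound
  -- C bounds q by C (1 + x⁻²); this is the largest η allowed by `morawetz_pointwise`.
  set η : ℝ := (200 * (1 + C))⁻¹ with hη
  have hη0 : 0 < η := by positivity
  have hηC : 200 * η * (1 + C) ≤ 1 := by
    rw [hη]
    field_simp
    exact le_rfl
  refine ⟨hq.multiplier η, min η (1 / 36), by positivity, fun g k => ?_⟩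
  have h1 := hq.re_inner_multiplier_ge hlam hr hg hC0 hC hη0 hηC g
  have h2 := hq.re_inner_multiplier_self_le η k
  rw [norm_sq_localL]
  have e1 := mul_le_mul_of_nonneg_right (min_le_right η (1 / 36))
    (show 0 ≤ ‖decayL (HDot.derivL _ (hq.energyLift g))‖ ^ 2 + ‖hq.localMul (hq.energyLift g)‖ ^ 2 by
      positivity)
  have e2 := mul_le_mul_of_nonneg_right (min_le_left η (1 / 36))
    (sq_nonneg ‖localVel (hq.resolvent k)‖)
  change min η (1 / 36) * (‖decayL (HDot.derivL _ (hq.energyLift g))‖ ^ 2 +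
    ‖hq.localMul (hq.energyLift g)‖ ^ 2 + ‖localVel (hq.resolvent k)‖ ^ 2) ≤ _
  linarith

end IsAdmissible

/-! ### Two potentials which agree near infinity -/

section Weights

variable {R : ℝ}

lemma one_le_mul_decay {x : ℝ} (hx : 0 < x) (hxR : x ≤ 2 * R) : 1 ≤ (1 + 2 * R) * decay x := by
  rw [decay, ← div_eq_mul_inv, le_div_iff₀ (by linarith)]
  linarith

variable (hR : 0 < R)

include hR

lemma inv_sq_ge {x : ℝ} (hx : 0 < x) (hxR : x ≤ 2 * R) : 1 + (x ^ 2)⁻¹ ≤ (1 + 4 * R ^ 2) * x⁻¹ ^ 2 := by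
  rw [inv_pow, add_mul, one_mul, add_comm, add_le_add_iff_left, ← div_eq_mul_inv,
    le_div_iff₀ (by positivity)]
  nlinarith

lemma abs_one_sub_step_le {x : ℝ} (hx : 0 < x) : |1 - step R x| ≤ (1 + 2 * R) ^ 2 * decay x ^ 2 := by
  rcases le_total (2 * R) x with h | h
  · rw [step_eq_one hR h, sub_self, abs_zero]
    positivity
  · have h1 := one_le_mul_decay hx h
    rw [abs_of_nonneg (sub_nonneg.2 (step_le_one R x)), ← mul_pow]
    exact (sub_le_self _ (step_nonneg R x)).trans (one_le_pow₀ h1)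

/-- The derivative of the cutoff lives on R ≤ x ≤ 2 R, where every power of (1 + x)⁻¹ is bounded
below. The cube is chosen because it splits into (1 + x)⁻² on a velocity and (1 + x)⁻¹ on a
gradient, the weights of the local energy. -/
lemma exists_abs_stepDeriv_le : ∃ K, 0 ≤ K ∧ ∀ x, 0 < x → |stepDeriv R x| ≤ K * decay x ^ 3 := by
  obtain ⟨K, hK0, hK⟩ := exists_bound_stepDeriv
  refine ⟨K * R⁻¹ * (1 + 2 * R) ^ 3, by positivity, fun x hx => ?_⟩
  have hd := decay_pos hx
  by_cases h : x ≤ R ∨ 2 * R ≤ x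
  · rw [stepDeriv_eq_zero hR h, abs_zero]
    positivity
  · push Not at h
    have h1 : 1 ≤ ((1 + 2 * R) * decay x) ^ 3 := one_le_pow₀ (one_le_mul_decay hx h.2.le)
    calc |stepDeriv R x| ≤ K * x⁻¹ := hK R x hR hx
      _ ≤ K * R⁻¹ * 1 := by
        rw [mul_one]
        exact mul_le_mul_of_nonneg_left (inv_anti₀ hR h.1.le) hK0
      _ ≤ K * R⁻¹ * ((1 + 2 * R) * decay x) ^ 3 := mul_le_mul_of_nonneg_left h1 (by positivity)
      _ = _ := by ring

end Weights

lemma exists_withLp_equiv {E₁ E₂ H : Type*} [NormedAddCommGroup E₁] [NormedSpace ℂ E₁]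
    [NormedAddCommGroup E₂] [NormedSpace ℂ E₂] [NormedAddCommGroup H] [NormedSpace ℂ H]
    (J₀ : E₁ ≃L[ℂ] E₂) : ∃ J : WithLp 2 (E₁ × H) ≃L[ℂ] WithLp 2 (E₂ × H),
      ∀ f, (J f).fst = J₀ f.fst ∧ (J f).snd = f.snd :=
  ⟨(WithLp.prodContinuousLinearEquiv 2 ℂ E₁ H).trans
    ((J₀.prodCongr (ContinuousLinearEquiv.refl ℂ H)).trans
      (WithLp.prodContinuousLinearEquiv 2 ℂ E₂ H).symm), fun _ => ⟨rfl, rfl⟩⟩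

/-- Multiplication by the smooth cutoff at radius `r` on `L²`. -/
noncomputable def stepL (r : ℝ) : HL2 →L[ℂ] HL2 :=
  mulL (step r) (continuous_step r).aestronglyMeasurable 1 fun x _ => by
    rw [abs_of_nonneg (step_nonneg r x)]
    exact step_le_one r x

lemma coeFn_stepL (r : ℝ) (f : HL2) : stepL r f =ᵐ[halfLine] fun x => (step r x : ℂ) * f x :=
  coeFn_mulL _ _ _ _

/-- Multiplication by the derivative of the smooth cutoff at radius `r` on `L²`. -/
noncomputable def stepDerivL {r : ℝ} (hr : 0 < r) : HL2 →L[ℂ] HL2 :=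
  mulL (stepDeriv r) (continuous_stepDeriv r).aestronglyMeasurable
    (exists_abs_stepDeriv_le hr).choose fun x hx =>
      ((exists_abs_stepDeriv_le hr).choose_spec.2 x hx).trans
        (mul_le_of_le_one_right (exists_abs_stepDeriv_le hr).choose_spec.1 (decay_pow_le_one hx 3))

lemma coeFn_stepDerivL {r : ℝ} (hr : 0 < r) (f : HL2) :
    stepDerivL hr f =ᵐ[halfLine] fun x => (stepDeriv r x : ℂ) * f x :=
  coeFn_mulL _ _ _ _

lemma inner_mul_real {a b : HL2} {F G : HL2} {m n m' n' : ℝ → ℝ}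
    (ha : a =ᵐ[halfLine] fun x => (m x : ℂ) * F x) (hb : b =ᵐ[halfLine] fun x => (n x : ℂ) * G x)
    {a' b' : HL2} (ha' : a' =ᵐ[halfLine] fun x => (m' x : ℂ) * F x)
    (hb' : b' =ᵐ[halfLine] fun x => (n' x : ℂ) * G x) (h : ∀ x, 0 < x → m x * n x = m' x * n' x) :
    inner ℂ a b = inner ℂ a' b' := by
  rw [L2.inner_def, L2.inner_def]
  refine integral_congr_ae ?_
  filter_upwards [ha, hb, ha', hb', ae_restrict_mem measurableSet_Ioi] with x e1 e2 e3 e4 hx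
  rw [e1, e2, e3, e4]
  simp only [RCLike.inner_apply, map_mul, Complex.conj_ofReal]
  have e : (m x : ℂ) * n x = m' x * n' x := by exact_mod_cast h x hx
  linear_combination (G x * starRingEnd ℂ (F x)) * e

lemma inner_stepL (r : ℝ) (f g : HL2) : inner ℂ (stepL r f) g = inner ℂ f (stepL r g) :=
  inner_mul_real (coeFn_stepL r f) (n := fun _ => 1) (Eventually.of_forall fun x => by simp)
    (m' := fun _ => 1) (Eventually.of_forall fun x => by simp) (coeFn_stepL r g) fun x _ => mul_comm _ _

lemma norm_le_of_ae_eq {a b : HL2} {F : ℝ → ℂ} {m n : ℝ → ℝ} (ha : a =ᵐ[halfLine] fun x => (m x : ℂ) * F x)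
    (hb : b =ᵐ[halfLine] fun x => (n x : ℂ) * F x) {K : ℝ} (h : ∀ x, 0 < x → |m x| ≤ K * |n x|) :
    ‖a‖ ≤ K * ‖b‖ := by
  refine Lp.norm_le_mul_norm_of_ae_le_mul ?_
  filter_upwards [ha, hb, ae_restrict_mem measurableSet_Ioi] with x e1 e2 hx
  rw [e1, e2, norm_mul, norm_mul, Complex.norm_real, Complex.norm_real, ← mul_assoc]
  exact mul_le_mul_of_nonneg_right (h x hx) (norm_nonneg _)

/-- One factor (1 + x)⁻¹ is moved to b; the remaining (1 + x)⁻² stays with a. -/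
lemma exists_norm_inner_stepDerivL_le {r : ℝ} (hr : 0 < r) : ∃ K, 0 ≤ K ∧ ∀ a b : HL2,
    ‖inner ℂ (stepDerivL hr a) b‖ ≤ K * (‖localVel a‖ * ‖decayL b‖) := by
  obtain ⟨K, hK0, hK⟩ := exists_abs_stepDeriv_le hr
  have hK' : ∀ x, 0 < x → |stepDeriv r x * (decay x)⁻¹| ≤ K * |decay x ^ 2| := fun x hx => by
    have hd := decay_pos hx
    rw [abs_mul, abs_of_pos (inv_pos.2 hd), abs_of_pos (pow_pos hd 2), ← div_eq_mul_inv,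
      div_le_iff₀ hd, mul_assoc, ← pow_succ]
    exact hK x hx
  have hc : ContinuousOn (fun x => stepDeriv r x * (decay x)⁻¹) (Ioi 0) :=
    (continuous_stepDeriv r).continuousOn.mul
      (continuousOn_decay.inv₀ fun x hx => (decay_pos hx).ne')
  have hm := hc.aestronglyMeasurable (μ := volume) measurableSet_Ioi
  have hb : ∀ x, 0 < x → |stepDeriv r x * (decay x)⁻¹| ≤ K := fun x hx => by
    refine (hK' x hx).trans (mul_le_of_le_one_right hK0 ?_)
    rw [abs_of_pos (pow_pos (decay_pos hx) 2)]
    exact decay_pow_le_one hx 2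
  refine ⟨K, hK0, fun a b => ?_⟩
  rw [inner_mul_real (coeFn_stepDerivL hr a) (b := b) (n := fun _ => 1) (G := b)
    (Eventually.of_forall fun x => by simp) (coeFn_mulL hm K hb a) (coeFn_decayL b) fun x hx => by
      have := (decay_pos hx).ne'
      field_simp]
  refine (norm_inner_le_norm _ _).trans ?_
  rw [← mul_assoc]
  exact mul_le_mul_of_nonneg_right (norm_le_of_ae_eq (coeFn_mulL hm K hb a) (coeFn_localVel a) hK')
    (norm_nonneg _)

open scoped InnerProduct in
/-- The cutoff of the identity map between two energy spaces. -/
noncomputable def stepEnergy (q q' : ℝ → ℝ) (R : ℝ) : EnergySpace q →L[ℂ] EnergySpace q' :=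
  ((WithLp.prodContinuousLinearEquiv 2 ℂ (HDot q') HL2).symm :
      HDot q' × HL2 →L[ℂ] EnergySpace q') ∘L
    ((((HDot.derivL q')† ∘L stepL R ∘L HDot.derivL q + (HDot.potL q')† ∘L stepL R ∘L HDot.potL q) ∘L
      WithLp.fstL 2 ℂ (HDot q) HL2).prod (stepL R ∘L WithLp.sndL 2 ℂ (HDot q) HL2))

/-- `stepEnergy` does not multiply the first component by the cutoff χ but represents the energy
form with χ inside. Its pairings therefore involve χ symmetrically in the two potentials, and
derivatives of χ appear only when the equation is used. -/
lemma inner_stepEnergy (q q' : ℝ → ℝ) (R : ℝ) (f : EnergySpace q) (y : EnergySpace q') :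
    inner ℂ (stepEnergy q q' R f) y =
      inner ℂ (stepL R (HDot.derivL q f.fst)) (HDot.derivL q' y.fst) +
      inner ℂ (stepL R (HDot.potL q f.fst)) (HDot.potL q' y.fst) + inner ℂ (stepL R f.snd) y.snd := by
  rw [← ContinuousLinearMap.adjoint_inner_left (HDot.derivL q'),
    ← ContinuousLinearMap.adjoint_inner_left (HDot.potL q'), ← inner_add_left]
  exact WithLp.prod_inner_apply _ _

namespace IsAdmissible

variable {q q' : ℝ → ℝ} (hq : IsAdmissible q) (hq' : IsAdmissible q') {R : ℝ} (hR : 0 < R)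
  (h : ∀ x, R < x → q x = q' x)

section

include hq hq' hR h

/-- Below R the potential q' is O(x⁻²), which Hardy's inequality controls; beyond R it equals q. -/
lemma exists_sq_sqrt_le : ∃ C, 0 ≤ C ∧ ∀ x, 0 < x → √(q' x) ^ 2 ≤ C * (q x + (x ^ 2)⁻¹) := by
  obtain ⟨C, hC0, hC⟩ := hq'.bound
  refine ⟨C * (1 + 4 * R ^ 2) + 1, by positivity, fun x hx => ?_⟩
  have h1 := hq.pos x hx
  have h2 : 0 ≤ C * (1 + 4 * R ^ 2) := by positivity
  have h3 : 0 < (x ^ 2)⁻¹ := by positivity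
  rw [hq'.sq_sqrt hx]
  rcases le_or_gt x R with hxR | hxR
  · have h4 := (hC x hx).trans (mul_le_mul_of_nonneg_left (inv_sq_ge hR hx (by linarith)) hC0)
    rw [inv_pow] at h4
    nlinarith
  · rw [← h x hxR]
    nlinarith

-- χ vanishes wherever q and q' may differ, so q' may replace q in the product. What remains is (1 -
-- χ) √q', supported in x ≤ 2 R, where √q' = O(1/x).
omit hq in
lemma exists_abs_sqrt_sub_le :
    ∃ K, 0 ≤ K ∧ ∀ x, 0 < x → |√(q' x) - step R x * √(q x)| ≤ K * |decay x * x⁻¹| := by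
  obtain ⟨C, hC0, hC⟩ := hq'.bound
  refine ⟨(1 + 2 * R) ^ 2 * √(C * (1 + 4 * R ^ 2)), by positivity, fun x hx => ?_⟩
  have hd := decay_pos hx
  have e : step R x * √(q x) = step R x * √(q' x) := by
    rcases le_or_gt x R with hxR | hxR
    · rw [step_eq_zero hR hxR, zero_mul, zero_mul]
    · rw [h x hxR]
  have e2 : √(q' x) - step R x * √(q' x) = (1 - step R x) * √(q' x) := by ring
  rw [e, e2, abs_mul, abs_of_nonneg (Real.sqrt_nonneg _),
    abs_of_pos (show 0 < decay x * x⁻¹ by positivity)]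
  rcases le_total (2 * R) x with hxR | hxR
  · rw [step_eq_one hR hxR, sub_self, abs_zero, zero_mul]
    positivity
  have h1 : √(q' x) ≤ √(C * (1 + 4 * R ^ 2)) * x⁻¹ := by
    rw [← Real.sqrt_sq (inv_pos.2 hx).le, ← Real.sqrt_mul (by positivity), mul_assoc]
    exact Real.sqrt_le_sqrt ((hC x hx).trans (mul_le_mul_of_nonneg_left (inv_sq_ge hR hx hxR) hC0))
  have h2 : |1 - step R x| ≤ (1 + 2 * R) ^ 2 * decay x := (abs_one_sub_step_le hR hx).trans
    (mul_le_mul_of_nonneg_left (by nlinarith [decay_le_one hx]) (by positivity))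
  refine (mul_le_mul h2 h1 (Real.sqrt_nonneg _) (by positivity)).trans (le_of_eq (by ring))

lemma exists_abs_sub_le : ∃ K, 0 ≤ K ∧ ∀ x, 0 < x → |q' x - q x| ≤ K * (decay x * x⁻¹) ^ 2 := by
  obtain ⟨C, hC0, hC⟩ := hq.bound
  obtain ⟨C', hC0', hC'⟩ := hq'.bound
  refine ⟨(C + C') * (1 + 4 * R ^ 2) * (1 + 2 * R) ^ 2, by positivity, fun x hx => ?_⟩
  rcases le_or_gt x R with hxR | hxR
  · have h0 : |q' x - q x| ≤ (C + C') * (1 + (x ^ 2)⁻¹) := by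
      rw [abs_le]
      constructor <;> linarith [hC x hx, hC' x hx, hq.pos x hx, hq'.pos x hx]
    have h1 := inv_sq_ge hR hx (by linarith)
    have h2 : 1 ≤ ((1 + 2 * R) * decay x) ^ 2 := one_le_pow₀ (one_le_mul_decay hx (by linarith))
    calc |q' x - q x| ≤ (C + C') * ((1 + 4 * R ^ 2) * x⁻¹ ^ 2) :=
          h0.trans (mul_le_mul_of_nonneg_left h1 (by positivity))
      _ ≤ (C + C') * ((1 + 4 * R ^ 2) * x⁻¹ ^ 2) * ((1 + 2 * R) * decay x) ^ 2 :=
          le_mul_of_one_le_right (by positivity) h2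
      _ = _ := by ring
  · rw [h x hxR, sub_self, abs_zero]
    positivity

lemma exists_hDot_equiv : ∃ J : HDot q ≃L[ℂ] HDot q', ∀ w, (J w).toFun = w.toFun := by
  obtain ⟨C, hC0, hC⟩ := hq.exists_sq_sqrt_le hq' hR h
  obtain ⟨C', hC0', hC'⟩ := hq'.exists_sq_sqrt_le hq hR fun x hx => (h x hx).symm
  exact ⟨ContinuousLinearEquiv.equivOfInverse
    (HDot.incl q q' hq'.aestronglyMeasurable C hC0 hC) (HDot.incl q' q hq.aestronglyMeasurable C' hC0' hC')
    (fun w => HDot.ext_toFun fun x _ => by rw [HDot.toFun_incl, HDot.toFun_incl])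
    (fun w => HDot.ext_toFun fun x _ => by rw [HDot.toFun_incl, HDot.toFun_incl]),
    fun w => HDot.toFun_incl _ _ _ _ _ _ w⟩

/-- The energy spaces of two potentials which agree near infinity consist of the same functions. -/
lemma exists_equiv : ∃ J : EnergySpace q ≃L[ℂ] EnergySpace q',
    ∀ f, (J f).fst.toFun = f.fst.toFun ∧ (J f).snd = f.snd := by
  obtain ⟨J₀, hJ₀⟩ := hq.exists_hDot_equiv hq' hR h
  obtain ⟨J, hJ⟩ := exists_withLp_equiv (H := HL2) J₀
  exact ⟨J, fun f => ⟨by rw [(hJ f).1, hJ₀], (hJ f).2⟩⟩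

end

section

include h

/-- The weak form of the cut off operator on the energy space. -/
lemma inner_stepL_energyLift (g k : HL2) :
    inner ℂ (stepL R (HDot.derivL q (hq.energyLift g))) (HDot.derivL q' (hq'.energyLift k)) +
      inner ℂ (stepL R (HDot.potL q (hq.energyLift g))) (HDot.potL q' (hq'.energyLift k)) =
    inner ℂ (stepL R (hq.resolvent g)) (k - hq'.resolvent k) -
      inner ℂ (stepDerivL hR (hq.resolvent g)) (HDot.derivL q' (hq'.energyLift k)) := by
  obtain ⟨K, hK0, hK⟩ := exists_bound_stepDeriv
  have hqq : ∀ x, 0 < x → step R x ≠ 0 → q x = q' x := fun x _ hx =>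
    h x (not_le.1 fun hxR => hx (step_eq_zero hR hxR))
  -- χ times the solution for q lies in the form domain of q', because χ vanishes where the
  -- potentials may differ.
  let w : HDot (formPotential q') := HDot.cutoff (step R) (stepDeriv R) (hasDerivAt_step R)
    (continuous_stepDeriv R) (fun x => by rw [abs_of_nonneg (step_nonneg R x)]; exact step_le_one R x) K
    (fun x hx => hK R x hR hx) (fun x hx hx' => congrArg (· + 1) (hqq x hx hx').symm) (hq.lift g)
  have hw : ∀ x, 0 < x → w.toFun x = (step R x : ℂ) * (hq.lift g).toFun x := fun x hx =>
    HDot.toFun_cutoff _ _ _ _ _ _ _ hx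
  have hwd : HDot.derivL _ w =ᵐ[halfLine] fun x => (stepDeriv R x : ℂ) * (hq.lift g).toFun x +
    (step R x : ℂ) * deriv (hq.lift g).toFun x := HDot.coeFn_derivL_cutoff _ _ _ _ _ _ _
  have e1 : hq'.embL w = stepL R (hq.resolvent g) := by
    refine Lp.ext ?_
    filter_upwards [hq'.coeFn_embL w, coeFn_stepL R (hq.resolvent g), hq.coeFn_embL (hq.lift g),
      ae_restrict_mem measurableSet_Ioi] with x h1 h2 h3 hx
    rw [h1, h2, hw x hx, resolvent, ContinuousLinearMap.comp_apply, h3]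
  have e2 : HDot.derivL q' (hq'.toEnergy w) =
      stepDerivL hR (hq.resolvent g) + stepL R (HDot.derivL q (hq.energyLift g)) := by
    rw [hq'.derivL_toEnergy]
    refine Lp.ext ?_
    filter_upwards [hwd, coeFn_stepL R (HDot.derivL q (hq.energyLift g)), hq.coeFn_embL (hq.lift g),
      coeFn_stepDerivL hR (hq.resolvent g), HDot.coeFn_derivL (hq.energyLift g),
      Lp.coeFn_add (stepDerivL hR (hq.resolvent g)) (stepL R (HDot.derivL q (hq.energyLift g)))]
      with x h1 h2 h3 h4 h5 h6
    rw [h1, h6, Pi.add_apply, h2, h4, h5, toFun_energyLift, resolvent, ContinuousLinearMap.comp_apply, h3]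
  have e3 : HDot.potL q' (hq'.toEnergy w) = stepL R (HDot.potL q (hq.energyLift g)) := by
    refine Lp.ext ?_
    filter_upwards [HDot.coeFn_potL (hq'.toEnergy w), coeFn_stepL R (HDot.potL q (hq.energyLift g)),
      HDot.coeFn_potL (hq.energyLift g), ae_restrict_mem measurableSet_Ioi] with x h1 h2 h3 hx
    rw [h1, h2, h3, toFun_energyLift, toFun_toEnergy, hw x hx]
    by_cases hs : step R x = 0
    · simp [hs]
    · rw [hqq x hx hs, mul_left_comm]
  -- The weak equation for the second operator, tested with w; the product rule for w' produces the
  -- term with χ'.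
  have e4 : inner ℂ (hq'.toEnergy w) (hq'.energyLift k) =
      inner ℂ (hq'.embL w) (k - hq'.resolvent k) := by
    rw [energyLift, ContinuousLinearMap.comp_apply, hq'.inner_toEnergy, inner_sub_right,
      ← inner_conj_symm w, hq'.inner_lift, inner_conj_symm]
    rfl
  rw [HDot.inner_eq, e1, e2, e3, inner_add_left] at e4
  rw [← e4]
  ring

end

section

include hq hq' hR h

/-- The cut off operator is only known through its pairings, so y = J f - P f is paired with itself.
All resulting factors carry 1 - χ or √q' - χ √q, supported in x ≤ 2 R, and one power of ‖y‖ cancels.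
-/
lemma exists_norm_sub_stepEnergy_le {J : EnergySpace q →L[ℂ] EnergySpace q'}
    (hJ : ∀ f, (J f).fst.toFun = f.fst.toFun ∧ (J f).snd = f.snd) :
    ∃ C, 0 ≤ C ∧ ∀ f, ‖J f - stepEnergy q q' R f‖ ≤ C * ‖hq.localL f‖ := by
  obtain ⟨K, hK0, hK⟩ := hq'.exists_abs_sqrt_sub_le hR h
  set M := (1 + 2 * R) ^ 2
  have hM0 : 0 ≤ M := by positivity
  refine ⟨M + K + M, by positivity, fun f => ?_⟩
  set y := J f - stepEnergy q q' R f with hy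
  have hD : HDot.derivL q' (J f).fst = HDot.derivL q f.fst := HDot.derivL_congr _ _ (hJ f).1
  have b1 : ‖HDot.derivL q f.fst - stepL R (HDot.derivL q f.fst)‖ ≤ M * ‖hq.localL f‖ := by
    refine le_trans (norm_le_of_ae_eq (m := fun x => 1 - step R x) ?_ (coeFn_decayL _) fun x hx => ?_)
      (mul_le_mul_of_nonneg_left (hq.norm_decayL_derivL_le f) hM0)
    · filter_upwards [Lp.coeFn_sub (HDot.derivL q f.fst) (stepL R (HDot.derivL q f.fst)),
        coeFn_stepL R (HDot.derivL q f.fst)] with x h1 h2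
      rw [h1, Pi.sub_apply, h2]
      push_cast
      ring
    · have hd := decay_pos hx
      rw [abs_of_pos hd]
      exact (abs_one_sub_step_le hR hx).trans
        (mul_le_mul_of_nonneg_left (by nlinarith [decay_le_one hx]) hM0)
  have b2 : ‖HDot.potL q' (J f).fst - stepL R (HDot.potL q f.fst)‖ ≤ K * ‖hq.localL f‖ := by
    refine le_trans (norm_le_of_ae_eq (m := fun x => √(q' x) - step R x * √(q x)) ?_
      (hq.coeFn_localMul f.fst) hK) (mul_le_mul_of_nonneg_left (hq.norm_localMul_le f) hK0)
    filter_upwards [Lp.coeFn_sub (HDot.potL q' (J f).fst) (stepL R (HDot.potL q f.fst)),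
      coeFn_stepL R (HDot.potL q f.fst), HDot.coeFn_potL f.fst, HDot.coeFn_potL (J f).fst] with x h1 h2 h3 h4
    rw [h1, Pi.sub_apply, h2, h3, h4, (hJ f).1]
    push_cast
    ring
  have b3 : ‖f.snd - stepL R f.snd‖ ≤ M * ‖hq.localL f‖ := by
    refine le_trans (norm_le_of_ae_eq (m := fun x => 1 - step R x) ?_ (coeFn_localVel _) fun x hx => ?_)
      (mul_le_mul_of_nonneg_left (hq.norm_localVel_le f) hM0)
    · filter_upwards [Lp.coeFn_sub f.snd (stepL R f.snd), coeFn_stepL R f.snd] with x h1 h2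
      rw [h1, Pi.sub_apply, h2]
      push_cast
      ring
    · rw [abs_of_pos (pow_pos (decay_pos hx) 2)]
      exact abs_one_sub_step_le hR hx
  have n0 : ‖y.fst‖ ≤ ‖y‖ := WithLp.norm_fst_le _ y
  have n1 : ‖HDot.derivL q' y.fst‖ ≤ ‖y‖ := (HDot.norm_derivL_le y.fst).trans n0
  have n2 : ‖HDot.potL q' y.fst‖ ≤ ‖y‖ := (HDot.norm_potL_le y.fst).trans n0
  have n3 : ‖y.snd‖ ≤ ‖y‖ := WithLp.norm_snd_le _ y
  have key : inner ℂ y y =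
      inner ℂ (HDot.derivL q f.fst - stepL R (HDot.derivL q f.fst)) (HDot.derivL q' y.fst) +
      inner ℂ (HDot.potL q' (J f).fst - stepL R (HDot.potL q f.fst)) (HDot.potL q' y.fst) +
      inner ℂ (f.snd - stepL R f.snd) y.snd := by
    have e : inner ℂ (J f) y = inner ℂ (HDot.derivL q f.fst) (HDot.derivL q' y.fst) +
        inner ℂ (HDot.potL q' (J f).fst) (HDot.potL q' y.fst) + inner ℂ f.snd y.snd := by
      rw [← hD, ← HDot.inner_eq, ← (hJ f).2]
      exact WithLp.prod_inner_apply _ _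
    conv_lhs => rw [hy, inner_sub_left, ← hy, e, inner_stepEnergy]
    simp only [inner_sub_left]
    ring
  have h2 : ‖y‖ ^ 2 ≤ (M + K + M) * ‖hq.localL f‖ * ‖y‖ := by
    have hL : 0 ≤ ‖hq.localL f‖ := norm_nonneg _
    calc ‖y‖ ^ 2 = ‖(inner ℂ y y : ℂ)‖ := by
          rw [inner_self_eq_norm_sq_to_K, norm_pow, RCLike.norm_ofReal, abs_of_nonneg (norm_nonneg _)]
      _ ≤ M * ‖hq.localL f‖ * ‖y‖ + K * ‖hq.localL f‖ * ‖y‖ + M * ‖hq.localL f‖ * ‖y‖ := by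
          rw [key]
          refine (norm_add₃_le).trans (add_le_add (add_le_add ?_ ?_) ?_)
          · exact (norm_inner_le_norm _ _).trans (mul_le_mul b1 n1 (norm_nonneg _) (by positivity))
          · exact (norm_inner_le_norm _ _).trans (mul_le_mul b2 n2 (norm_nonneg _) (by positivity))
          · exact (norm_inner_le_norm _ _).trans (mul_le_mul b3 n3 (norm_nonneg _) (by positivity))
      _ = _ := by ring
  rcases (norm_nonneg y).eq_or_lt with h0 | h0
  · rw [← h0]
    positivity
  · rw [sq] at h2
    exact le_of_mul_le_mul_right h2 h0

/-- The two energies differ only by the integral of (q' - q) |w|², which lives on x ≤ R and is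
bounded there by the weight ((1 + x) x)⁻². -/
lemma exists_abs_norm_sq_sub_le {J : EnergySpace q →L[ℂ] EnergySpace q'}
    (hJ : ∀ f, (J f).fst.toFun = f.fst.toFun ∧ (J f).snd = f.snd) :
    ∃ C, 0 ≤ C ∧ ∀ f, |‖J f‖ ^ 2 - ‖f‖ ^ 2| ≤ C * ‖hq.localL f‖ ^ 2 := by
  obtain ⟨K, hK0, hK⟩ := hq.exists_abs_sub_le hq' hR h
  refine ⟨K, hK0, fun f => ?_⟩
  have hD : HDot.derivL q' (J f).fst = HDot.derivL q f.fst := HDot.derivL_congr _ _ (hJ f).1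
  have e1 : ‖J f‖ ^ 2 - ‖f‖ ^ 2 = ‖HDot.potL q' (J f).fst‖ ^ 2 - ‖HDot.potL q f.fst‖ ^ 2 := by
    rw [WithLp.prod_norm_sq_eq_of_L2 (J f), WithLp.prod_norm_sq_eq_of_L2 f, HDot.norm_sq_eq,
      HDot.norm_sq_eq, hD, (hJ f).2]
    ring
  rw [e1]
  refine le_trans ?_ (mul_le_mul_of_nonneg_left
    (pow_le_pow_left₀ (norm_nonneg _) (hq.norm_localMul_le f) 2) hK0)
  rw [norm_sq_HL2, norm_sq_HL2, norm_sq_HL2, ← integral_sub (integrableOn_norm_sq (Lp.memLp _))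
    (integrableOn_norm_sq (Lp.memLp _)), ← integral_const_mul, ← Real.norm_eq_abs]
  refine norm_integral_le_of_norm_le ((integrableOn_norm_sq (Lp.memLp _)).const_mul K) ?_
  filter_upwards [HDot.coeFn_potL f.fst, HDot.coeFn_potL (J f).fst, hq.coeFn_localMul f.fst,
    ae_restrict_mem measurableSet_Ioi] with x h1 h2 h3 hx
  rw [h1, h2, h3, (hJ f).1]
  simp only [norm_mul, mul_pow, Complex.norm_real, Real.norm_eq_abs, sq_abs, hq.sq_sqrt hx,
    hq'.sq_sqrt hx]
  rw [← sub_mul, abs_mul, abs_of_nonneg (sq_nonneg ‖f.fst.toFun x‖), ← mul_assoc, ← mul_pow]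
  exact mul_le_mul_of_nonneg_right (hK x hx) (sq_nonneg _)

/-- The sum is the time derivative of ⟨P u₁, u₂⟩. The weak identity is applied once as it stands and
once with the operators exchanged and conjugated; everything cancels except two terms with χ', each
pairing a velocity of one solution with the gradient of the other. -/
lemma exists_norm_inner_stepEnergy_add_le : ∃ C, 0 ≤ C ∧ ∀ g g' k k' : HL2,
    ‖inner ℂ (stepEnergy q q' R (WithLp.toLp 2 (hq.energyLift g', hq.resolvent g - g)))
        (WithLp.toLp 2 (hq'.energyLift k, hq'.resolvent k')) +
      inner ℂ (stepEnergy q q' R (WithLp.toLp 2 (hq.energyLift g, hq.resolvent g')))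
        (WithLp.toLp 2 (hq'.energyLift k', hq'.resolvent k - k))‖ ≤
    C * (‖hq.localL (WithLp.toLp 2 (hq.energyLift g, hq.resolvent g'))‖ *
      ‖hq'.localL (WithLp.toLp 2 (hq'.energyLift k, hq'.resolvent k'))‖) := by
  obtain ⟨K, hK0, hK⟩ := exists_norm_inner_stepDerivL_le hR
  refine ⟨2 * K, by positivity, fun g g' k k' => ?_⟩
  have i1 := hq.inner_stepL_energyLift hq' hR h g' k
  have i2 := congrArg (starRingEnd ℂ)
    (hq'.inner_stepL_energyLift hq hR (fun x hx => (h x hx).symm) k' g)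
  simp only [map_add, map_sub, inner_conj_symm] at i2
  rw [← inner_stepL, ← inner_stepL, ← inner_stepL] at i2
  have e : inner ℂ (stepEnergy q q' R (WithLp.toLp 2 (hq.energyLift g', hq.resolvent g - g)))
        (WithLp.toLp 2 (hq'.energyLift k, hq'.resolvent k')) +
      inner ℂ (stepEnergy q q' R (WithLp.toLp 2 (hq.energyLift g, hq.resolvent g')))
        (WithLp.toLp 2 (hq'.energyLift k', hq'.resolvent k - k)) =
      -(inner ℂ (stepDerivL hR (hq.resolvent g')) (HDot.derivL q' (hq'.energyLift k)) +
        inner ℂ (HDot.derivL q (hq.energyLift g)) (stepDerivL hR (hq'.resolvent k'))) := by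
    rw [inner_stepEnergy, inner_stepEnergy]
    change inner ℂ (stepL R (HDot.derivL q (hq.energyLift g'))) (HDot.derivL q' (hq'.energyLift k)) +
        inner ℂ (stepL R (HDot.potL q (hq.energyLift g'))) (HDot.potL q' (hq'.energyLift k)) +
        inner ℂ (stepL R (hq.resolvent g - g)) (hq'.resolvent k') +
      (inner ℂ (stepL R (HDot.derivL q (hq.energyLift g))) (HDot.derivL q' (hq'.energyLift k')) +
        inner ℂ (stepL R (HDot.potL q (hq.energyLift g))) (HDot.potL q' (hq'.energyLift k')) +
        inner ℂ (stepL R (hq.resolvent g')) (hq'.resolvent k - k)) = _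
    rw [i1, i2, ← neg_sub k, inner_neg_right, ← neg_sub g, map_neg, inner_neg_left]
    ring
  rw [e, norm_neg]
  have hf : ∀ (g g' : HL2), ‖decayL (HDot.derivL q (hq.energyLift g))‖ ≤
      ‖hq.localL (WithLp.toLp 2 (hq.energyLift g, hq.resolvent g'))‖ := fun g g' =>
    hq.norm_decayL_derivL_le (WithLp.toLp 2 (hq.energyLift g, hq.resolvent g'))
  have c1 := hK (hq.resolvent g') (HDot.derivL q' (hq'.energyLift k))
  have c2 := hK (hq'.resolvent k') (HDot.derivL q (hq.energyLift g))
  rw [← inner_conj_symm, RCLike.norm_conj] at c2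
  have d1 := hq.norm_localVel_le (WithLp.toLp 2 (hq.energyLift g, hq.resolvent g'))
  have d2 := hq'.norm_localVel_le (WithLp.toLp 2 (hq'.energyLift k, hq'.resolvent k'))
  have d3 := hq.norm_decayL_derivL_le (WithLp.toLp 2 (hq.energyLift g, hq.resolvent g'))
  have d4 := hq'.norm_decayL_derivL_le (WithLp.toLp 2 (hq'.energyLift k, hq'.resolvent k'))
  have m1 := mul_le_mul d1 d4 (norm_nonneg _) (norm_nonneg _)
  have m2 := mul_le_mul d3 d2 (norm_nonneg _) (norm_nonneg _)
  rw [mul_comm ‖decayL _‖] at m2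
  calc _ ≤ _ := norm_add_le _ _
    _ ≤ _ := add_le_add (c1.trans (mul_le_mul_of_nonneg_left m1 hK0))
        (c2.trans (mul_le_mul_of_nonneg_left m2 hK0))
    _ = _ := by ring

lemma exists_isLocalPerturbation {J : EnergySpace q →L[ℂ] EnergySpace q'}
    (hJ : ∀ f, (J f).fst.toFun = f.fst.toFun ∧ (J f).snd = f.snd) :
    ∃ C, IsLocalPerturbation hq.resolvent hq'.resolvent hq.energyLift hq'.energyLift hq.localL hq'.localL
      J (stepEnergy q q' R) C := by
  obtain ⟨C₁, h₁, hC₁⟩ := hq.exists_norm_sub_stepEnergy_le hq' hR h hJ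
  obtain ⟨C₂, h₂, hC₂⟩ := hq.exists_abs_norm_sq_sub_le hq' hR h hJ
  obtain ⟨C₃, h₃, hC₃⟩ := hq.exists_norm_inner_stepEnergy_add_le hq' hR h
  exact ⟨C₁ + C₂ + C₃, by positivity,
    fun f => (hC₁ f).trans (mul_le_mul_of_nonneg_right (by linarith) (norm_nonneg _)),
    fun f => (hC₂ f).trans (mul_le_mul_of_nonneg_right (by linarith) (by positivity)),
    fun g g' k k' => (hC₃ g g' k k').trans (mul_le_mul_of_nonneg_right (by linarith) (by positivity))⟩

end

end IsAdmissible
end HalfLineWave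

theorem mainTheorem5 (lam₁ lam₂ : ℝ) (q₁ q₂ : ℝ → ℝ)
    (hlam₁ : lam₁ = 0 ∨ 3 / 4 ≤ lam₁) (hlam₂ : lam₂ = 0 ∨ 3 / 4 ≤ lam₂)
    (hq₁ : IsRepulsive q₁) (hq₂ : IsRepulsive q₂)
    (hg₁ : GrowthAtZero q₁) (hg₂ : GrowthAtZero q₂)
    (R : ℝ) (hR : 0 < R)
    (hcoincide : ∀ x, R < x → potential lam₁ q₁ x = potential lam₂ q₂ x) :
    -- `J` identifies the two energy spaces, which consist of the same pairs of functions
    ∃ J : EnergySpace (potential lam₁ q₁) ≃L[ℂ] EnergySpace (potential lam₂ q₂),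
      (∀ f, (J f).fst.toFun = f.fst.toFun ∧ (J f).snd = f.snd) ∧
      ∃ T : EnergySpace (potential lam₁ q₁) ≃ₗᵢ[ℂ] EnergySpace (potential lam₂ q₂),
        ∀ f, Tendsto
          (fun t : ℝ => wavePropagator lam₂ q₂ (-t) (J (wavePropagator lam₁ q₁ t f)))
          atTop (𝓝 (T f)) := by
  have a₁ := isAdmissible_potential hlam₁ hq₁ hg₁
  have a₂ := isAdmissible_potential hlam₂ hq₂ hg₂
  have p₁ := a₁.isResolventPair hlam₁ hq₁ hg₁
  have p₂ := a₂.isResolventPair hlam₂ hq₂ hg₂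
  obtain ⟨B₁, c₁, m₁⟩ := a₁.exists_isMultiplier hlam₁ hq₁ hg₁
  obtain ⟨B₂, c₂, m₂⟩ := a₂.exists_isMultiplier hlam₂ hq₂ hg₂
  obtain ⟨J, hJ⟩ := a₁.exists_equiv a₂ hR hcoincide
  have hJ' : ∀ f, (J.symm f).fst.toFun = f.fst.toFun ∧ (J.symm f).snd = f.snd := fun f => by
    have := hJ (J.symm f)
    rw [J.apply_symm_apply] at this
    exact ⟨this.1.symm, this.2.symm⟩
  obtain ⟨C, hC⟩ := a₁.exists_isLocalPerturbation a₂ hR hcoincide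
    (J := (J : EnergySpace (potential lam₁ q₁) →L[ℂ] EnergySpace (potential lam₂ q₂))) hJ
  -- The hypotheses are symmetric in the two operators, so the limit also exists in the opposite
  -- direction with the inverse of J.
  obtain ⟨C', hC'⟩ := a₂.exists_isLocalPerturbation a₁ hR (fun x hx => (hcoincide x hx).symm)
    (J := (J.symm : EnergySpace (potential lam₂ q₂) →L[ℂ] EnergySpace (potential lam₁ q₁))) hJ'
  obtain ⟨W, hW⟩ := hC.exists_tendsto p₁ p₂ m₁ m₂
  obtain ⟨W', hW'⟩ := hC'.exists_tendsto p₂ p₁ m₂ m₁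
  -- Surjectivity: the opposite limit W' f is a preimage of f under W.
  refine ⟨J, hJ, LinearIsometryEquiv.ofSurjective W fun f =>
    ⟨W' f, IsLocalPerturbation.apply_apply_of_tendsto p₁ p₂ J (hW _) (hW' f)⟩, fun f => ?_⟩
  simp only [a₁.wavePropagator_eq hlam₁ hq₁ hg₁, a₂.wavePropagator_eq hlam₂ hq₂ hg₂]
  exact hW f
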